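/- **Setting.** Let $n\ge 2$, let $M$ be a smooth (Hausdorff) $n$-manifold with a pseudo-Riemannian metric $\mathrm g=(\mathrm g_{ij})$, Levi-Civita connection $\nabla$, Ricci tensor $R_{ij}$ and scalar curvature $R$ (positive on round spheres). Let $\lambda,\mu\in\mathbb C$, $\delta=\mu-\lambda$, and assume the non-resonance condition $$\delta\notin\Big\{\tfrac2n,\ \tfrac{n+2}{2n},\ 1,\ \tfrac{n+1}{n},\ \tfrac{n+2}{n}\Big\}.$$ $\mathcal F_\lambda$ is the space of smooth complex $\lambda$-densities on $M$ (sections of $|\Lambda^nT^*M|^{\otimes\lambda}$), $\mathcal D^2_{\lambda,\mu}$ the space of differential operators $\mathcal F_\lambda\to\mathcal F_\mu$ of order $\le 2$, and $\mathcal S^2_\delta$ the space of symbols $P(\xi)=P_2^{ij}\xi_i\xi_j+P_1^i\xi_i+P_0$ ($P_2$ symmetric) on $T^*M$ with values in $\delta$-densities. A quantization map is a linear map $\mathcal Q_{\lambda,\mu}:\mathcal S^2_\delta\to\mathcal D^2_{\lambda,\mu}$; for $\hbar\in\mathbb R$ put $\mathcal Q_{\lambda,\mu;\hbar}(P)=\mathcal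 Q_{\lambda,\mu}(P(i\hbar\,\cdot\,))$. We consider the map $\mathcal Q_{\lambda,\mu}$ in either of the following situations. (a) $n\ge3$, $(M,\mathrm g)$ arbitrary, and $$\mathcal Q_{\lambda,\mu}(P)=P_2^{ij}\nabla_i\nabla_j+\big(\beta_1\nabla_iP_2^{ij}+\beta_2\,\mathrm g^{ij}\mathrm g_{k\ell}\nabla_iP_2^{k\ell}\big)\nabla_j+\beta_3\nabla_i\nabla_jP_2^{ij}+\beta_4\,\mathrm g^{ij}\mathrm g_{k\ell}\nabla_i\nabla_jP_2^{k\ell}+\beta_5R_{ij}P_2^{ij}+\beta_6R\,\mathrm g_{ij}P_2^{ij}+P_1^i\nabla_i+\alpha\nabla_iP_1^i+P_0,$$ where $\nabla$ acts on densities and density-valued tensors, $\alpha=\frac{\lambda}{1-\delta}$, $\beta_1=\frac{2(n\lambda+1)}{2+n(1-\delta)}$, $\beta_2=\frac{n(\lambda+\mu-1)}{(2+n(1-\delta))(2-n\delta)}$, $\beta_3=\frac{n\lambda(n\lambda+1)}{(1+n(1-\delta))(2+n(1-\delta))}$, $\beta_4=\frac{n\lambda(n^2\mu(2-\lambda-\mu)+2(n\lambda+1)^2-n(n+1))}{(1+n(1-\delta))(2+n(1-\delta))(2+n(1-2\delta))(2-n\delta)}$,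 $\beta_5=\frac{n^2\lambda(\mu-1)}{(n-2)(1+n(1-\delta))}$, $\beta_6=\frac{n^2\lambda(\mu-1)(n\delta-2)}{(n-1)(n-2)(1+n(1-\delta))(2+n(1-2\delta))}$. (b) $n=p+q\ge2$ and $(M,\mathrm g)$ is conformally flat: $M$ carries a covering family of (adapted) charts in each of which $\mathrm g=F\,\mathrm{diag}(1,\dots,1,-1,\dots,-1)$ ($p$ times $+1$, $q$ times $-1$) with $F>0$, and whose changes of coordinates preserve (locally) the Lie algebra $\mathrm o(p+1,q+1)$ of conformal vector fields on $\mathbb R^n$, spanned by $\partial_i$, $x_i\partial_j-x_j\partial_i$, $x^i\partial_i$, $x_jx^j\partial_i-2x_ix^j\partial_j$ (indices lowered with the flat metric); and $\mathcal Q_{\lambda,\mu}$ is a conformally equivariant quantization, i.e. a linear map $\mathcal S^2_\delta\to\mathcal D^2_{\lambda,\mu}$ preserving the principal symbol at each order and (locally) intertwining, in the adapted charts, the Lie derivatives of symbols and of differential operators along all vector fields of $\mathrm o(p+1,q+1)$. **Proposition.** Let $H=\mathrm g^{ij}\xi_i\xi_j$, regarded as the element $\mathrm g^{ij}\xi_i\xi_j\,|\mathrm{vol}_{\mathrm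 g}|^{\delta}$ of $\mathcal S^2_\delta$. In both situations $$\mathcal Q_{\lambda,\mu;\hbar}(H)=-\hbar^2\,(\Delta+C_{\lambda,\mu}R),\qquad C_{\lambda,\mu}=\frac{n^2\lambda(\mu-1)}{(n-1)(n+2-2n\delta)},$$ where $\Delta:\mathcal F_\lambda\to\mathcal F_\mu$ is $f|\mathrm{vol}_{\mathrm g}|^\lambda\mapsto(\Delta_{\mathrm g}f)|\mathrm{vol}_{\mathrm g}|^\mu$ with $\Delta_{\mathrm g}$ the Laplace–Beltrami operator, and $R$ acts by $f|\mathrm{vol}_{\mathrm g}|^\lambda\mapsto Rf|\mathrm{vol}_{\mathrm g}|^\mu$. The weights $\lambda=\mu=\frac12$ are non-resonant and $C_{\frac12,\frac12}=-\frac{n^2}{4(n-1)(n+2)}$, so that on half-densities $\mathcal Q_{\frac12,\frac12;\hbar}(H)=-\hbar^2\big(\Delta-\frac{n^2}{4(n-1)(n+2)}R\big)$. -/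

import Mathlib

open scoped Manifold ContDiff Matrix

noncomputable section

namespace ConfQuant

/-! ### Charts, partial derivatives, transition maps -/

/-- The model space `ℝⁿ`. -/
abbrev E (n : ℕ) := EuclideanSpace ℝ (Fin n)

/-- A smooth coordinate system on the manifold `M`: a chart of its maximal smooth atlas. -/
abbrev Chart (n : ℕ) (M : Type*) [TopologicalSpace M] [ChartedSpace (E n) M] :=
  {e : OpenPartialHomeomorph M (E n) // e ∈ IsManifold.maximalAtlas (𝓡 n) ∞ M}

/-- The partial derivative `∂ᵢ f`. -/
def pd {n : ℕ} {F : Type*} [NormedAddCommGroup F] [NormedSpace ℝ F]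
    (i : Fin n) (f : E n → F) (x : E n) : F :=
  fderiv ℝ f x (EuclideanSpace.single i 1)

section Manifold

variable (n : ℕ) (M : Type*) [TopologicalSpace M] [ChartedSpace (E n) M]

variable {n M}

/-- The domain, in the coordinates `e`, of the change of coordinates from `e` to `e'`. -/
def overlap (e e' : Chart n M) : Set (E n) := (e.1.symm.trans e'.1).source

/-- The change of coordinates from `e` to `e'`. -/
def transition (e e' : Chart n M) : E n → E n := fun x => e'.1 (e.1.symm x)

/-- The Jacobian matrix `∂x'ⁱ/∂xᵃ` of the change of coordinates from `e` to `e'`. -/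
def jac (e e' : Chart n M) (x : E n) : Matrix (Fin n) (Fin n) ℝ :=
  Matrix.of fun i a => (pd a (transition e e') x) i

/-- The complex power `|a| ^ w` for a real number `a` and a complex weight `w`. -/
def absPow (a : ℝ) (w : ℂ) : ℂ := ((|a| : ℝ) : ℂ) ^ w

variable (n M)

/-! ### Densities, symbols, metrics

Geometric objects are given by their components in all coordinate systems, related by the
tensorial transformation law. Components are `0` outside of the range of the coordinates, so that
two objects are equal exactly when they have the same components. -/

/-- The space `F_w(M)` of smooth complex-valued tensor densities of degree `w` on `M`,
i.e. sections of `|Λⁿ T*M|^w`. -/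
def Density (w : ℂ) : Submodule ℂ (Chart n M → E n → ℂ) where
  carrier := {φ | (∀ e, ∀ x ∉ e.1.target, φ e x = 0) ∧
    (∀ e, ContDiffOn ℝ ∞ (φ e) e.1.target) ∧
    (∀ e e', ∀ x ∈ overlap e e',
      φ e x = absPow (jac e e' x).det w * φ e' (transition e e' x))}
  add_mem' := by
    rintro φ ψ ⟨h1, h2, h3⟩ ⟨k1, k2, k3⟩
    refine ⟨fun e x hx => ?_, fun e => (h2 e).add (k2 e), fun e e' x hx => ?_⟩
    · simp [h1 e x hx, k1 e x hx]
    · simp only [Pi.add_apply]; rw [h3 e e' x hx, k3 e e' x hx]; ring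
  zero_mem' := ⟨fun _ _ _ => rfl, fun _ => contDiffOn_const, fun _ _ _ _ => by simp⟩
  smul_mem' := by
    rintro c φ ⟨h1, h2, h3⟩
    refine ⟨fun e x hx => ?_, fun e => (h2 e).const_smul c, fun e e' x hx => ?_⟩
    · simp [h1 e x hx]
    · simp only [Pi.smul_apply, smul_eq_mul]; rw [h3 e e' x hx]; ring

/-- Homogeneous first-order symbols `P₁ⁱ ξᵢ` with values in `w`-densities. -/
def Symbol1 (w : ℂ) : Submodule ℂ (Chart n M → E n → Fin n → ℂ) where
  carrier := {P | (∀ e, ∀ x ∉ e.1.target, P e x = 0) ∧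
    (∀ e i, ContDiffOn ℝ ∞ (fun x => P e x i) e.1.target) ∧
    (∀ e e', ∀ x ∈ overlap e e',
      (jac e e' x).map (fun r => (r : ℂ)) *ᵥ P e x
        = absPow (jac e e' x).det w • P e' (transition e e' x))}
  add_mem' := by
    rintro φ ψ ⟨h1, h2, h3⟩ ⟨k1, k2, k3⟩
    refine ⟨fun e x hx => ?_, fun e i => (h2 e i).add (k2 e i), fun e e' x hx => ?_⟩
    · simp [h1 e x hx, k1 e x hx]
    · simp only [Pi.add_apply]
      rw [Matrix.mulVec_add, h3 e e' x hx, k3 e e' x hx, smul_add]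
  zero_mem' := ⟨fun _ _ _ => rfl, fun _ _ => contDiffOn_const, fun _ _ _ _ => by simp⟩
  smul_mem' := by
    rintro c φ ⟨h1, h2, h3⟩
    refine ⟨fun e x hx => ?_, fun e i => (h2 e i).const_smul c, fun e e' x hx => ?_⟩
    · simp [h1 e x hx]
    · simp only [Pi.smul_apply]
      rw [Matrix.mulVec_smul, h3 e e' x hx, smul_comm]

/-- Homogeneous second-order symbols `P₂ⁱʲ ξᵢ ξⱼ` (with `P₂ⁱʲ` symmetric) with values in
`w`-densities. -/
def Symbol2 (w : ℂ) : Submodule ℂ (Chart n M → E n → Matrix (Fin n) (Fin n) ℂ) where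
  carrier := {P | (∀ e, ∀ x ∉ e.1.target, P e x = 0) ∧
    (∀ e i j, ContDiffOn ℝ ∞ (fun x => P e x i j) e.1.target) ∧
    (∀ e x, (P e x)ᵀ = P e x) ∧
    (∀ e e', ∀ x ∈ overlap e e',
      (jac e e' x).map (fun r => (r : ℂ)) * P e x * ((jac e e' x).map (fun r => (r : ℂ)))ᵀ
        = absPow (jac e e' x).det w • P e' (transition e e' x))}
  add_mem' := by
    rintro φ ψ ⟨h1, h2, hs, h3⟩ ⟨k1, k2, ks, k3⟩
    refine ⟨fun e x hx => ?_, fun e i j => (h2 e i j).add (k2 e i j), fun e x => ?_,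
      fun e e' x hx => ?_⟩
    · simp [h1 e x hx, k1 e x hx]
    · simp [hs, ks]
    · simp only [Pi.add_apply]
      rw [mul_add, add_mul, h3 e e' x hx, k3 e e' x hx, smul_add]
  zero_mem' := ⟨fun _ _ _ => rfl, fun _ _ _ => contDiffOn_const, fun _ _ => by simp,
    fun _ _ _ _ => by simp⟩
  smul_mem' := by
    rintro c φ ⟨h1, h2, hs, h3⟩
    refine ⟨fun e x hx => ?_, fun e i j => (h2 e i j).const_smul c, fun e x => ?_,
      fun e e' x hx => ?_⟩
    · simp [h1 e x hx]
    · simp [hs]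
    · simp only [Pi.smul_apply]
      rw [Matrix.mul_smul, Matrix.smul_mul, h3 e e' x hx, smul_comm]

/-- The space `S²_w(M)` of symbols `P(ξ) = P₂ⁱʲ ξᵢ ξⱼ + P₁ⁱ ξᵢ + P₀` of degree at most two with
values in `w`-densities; the components are `P.1 = P₂`, `P.2.1 = P₁`, `P.2.2 = P₀`. -/
abbrev Symbol (w : ℂ) := Symbol2 n M w × Symbol1 n M w × Density n M w

/-- The operator `P(ξ) ↦ P(i ħ ξ)` on symbols. -/
def symbolScale (w : ℂ) (hbar : ℝ) (P : Symbol n M w) : Symbol n M w :=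
  ((Complex.I * hbar) ^ 2 • P.1, (Complex.I * hbar) • P.2.1, P.2.2)

/-- A pseudo-Riemannian metric on `M`, given by its components `g_ij` in all coordinate systems. -/
structure PseudoRiemannianMetric where
  coeff : Chart n M → E n → Matrix (Fin n) (Fin n) ℝ
  smooth : ∀ e i j, ContDiffOn ℝ ∞ (fun x => coeff e x i j) e.1.target
  symm : ∀ e, ∀ x ∈ e.1.target, (coeff e x)ᵀ = coeff e x
  nondegenerate : ∀ e, ∀ x ∈ e.1.target, (coeff e x).det ≠ 0
  transform : ∀ e e', ∀ x ∈ overlap e e',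
    coeff e x = (jac e e' x)ᵀ * coeff e' (transition e e' x) * jac e e' x

end Manifold

/-! ### Tensor calculus in coordinates

Here `G` is the matrix of components `g_ij` of a metric in some coordinate system. -/

section Local

variable {n : ℕ} (G : E n → Matrix (Fin n) (Fin n) ℝ)

/-- The component `|vol_g|^w = |det g|^(w/2)` of the `w`-th power of the metric density. -/
def volPow (w : ℂ) (x : E n) : ℂ := absPow (G x).det (w / 2)

/-- The Christoffel symbols `Γᵏ_ij` of the Levi-Civita connection. -/
def christoffel (k i j : Fin n) (x : E n) : ℝ :=
  (1 / 2) * ∑ l, (G x)⁻¹ k l *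
    (pd i (fun y => G y j l) x + pd j (fun y => G y i l) x - pd l (fun y => G y i j) x)

/-- The contraction `Γ_i = Γʲ_ij`. -/
def christoffelTrace (i : Fin n) (x : E n) : ℝ := ∑ j, christoffel G j i j x

/-- The Ricci tensor `R_ij`; the sign is such that round spheres have positive curvature. -/
def ricci (i j : Fin n) (x : E n) : ℝ :=
  ∑ k, (pd k (christoffel G k i j) x - pd j (christoffel G k i k) x
    + ∑ l, (christoffel G k k l x * christoffel G l i j x
      - christoffel G k j l x * christoffel G l i k x))

/-- The scalar curvature `R = gⁱʲ R_ij`. -/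
def scalarCurvature (x : E n) : ℝ := ∑ i, ∑ j, (G x)⁻¹ i j * ricci G i j x

/-- `∇_i φ` for a `w`-density `φ`. -/
def covDensity (w : ℂ) (φ : E n → ℂ) (i : Fin n) (x : E n) : ℂ :=
  pd i φ x - w * christoffelTrace G i x * φ x

/-- `∇_i α_j` for a covector field `α_j` with values in `w`-densities. -/
def covCovector (w : ℂ) (α : Fin n → E n → ℂ) (i j : Fin n) (x : E n) : ℂ :=
  pd i (α j) x - ∑ k, christoffel G k i j x * α k x - w * christoffelTrace G i x * α j x

/-- `∇_i ∇_j φ` for a `w`-density `φ`. -/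
def hessDensity (w : ℂ) (φ : E n → ℂ) (i j : Fin n) (x : E n) : ℂ :=
  covCovector G w (covDensity G w φ) i j x

/-- `∇_i Vʲ` for a vector field `Vʲ` with values in `w`-densities. -/
def covVector (w : ℂ) (V : E n → Fin n → ℂ) (i j : Fin n) (x : E n) : ℂ :=
  pd i (fun y => V y j) x + ∑ k, christoffel G j i k x * V x k
    - w * christoffelTrace G i x * V x j

/-- `∇_i Pʲᵏ` for a twice contravariant tensor field `Pʲᵏ` with values in `w`-densities. -/
def covTensor (w : ℂ) (P : E n → Matrix (Fin n) (Fin n) ℂ) (i j k : Fin n) (x : E n) : ℂ :=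
  pd i (fun y => P y j k) x + ∑ l, christoffel G j i l x * P x l k
    + ∑ l, christoffel G k i l x * P x j l - w * christoffelTrace G i x * P x j k

/-- `∇_i T_jᵏˡ` for a tensor field `T_jᵏˡ` with values in `w`-densities. -/
def covTensor' (w : ℂ) (T : Fin n → Fin n → Fin n → E n → ℂ) (i j k l : Fin n) (x : E n) : ℂ :=
  pd i (T j k l) x - ∑ m, christoffel G m i j x * T m k l x
    + ∑ m, christoffel G k i m x * T j m l x + ∑ m, christoffel G l i m x * T j k m x
    - w * christoffelTrace G i x * T j k l x

/-- `∇_i ∇_j Pᵏˡ` for a twice contravariant tensor field with values in `w`-densities. -/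
def hessTensor (w : ℂ) (P : E n → Matrix (Fin n) (Fin n) ℂ) (i j k l : Fin n) (x : E n) : ℂ :=
  covTensor' G w (covTensor G w P) i j k l x

/-- The Laplace operator from `lam`-densities to `mu`-densities: with the identification of
functions with densities by means of the metric density `|vol_g|`, it is the operator
`f |vol_g|^lam ↦ (Δ f) |vol_g|^mu`, where `Δ f = gⁱʲ (∂_i ∂_j f - Γᵏ_ij ∂_k f)` is the
Laplace-Beltrami operator. -/
def laplace (lam mu : ℂ) (φ : E n → ℂ) (x : E n) : ℂ :=
  volPow G mu x * ∑ i, ∑ j, (((G x)⁻¹ i j : ℝ) : ℂ) *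
    (pd i (pd j (fun y => volPow G (-lam) y * φ y)) x
      - ∑ k, christoffel G k i j x * pd k (fun y => volPow G (-lam) y * φ y) x)

/-- Multiplication by the scalar curvature, from `lam`-densities to `mu`-densities:
`f |vol_g|^lam ↦ R f |vol_g|^mu`. -/
def curvatureOp (lam mu : ℂ) (φ : E n → ℂ) (x : E n) : ℂ :=
  volPow G (mu - lam) x * scalarCurvature G x * φ x

end Local

/-! ### The intrinsic formula for the quantization map in dimension at least three -/

section Coefficients

variable (n : ℕ) (lam mu : ℂ)

/-- The shift `δ` of the weights does not belong to the set of resonances. -/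
def NonResonant (δ : ℂ) : Prop :=
  δ ∉ ({2 / (n : ℂ), ((n : ℂ) + 2) / (2 * n), 1, ((n : ℂ) + 1) / n, ((n : ℂ) + 2) / n} : Set ℂ)

def coeffAlpha : ℂ := lam / (1 - (mu - lam))

def coeffBeta1 : ℂ := 2 * (n * lam + 1) / (2 + n * (1 - (mu - lam)))

def coeffBeta2 : ℂ :=
  n * (lam + mu - 1) / ((2 + n * (1 - (mu - lam))) * (2 - n * (mu - lam)))

def coeffBeta3 : ℂ :=
  n * lam * (n * lam + 1) / ((1 + n * (1 - (mu - lam))) * (2 + n * (1 - (mu - lam))))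

def coeffBeta4 : ℂ :=
  n * lam * (n ^ 2 * mu * (2 - lam - mu) + 2 * (n * lam + 1) ^ 2 - n * (n + 1)) /
    ((1 + n * (1 - (mu - lam))) * (2 + n * (1 - (mu - lam))) *
      (2 + n * (1 - 2 * (mu - lam))) * (2 - n * (mu - lam)))

def coeffBeta5 : ℂ :=
  n ^ 2 * lam * (mu - 1) / ((n - 2) * (1 + n * (1 - (mu - lam))))

def coeffBeta6 : ℂ :=
  n ^ 2 * lam * (mu - 1) * (n * (mu - lam) - 2) /
    ((n - 1) * (n - 2) * (1 + n * (1 - (mu - lam))) * (2 + n * (1 - 2 * (mu - lam))))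

/-- The constant `C_{lam,mu}` in front of the scalar curvature. -/
def curvatureCoupling : ℂ :=
  n ^ 2 * lam * (mu - 1) / ((n - 1) * (n + 2 - 2 * n * (mu - lam)))

end Coefficients

/-- The coordinate expression of `Q_{lam,mu}(P) φ`, for a symbol `P` with components `P2`, `P1`,
`P0` with values in `(mu - lam)`-densities and a `lam`-density `φ`. -/
def quantizeLocal {n : ℕ} (G : E n → Matrix (Fin n) (Fin n) ℝ) (lam mu : ℂ)
    (P2 : E n → Matrix (Fin n) (Fin n) ℂ) (P1 : E n → Fin n → ℂ) (P0 : E n → ℂ)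
    (φ : E n → ℂ) (x : E n) : ℂ :=
  (∑ i, ∑ j, P2 x i j * hessDensity G lam φ i j x)
  + (∑ j, (coeffBeta1 n lam mu * ∑ i, covTensor G (mu - lam) P2 i i j x
      + coeffBeta2 n lam mu * ∑ i, ∑ k, ∑ l,
          (((G x)⁻¹ i j : ℝ) : ℂ) * ((G x k l : ℝ) : ℂ) * covTensor G (mu - lam) P2 i k l x)
      * covDensity G lam φ j x)
  + (coeffBeta3 n lam mu * ∑ i, ∑ j, hessTensor G (mu - lam) P2 i j i j x
      + coeffBeta4 n lam mu * ∑ i, ∑ j, ∑ k, ∑ l,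
          (((G x)⁻¹ i j : ℝ) : ℂ) * ((G x k l : ℝ) : ℂ) * hessTensor G (mu - lam) P2 i j k l x
      + coeffBeta5 n lam mu * ∑ i, ∑ j, ((ricci G i j x : ℝ) : ℂ) * P2 x i j
      + coeffBeta6 n lam mu * ((scalarCurvature G x : ℝ) : ℂ) *
          ∑ i, ∑ j, ((G x i j : ℝ) : ℂ) * P2 x i j) * φ x
  + (∑ i, P1 x i * covDensity G lam φ i x)
  + (coeffAlpha lam mu * ∑ i, covVector G (mu - lam) P1 i i x) * φ x
  + P0 x * φ x

/-! ### Conformally flat structures and conformal equivariance -/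

/-- The diagonal entries of the flat metric `diag(1, …, 1, -1, …, -1)` with `p` entries `1`. -/
def flatDiag (n p : ℕ) (i : Fin n) : ℝ := if (i : ℕ) < p then 1 else -1

/-- `x_i = g_ij xʲ` for the flat metric. -/
def lower {n : ℕ} (p : ℕ) (x : E n) (i : Fin n) : ℝ := flatDiag n p i * x i

/-- The Lie algebra `o(p+1,q+1)` of vector fields on `ℝⁿ`, `n = p + q`, spanned by the translations
`∂_i`, the rotations `x_i ∂_j - x_j ∂_i`, the homotheties `xⁱ ∂_i` and the inversions
`x_j xʲ ∂_i - 2 x_i xʲ ∂_j`. -/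
def confAlg (n p : ℕ) : Submodule ℝ (E n → E n) :=
  Submodule.span ℝ
    ((Set.range fun i : Fin n => fun _ : E n => EuclideanSpace.single i (1 : ℝ)) ∪
     (Set.range fun ij : Fin n × Fin n => fun x : E n =>
        lower p x ij.1 • EuclideanSpace.single ij.2 (1 : ℝ)
          - lower p x ij.2 • EuclideanSpace.single ij.1 (1 : ℝ)) ∪
     {fun x : E n => x} ∪
     (Set.range fun i : Fin n => fun x : E n =>
        (∑ j, lower p x j * x j) • EuclideanSpace.single i (1 : ℝ) - (2 * lower p x i) • x))

section Lie

variable {n : ℕ}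

/-- The divergence `∂_i Xⁱ`. -/
def divergence (X : E n → E n) (x : E n) : ℝ := ∑ i, pd i (fun y => X y i) x

/-- The Lie derivative of (the coordinate expression of) a `w`-density. -/
def lieDensity (w : ℂ) (X : E n → E n) (f : E n → ℂ) (x : E n) : ℂ :=
  ∑ k, (X x k : ℂ) * pd k f x + w * divergence X x * f x

/-- The Lie derivative of a first-order symbol with values in `w`-densities. -/
def lieSymbol1 (w : ℂ) (X : E n → E n) (P : E n → Fin n → ℂ) (x : E n) (i : Fin n) : ℂ :=
  ∑ k, (X x k : ℂ) * pd k (fun y => P y i) x - ∑ k, P x k * pd k (fun y => X y i) x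
    + w * divergence X x * P x i

/-- The Lie derivative of a second-order symbol with values in `w`-densities. -/
def lieSymbol2 (w : ℂ) (X : E n → E n) (P : E n → Matrix (Fin n) (Fin n) ℂ) (x : E n)
    (i j : Fin n) : ℂ :=
  ∑ k, (X x k : ℂ) * pd k (fun y => P y i j) x - ∑ k, P x k j * pd k (fun y => X y i) x
    - ∑ k, P x i k * pd k (fun y => X y j) x + w * divergence X x * P x i j

end Lie

section Equivariance

variable (n : ℕ) (M : Type*) [TopologicalSpace M] [ChartedSpace (E n) M]

/-- A flat conformal structure (of signature `(p, n - p)`) on `M`: a covering of `M` by adapted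
coordinate systems, which identify `M` locally with `ℝⁿ` endowed with the canonical action of
`o(p+1,q+1)`. -/
structure FlatConformalStructure (p : ℕ) where
  charts : Set (Chart n M)
  cover : ∀ m : M, ∃ e ∈ charts, m ∈ e.1.source
  compatible : ∀ e ∈ charts, ∀ e' ∈ charts, ∀ x ∈ overlap e e', ∀ X ∈ confAlg n p,
    ∃ Y ∈ confAlg n p, ∀ᶠ y in nhds x,
      fderiv ℝ (transition e e') y (X y) = Y (transition e e' y)

variable {n M}

/-- The metric `g` belongs to the conformal class of the flat conformal structure: it is
`F diag(1, …, 1, -1, …, -1)` with `F > 0` in all adapted coordinate systems. -/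
def FlatConformalStructure.Represents {p : ℕ} (𝒜 : FlatConformalStructure n M p)
    (g : PseudoRiemannianMetric n M) : Prop :=
  ∀ e ∈ 𝒜.charts, ∀ x ∈ e.1.target, ∃ F : ℝ, 0 < F ∧
    g.coeff e x = F • Matrix.diagonal (flatDiag n p)

/-- In the coordinates `e`, the operator `A` is `a2ⁱʲ ∂_i ∂_j + a1ⁱ ∂_i + a0`, with smooth
coefficients. -/
def HasCoordExpr {lam mu : ℂ} (A : Density n M lam →ₗ[ℂ] Density n M mu) (e : Chart n M)
    (a2 : E n → Matrix (Fin n) (Fin n) ℂ) (a1 : E n → Fin n → ℂ) (a0 : E n → ℂ) : Prop :=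
  (∀ i j, ContDiffOn ℝ ∞ (fun x => a2 x i j) e.1.target) ∧
  (∀ i, ContDiffOn ℝ ∞ (fun x => a1 x i) e.1.target) ∧
  ContDiffOn ℝ ∞ a0 e.1.target ∧
  ∀ φ : Density n M lam, ∀ x ∈ e.1.target,
    (A φ).1 e x = (∑ i, ∑ j, a2 x i j * pd i (pd j (φ.1 e)) x)
      + (∑ i, a1 x i * pd i (φ.1 e) x) + a0 x * φ.1 e x

/-- `Q` is a conformally equivariant quantization map `S²_{mu-lam}(M) → D²_{lam,mu}(M)` for the
flat conformal structure `𝒜`. -/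
structure IsConformallyEquivariantQuantization {p : ℕ} (𝒜 : FlatConformalStructure n M p)
    (lam mu : ℂ)
    (Q : Symbol n M (mu - lam) →ₗ[ℂ] (Density n M lam →ₗ[ℂ] Density n M mu)) : Prop where
  /-- `Q(P)` is a differential operator of order at most two with the principal symbol of `P`. -/
  symbol_two : ∀ P : Symbol n M (mu - lam), ∀ e : Chart n M, ∃ a1 a0,
    HasCoordExpr (Q P) e (P.1.1 e) a1 a0
  /-- The principal symbol is preserved on symbols of degree at most one. -/
  symbol_one : ∀ P : Symbol n M (mu - lam), P.1 = 0 → ∀ e : Chart n M, ∃ a0,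
    HasCoordExpr (Q P) e 0 (P.2.1.1 e) a0
  /-- The principal symbol is preserved on symbols of degree zero. -/
  symbol_zero : ∀ P : Symbol n M (mu - lam), P.1 = 0 → P.2.1 = 0 → ∀ e : Chart n M,
    HasCoordExpr (Q P) e 0 0 (P.2.2.1 e)
  /-- Equivariance `Q(L_X P) = L_X ∘ Q(P) - Q(P) ∘ L_X` for the (local) action of
  `o(p+1,q+1)`: wherever `P'` is the Lie derivative of `P`, and `φ'` that of `φ`, along a vector
  field `X` of this algebra, one has `Q(P') φ = L_X (Q(P) φ) - Q(P) φ'`. -/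
  equivariant : ∀ e ∈ 𝒜.charts, ∀ X ∈ confAlg n p, ∀ V : Set (E n), IsOpen V → V ⊆ e.1.target →
    ∀ P P' : Symbol n M (mu - lam), ∀ φ φ' : Density n M lam,
    (∀ x ∈ V, ∀ i j, P'.1.1 e x i j = lieSymbol2 (mu - lam) X (P.1.1 e) x i j) →
    (∀ x ∈ V, ∀ i, P'.2.1.1 e x i = lieSymbol1 (mu - lam) X (P.2.1.1 e) x i) →
    (∀ x ∈ V, P'.2.2.1 e x = lieDensity (mu - lam) X (P.2.2.1 e) x) →
    (∀ x ∈ V, φ'.1 e x = lieDensity lam X (φ.1 e) x) →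
    ∀ x ∈ V, (Q P' φ).1 e x = lieDensity mu X ((Q P φ).1 e) x - (Q P φ').1 e x

/-! ### The geodesic Hamiltonian -/

theorem absPow_mul (a b : ℝ) (w : ℂ) : absPow (a * b) w = absPow a w * absPow b w := by
  unfold absPow
  rw [abs_mul, Complex.ofReal_mul,
    Complex.mul_cpow_ofReal_nonneg (abs_nonneg a) (abs_nonneg b)]

theorem absPow_sq {a : ℝ} (ha : a ≠ 0) (w : ℂ) : absPow a (w / 2) * absPow a (w / 2) = absPow a w := by
  unfold absPow
  rw [← Complex.cpow_add _ _ (by simpa using ha)]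
  congr 1; ring

theorem absPow_eq_exp {a : ℝ} (ha : a ≠ 0) (w : ℂ) :
    absPow a w = Complex.exp ((Real.log a : ℝ) * w) := by
  unfold absPow
  rw [Complex.cpow_def_of_ne_zero (by simpa using ha), ← Complex.ofReal_log (abs_nonneg a),
    Real.log_abs]

theorem contDiffOn_det {n : ℕ} {s : Set (E n)} {A : E n → Matrix (Fin n) (Fin n) ℝ}
    (hA : ∀ i j, ContDiffOn ℝ ∞ (fun x => A x i j) s) :
    ContDiffOn ℝ ∞ (fun x => (A x).det) s := by
  simp only [Matrix.det_apply]
  refine ContDiffOn.sum fun σ _ => ?_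
  exact (contDiffOn_prod fun i _ => hA (σ i) i).const_smul _

theorem contDiffOn_inv_entry {n : ℕ} {s : Set (E n)} {A : E n → Matrix (Fin n) (Fin n) ℝ}
    (hA : ∀ i j, ContDiffOn ℝ ∞ (fun x => A x i j) s) (h0 : ∀ x ∈ s, (A x).det ≠ 0)
    (i j : Fin n) : ContDiffOn ℝ ∞ (fun x => (A x)⁻¹ i j) s := by
  have h1 : ContDiffOn ℝ ∞ (fun x => (A x).adjugate i j) s := by
    simp only [Matrix.adjugate_apply]
    refine contDiffOn_det fun k l => ?_
    by_cases hk : k = j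
    · subst hk; simp only [Matrix.updateRow_self]; exact contDiffOn_const
    · simp only [Matrix.updateRow_ne hk]; exact hA k l
  refine (((contDiffOn_det hA).inv h0).mul h1).congr fun x _ => ?_
  simp [Matrix.inv_def]

theorem contDiffOn_volPow {n : ℕ} {s : Set (E n)} {A : E n → Matrix (Fin n) (Fin n) ℝ}
    (hA : ∀ i j, ContDiffOn ℝ ∞ (fun x => A x i j) s) (h0 : ∀ x ∈ s, (A x).det ≠ 0) (w : ℂ) :
    ContDiffOn ℝ ∞ (volPow A w) s := by
  have h1 : ContDiffOn ℝ ∞ (fun x => ((Real.log (A x).det : ℝ) : ℂ)) s :=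
    Complex.ofRealCLM.contDiff.comp_contDiffOn ((contDiffOn_det hA).log h0)
  refine ((h1.mul (contDiffOn_const (c := w / 2))).cexp).congr fun x hx => ?_
  exact absPow_eq_exp (h0 x hx) _

theorem hamiltonian_transform {n : ℕ} (w : ℂ) {A B J : Matrix (Fin n) (Fin n) ℝ}
    (hA : A.det ≠ 0) (h : A = Jᵀ * B * J) :
    J.map (fun r => (r : ℂ)) * (absPow A.det (w / 2) • A⁻¹.map (fun r => (r : ℂ))) *
        (J.map (fun r => (r : ℂ)))ᵀ
      = absPow J.det w • (absPow B.det (w / 2) • B⁻¹.map (fun r => (r : ℂ))) := by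
  have hdet : A.det = J.det * B.det * J.det := by
    rw [h, Matrix.det_mul, Matrix.det_mul, Matrix.det_transpose]
  have hJ : J.det ≠ 0 := by
    intro h0; exact hA (by rw [hdet, h0]; simp)
  have hB : B.det ≠ 0 := by
    intro h0; exact hA (by rw [hdet, h0]; simp)
  have hinv : J * A⁻¹ * Jᵀ = B⁻¹ := by
    have hJu : IsUnit J.det := isUnit_iff_ne_zero.2 hJ
    have hJt : IsUnit (Jᵀ).det := by rwa [Matrix.det_transpose]
    rw [h, Matrix.mul_inv_rev, Matrix.mul_inv_rev, ← mul_assoc, Matrix.mul_nonsing_inv _ hJu,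
      one_mul, mul_assoc, Matrix.nonsing_inv_mul _ hJt, mul_one]
  have hmap : J.map (fun r => (r : ℂ)) * A⁻¹.map (fun r => (r : ℂ)) *
      (J.map (fun r => (r : ℂ)))ᵀ = B⁻¹.map (fun r => (r : ℂ)) := by
    rw [← hinv]
    have := Matrix.map_mul (L := J * A⁻¹) (M := Jᵀ) (f := Complex.ofRealHom)
    have h2 := Matrix.map_mul (L := J) (M := A⁻¹) (f := Complex.ofRealHom)
    rw [h2] at this
    exact this.symm
  rw [Matrix.mul_smul, Matrix.smul_mul, hmap, smul_smul, hdet, absPow_mul, absPow_mul,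
    ← absPow_sq hJ w]
  congr 1; ring

/-- The symbol `H = gⁱʲ ξᵢ ξⱼ ∈ S_{2,w}`, i.e. `gⁱʲ ξᵢ ξⱼ |vol_g|^w`. -/
def geodesicHamiltonian (g : PseudoRiemannianMetric n M) (w : ℂ) : Symbol n M w :=
  (⟨fun e => e.1.target.indicator fun x =>
      volPow (g.coeff e) w x • ((g.coeff e x)⁻¹).map (fun r => (r : ℂ)), by
    refine ⟨fun e x hx => ?_, fun e i j => ?_, fun e x => ?_, fun e e' x hx => ?_⟩
    · simp [hx]
    · have h1 := contDiffOn_volPow (g.smooth e) (g.nondegenerate e) w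
      have h2 : ContDiffOn ℝ ∞ (fun x => (((g.coeff e x)⁻¹ i j : ℝ) : ℂ)) e.1.target :=
        Complex.ofRealCLM.contDiff.comp_contDiffOn
          (contDiffOn_inv_entry (g.smooth e) (g.nondegenerate e) i j)
      refine (h1.mul h2).congr fun x hx => ?_
      simp [hx]
    · by_cases hx : x ∈ e.1.target
      · simp only [hx, Set.indicator_of_mem]
        rw [Matrix.transpose_smul, ← Matrix.transpose_map, Matrix.transpose_nonsing_inv,
          g.symm e x hx]
      · simp [hx]
    · have hx1 : x ∈ e.1.target := hx.1
      have hx2 : transition e e' x ∈ e'.1.target := e'.1.map_source hx.2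
      simp only [hx1, hx2, Set.indicator_of_mem]
      exact hamiltonian_transform w (g.nondegenerate e x hx1) (g.transform e e' x hx)⟩, 0, 0)

/-! ### Operators on the manifold, in coordinates -/

/-- The expression in the coordinates `e` of `Q_{lam,mu}(P) φ`, where `Q_{lam,mu}` is the
quantization map of the metric `g` (in dimension at least three). -/
def quantize (g : PseudoRiemannianMetric n M) (lam mu : ℂ) (P : Symbol n M (mu - lam))
    (φ : Density n M lam) (e : Chart n M) (x : E n) : ℂ :=
  quantizeLocal (g.coeff e) lam mu (P.1.1 e) (P.2.1.1 e) (P.2.2.1 e) (φ.1 e) x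

/-- The expression in the coordinates `e` of `(Δ + c R) φ`. -/
def laplacePlusCurvature (g : PseudoRiemannianMetric n M) (lam mu c : ℂ)
    (φ : Density n M lam) (e : Chart n M) (x : E n) : ℂ :=
  laplace (g.coeff e) lam mu (φ.1 e) x + c * curvatureOp (g.coeff e) lam mu (φ.1 e) x

end Equivariance

end ConfQuant

namespace ConfQuant

/-! ### Calculus of partial derivatives -/

section PartialDerivatives

variable {n : ℕ} {F : Type*} [NormedAddCommGroup F] [NormedSpace ℝ F]

/-! Write δ = μ − λ, and let η be the constant diagonal matrix of signs of the flat metric. Two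
separate arguments lead to the same constant.

In situation (a), the tensor density gⁱʲ|vol|^δ is parallel for the Levi-Civita connection. Every
term of the intrinsic formula that differentiates P₂ therefore vanishes, and β₁, …, β₄ play no role.
What remains is gⁱʲ∇ᵢ∇ⱼ, which is the Laplacian because |vol|^λ is parallel too, and the curvature
terms (β₅ + nβ₆)R. A cancellation of the factor n − 2 identifies β₅ + nβ₆ with C. The lemmas are
`covTensor_eq_zero`, `quantizeLocal_eq` and `coeffBeta_add`.

In situation (b), in an adapted chart g = e^κ η and H = f η with f = exp((nδ/2 − 1)κ). By the
conformal Killing equation the symbols f η are stable under the conformal algebra, and f behaves as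
a density of weight ν = δ − 2/n (`lieSymbol2_diagonal`). Hence (f, φ) ↦ Q(f η)φ is a conformally
equivariant bilinear pairing of densities, and such pairings are classified in
`IsConformalPairing.eq`. Fix a point x₀ and use the conformal fields that vanish there. The
principal symbol leaves only the functionals f ↦ B(f, xⁱ − x₀ⁱ) and f ↦ B(f, 1) to be found. The
homothety makes them homogeneous of degree 1 and 2, so they depend only on the differential and on
the Hessian of f at x₀; rotations reduce the second to a multiple of the trace; inversions fix the
constants. No continuity or locality in f enters this step: monomials of too high degree times
smooth functions are in the image of a shifted Euler operator, by Hadamard's lemma and a radial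
integral.

The result is a combination of f□φ, ⟨∇f, ∇φ⟩ and (□f)φ, where □ is the flat Laplacian. Expanding Δ +
C R for g = e^κ η gives the same combination (`laplace_add_curvatureOp`). Finally Δ + C R is shown
to obey the transformation law of a μ-density, so the identity passes from the adapted charts, which
cover M, to all charts. -/

theorem pd_congr {U : Set (E n)} (hU : IsOpen U) {f g : E n → F} (h : ∀ y ∈ U, f y = g y)
    {x : E n} (hx : x ∈ U) (i : Fin n) : pd i f x = pd i g x := by
  have : f =ᶠ[nhds x] g := Filter.eventuallyEq_of_mem (hU.mem_nhds hx) h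
  unfold pd
  rw [this.fderiv_eq]

theorem diffAt {U : Set (E n)} (hU : IsOpen U) {f : E n → F} (h : ContDiffOn ℝ ∞ f U)
    {x : E n} (hx : x ∈ U) : DifferentiableAt ℝ f x :=
  (h.contDiffAt (hU.mem_nhds hx)).differentiableAt (by simp)

theorem contDiffOn_pd {U : Set (E n)} (hU : IsOpen U) {f : E n → F} (h : ContDiffOn ℝ ∞ f U)
    (i : Fin n) : ContDiffOn ℝ ∞ (pd i f) U :=
  (h.fderiv_of_isOpen hU (m := ∞) (by simp)).clm_apply contDiffOn_const

theorem contDiff_pd {f : E n → F} (h : ContDiff ℝ ∞ f) (i : Fin n) : ContDiff ℝ ∞ (pd i f) :=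
  contDiffOn_univ.1 (contDiffOn_pd isOpen_univ (contDiffOn_univ.2 h) i)

theorem pd_const (i : Fin n) (c : F) (x : E n) : pd i (fun _ => c) x = 0 := by
  simp [pd]

theorem pd_add {f g : E n → F} {x : E n} (hf : DifferentiableAt ℝ f x)
    (hg : DifferentiableAt ℝ g x) (i : Fin n) :
    pd i (fun y => f y + g y) x = pd i f x + pd i g x := by
  simp [pd, fderiv_fun_add hf hg]

theorem pd_sub {f g : E n → F} {x : E n} (hf : DifferentiableAt ℝ f x)
    (hg : DifferentiableAt ℝ g x) (i : Fin n) :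
    pd i (fun y => f y - g y) x = pd i f x - pd i g x := by
  simp [pd, fderiv_fun_sub hf hg]

theorem pd_sum {ι : Type*} (s : Finset ι) {f : ι → E n → F} {x : E n}
    (hf : ∀ k ∈ s, DifferentiableAt ℝ (f k) x) (i : Fin n) :
    pd i (fun y => ∑ k ∈ s, f k y) x = ∑ k ∈ s, pd i (f k) x := by
  simp [pd, fderiv_fun_sum hf]

theorem pd_mul {A : Type*} [NormedCommRing A] [NormedAlgebra ℝ A] {f g : E n → A} {x : E n}
    (hf : DifferentiableAt ℝ f x) (hg : DifferentiableAt ℝ g x) (i : Fin n) :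
    pd i (fun y => f y * g y) x = pd i f x * g x + f x * pd i g x := by
  simp [pd, fderiv_fun_mul hf hg]; ring

theorem pd_const_mul {A : Type*} [NormedCommRing A] [NormedAlgebra ℝ A] {f : E n → A} {x : E n}
    (hf : DifferentiableAt ℝ f x) (c : A) (i : Fin n) :
    pd i (fun y => c * f y) x = c * pd i f x := by
  rw [pd_mul (differentiableAt_const c) hf, pd_const]; ring

theorem pd_ofReal {f : E n → ℝ} {x : E n} (hf : DifferentiableAt ℝ f x) (i : Fin n) :
    pd i (fun y => ((f y : ℝ) : ℂ)) x = ((pd i f x : ℝ) : ℂ) := by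
  have := (Complex.ofRealCLM.hasFDerivAt.comp x hf.hasFDerivAt).fderiv
  unfold pd
  have h2 : (fun y => ((f y : ℝ) : ℂ)) = Complex.ofRealCLM ∘ f := rfl
  rw [h2, this]; simp

theorem pd_cexp {f : E n → ℂ} {x : E n} (hf : DifferentiableAt ℝ f x) (i : Fin n) :
    pd i (fun y => Complex.exp (f y)) x = Complex.exp (f x) * pd i f x := by
  unfold pd
  rw [hf.hasFDerivAt.cexp.fderiv]; simp

theorem pd_coord (i j : Fin n) (x : E n) :
    pd i (fun y : E n => y j) x = if i = j then 1 else 0 := by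
  have : (fun y : E n => y j) = EuclideanSpace.proj (𝕜 := ℝ) j := rfl
  unfold pd
  rw [this, ContinuousLinearMap.fderiv]
  simp [eq_comm]

theorem pd_apply {m : ℕ} {f : E n → E m} {x : E n} (hf : DifferentiableAt ℝ f x) (i : Fin n)
    (j : Fin m) : pd i (fun y => f y j) x = (pd i f x) j := by
  have := ((EuclideanSpace.proj (𝕜 := ℝ) j).hasFDerivAt.comp x hf.hasFDerivAt).fderiv
  unfold pd
  have h2 : (fun y => f y j) = (EuclideanSpace.proj (𝕜 := ℝ) j) ∘ f := rfl
  rw [h2, this]; simp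

theorem fderiv_eq_sum_pd (f : E n → F) (x v : E n) :
    fderiv ℝ f x v = ∑ i, v i • pd i f x := by
  have h : v = ∑ i, v i • EuclideanSpace.single i (1 : ℝ) := by
    have := (EuclideanSpace.basisFun (Fin n) ℝ).sum_repr v
    simpa using this.symm
  conv_lhs => rw [h]
  simp [pd, map_sum]

theorem pd_comp {m : ℕ} {f : E m → F} {φ : E n → E m} {x : E n}
    (hf : DifferentiableAt ℝ f (φ x)) (hφ : DifferentiableAt ℝ φ x) (i : Fin n) :
    pd i (fun y => f (φ y)) x = ∑ b, (pd i φ x) b • pd b f (φ x) := by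
  have h := (hf.hasFDerivAt.comp x hφ.hasFDerivAt).fderiv
  rw [← fderiv_eq_sum_pd]
  change fderiv ℝ (f ∘ φ) x _ = _
  rw [h]; rfl

theorem pd_comm {U : Set (E n)} (hU : IsOpen U) {f : E n → F} (h : ContDiffOn ℝ ∞ f U)
    {x : E n} (hx : x ∈ U) (i j : Fin n) : pd i (pd j f) x = pd j (pd i f) x := by
  have hc := h.contDiffAt (hU.mem_nhds hx)
  have hs : IsSymmSndFDerivAt ℝ f x := hc.isSymmSndFDerivAt (by simpa using WithTop.coe_le_coe.2 (le_top : (2 : ℕ∞) ≤ ⊤))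
  have hd : DifferentiableAt ℝ (fderiv ℝ f) x :=
    (hc.fderiv_right (m := ∞) (by simp)).differentiableAt (by simp)
  have key : ∀ a b : Fin n, pd a (pd b f) x
      = fderiv ℝ (fderiv ℝ f) x (EuclideanSpace.single a 1) (EuclideanSpace.single b 1) := by
    intro a b
    have := (hd.hasFDerivAt.clm_apply (hasFDerivAt_const (EuclideanSpace.single b (1 : ℝ)) x)).fderiv
    change fderiv ℝ (fun y => fderiv ℝ f y (EuclideanSpace.single b 1)) x _ = _
    rw [this]; simp
  rw [key, key, hs]

end PartialDerivatives

/-! ### Matrix-valued functions -/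

section MatrixCalculus

variable {n : ℕ}

/-- The entrywise partial derivative of a matrix-valued function. -/
def mpd (i : Fin n) (A : E n → Matrix (Fin n) (Fin n) ℝ) (x : E n) : Matrix (Fin n) (Fin n) ℝ :=
  Matrix.of fun a b => pd i (fun y => A y a b) x

/-- A matrix-valued function with smooth entries. -/
def SmoothMat (A : E n → Matrix (Fin n) (Fin n) ℝ) (U : Set (E n)) : Prop :=
  ∀ a b, ContDiffOn ℝ ∞ (fun x => A x a b) U

variable {U : Set (E n)} {A B : E n → Matrix (Fin n) (Fin n) ℝ}

theorem SmoothMat.mul (hA : SmoothMat A U) (hB : SmoothMat B U) :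
    SmoothMat (fun x => A x * B x) U := by
  intro a b
  simp only [Matrix.mul_apply]
  exact ContDiffOn.sum fun k _ => (hA a k).mul (hB k b)

theorem SmoothMat.transpose (hA : SmoothMat A U) : SmoothMat (fun x => (A x)ᵀ) U :=
  fun a b => hA b a

theorem SmoothMat.mpd (hU : IsOpen U) (hA : SmoothMat A U) (i : Fin n) :
    SmoothMat (mpd i A) U :=
  fun a b => contDiffOn_pd hU (hA a b) i

theorem mpd_congr (hU : IsOpen U) (h : ∀ y ∈ U, A y = B y) {x : E n} (hx : x ∈ U) (i : Fin n) :
    mpd i A x = mpd i B x := by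
  ext a b
  exact pd_congr hU (fun y hy => by rw [h y hy]) hx i

theorem mpd_transpose (i : Fin n) (x : E n) : mpd i (fun y => (A y)ᵀ) x = (mpd i A x)ᵀ := rfl

theorem mpd_const (i : Fin n) (C : Matrix (Fin n) (Fin n) ℝ) (x : E n) :
    mpd i (fun _ => C) x = 0 := by
  ext a b; exact pd_const i _ x

theorem mpd_add (hU : IsOpen U) (hA : SmoothMat A U) (hB : SmoothMat B U) {x : E n} (hx : x ∈ U)
    (i : Fin n) : mpd i (fun y => A y + B y) x = mpd i A x + mpd i B x := by
  ext a b
  exact pd_add (diffAt hU (hA a b) hx) (diffAt hU (hB a b) hx) i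

theorem mpd_mul (hU : IsOpen U) (hA : SmoothMat A U) (hB : SmoothMat B U) {x : E n} (hx : x ∈ U)
    (i : Fin n) : mpd i (fun y => A y * B y) x = mpd i A x * B x + A x * mpd i B x := by
  ext a b
  simp only [mpd, Matrix.of_apply, Matrix.mul_apply, Matrix.add_apply]
  rw [← Finset.sum_add_distrib]
  refine (pd_sum _ (fun k _ => (diffAt hU (hA a k) hx).fun_mul (diffAt hU (hB k b) hx)) i).trans ?_
  exact Finset.sum_congr rfl fun k _ => pd_mul (diffAt hU (hA a k) hx) (diffAt hU (hB k b) hx) i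

theorem mpd_comm (hU : IsOpen U) (hA : SmoothMat A U) {x : E n} (hx : x ∈ U) (i j : Fin n) :
    mpd i (mpd j A) x = mpd j (mpd i A) x := by
  ext a b
  exact pd_comm hU (hA a b) hx i j

theorem smoothMat_inv (hA : SmoothMat A U) (h0 : ∀ x ∈ U, (A x).det ≠ 0) :
    SmoothMat (fun x => (A x)⁻¹) U :=
  contDiffOn_inv_entry hA h0

/-- Differentiate A · A⁻¹ = 1. -/
theorem mpd_inv (hU : IsOpen U) (hA : SmoothMat A U) (h0 : ∀ x ∈ U, (A x).det ≠ 0)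
    {x : E n} (hx : x ∈ U) (i : Fin n) :
    mpd i (fun y => (A y)⁻¹) x = -((A x)⁻¹ * mpd i A x * (A x)⁻¹) := by
  have hu : ∀ y ∈ U, IsUnit (A y).det := fun y hy => isUnit_iff_ne_zero.2 (h0 y hy)
  have h1 : mpd i (fun y => A y * (A y)⁻¹) x = 0 := by
    rw [mpd_congr hU (B := fun _ => 1) (fun y hy => Matrix.mul_nonsing_inv _ (hu y hy)) hx,
      mpd_const]
  rw [mpd_mul hU hA (smoothMat_inv hA h0) hx] at h1
  have h2 : A x * mpd i (fun y => (A y)⁻¹) x = -(mpd i A x * (A x)⁻¹) :=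
    eq_neg_of_add_eq_zero_right h1
  calc mpd i (fun y => (A y)⁻¹) x = (A x)⁻¹ * (A x * mpd i (fun y => (A y)⁻¹) x) := by
        rw [← mul_assoc, Matrix.nonsing_inv_mul _ (hu x hx), one_mul]
    _ = _ := by rw [h2, mul_neg, mul_assoc]

/-- Jacobi's formula. -/
theorem pd_det (hU : IsOpen U) (hA : SmoothMat A U) {x : E n} (hx : x ∈ U) (i : Fin n) :
    pd i (fun y => (A y).det) x = ((A x).adjugate * mpd i A x).trace := by
  have hd : ∀ a b, DifferentiableAt ℝ (fun y => A y a b) x := fun a b => diffAt hU (hA a b) hx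
  have hdp : ∀ σ : Equiv.Perm (Fin n), DifferentiableAt ℝ (fun y => ∏ k, A y (σ k) k) x :=
    fun σ => (HasFDerivAt.finsetProd (u := Finset.univ)
      fun k _ => (hd (σ k) k).hasFDerivAt).differentiableAt
  have hprod : ∀ σ : Equiv.Perm (Fin n), pd i (fun y => ∏ k, A y (σ k) k) x
      = ∑ k, ∏ l, ((A x).updateCol k fun a => mpd i A x a k) (σ l) l := by
    intro σ
    have h := (HasFDerivAt.finsetProd (u := Finset.univ)
      fun k _ => (hd (σ k) k).hasFDerivAt).fderiv
    unfold pd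
    rw [h]
    simp only [sum_apply, smul_apply, smul_eq_mul]
    refine Finset.sum_congr rfl fun k _ => ?_
    rw [← Finset.prod_erase_mul _ _ (Finset.mem_univ k)]
    congr 1
    · refine Finset.prod_congr rfl fun l hl => ?_
      rw [Matrix.updateCol_ne (Finset.ne_of_mem_erase hl)]
    · simp [mpd, pd]
  have h1 : pd i (fun y => (A y).det) x
      = ∑ k, ((A x).updateCol k fun a => mpd i A x a k).det := by
    simp only [Matrix.det_apply, zsmul_eq_mul, Units.smul_def]
    rw [pd_sum, Finset.sum_comm]
    · refine Finset.sum_congr rfl fun σ _ => ?_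
      rw [pd_const_mul, hprod, Finset.mul_sum]
      exact hdp σ
    · exact fun σ _ => (hdp σ).const_mul _
  rw [h1, Matrix.trace]
  refine Finset.sum_congr rfl fun k _ => ?_
  -- A determinant with one column replaced is an entry of Cramer's vector, that is, of the adjugate
  -- applied to the new column.
  rw [← Matrix.cramer_apply, Matrix.cramer_eq_adjugate_mulVec]
  simp [Matrix.mulVec, dotProduct, Matrix.mul_apply]

end MatrixCalculus

/-! ### The Levi-Civita connection in coordinates -/

section LeviCivita

variable {n : ℕ}

/-- The connection matrix `(Γᵏ_ij)_{kj}`. -/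
def conn (G : E n → Matrix (Fin n) (Fin n) ℝ) (i : Fin n) (x : E n) : Matrix (Fin n) (Fin n) ℝ :=
  Matrix.of fun k j => christoffel G k i j x

/-- A smooth metric on an open subset of `ℝⁿ`. -/
structure IsMetricOn (G : E n → Matrix (Fin n) (Fin n) ℝ) (U : Set (E n)) : Prop where
  isOpen : IsOpen U
  smooth : SmoothMat G U
  symm : ∀ x ∈ U, (G x)ᵀ = G x
  det_ne : ∀ x ∈ U, (G x).det ≠ 0

variable {G : E n → Matrix (Fin n) (Fin n) ℝ} {U : Set (E n)}

namespace IsMetricOn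

theorem mono (h : IsMetricOn G U) {V : Set (E n)} (hV : IsOpen V) (hVU : V ⊆ U) :
    IsMetricOn G V :=
  ⟨hV, fun a b => (h.smooth a b).mono hVU, fun x hx => h.symm x (hVU hx),
    fun x hx => h.det_ne x (hVU hx)⟩

theorem isUnit_det (h : IsMetricOn G U) {x : E n} (hx : x ∈ U) : IsUnit (G x).det :=
  isUnit_iff_ne_zero.2 (h.det_ne x hx)

theorem inv_symm (h : IsMetricOn G U) {x : E n} (hx : x ∈ U) : ((G x)⁻¹)ᵀ = (G x)⁻¹ := by
  rw [Matrix.transpose_nonsing_inv, h.symm x hx]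

theorem smooth_inv (h : IsMetricOn G U) : SmoothMat (fun x => (G x)⁻¹) U :=
  smoothMat_inv h.smooth h.det_ne

theorem mpd_symm (h : IsMetricOn G U) {x : E n} (hx : x ∈ U) (i : Fin n) :
    (mpd i G x)ᵀ = mpd i G x := by
  rw [← mpd_transpose]
  exact mpd_congr h.isOpen h.symm hx i

theorem pd_symm (h : IsMetricOn G U) {x : E n} (hx : x ∈ U) (i a b : Fin n) :
    pd i (fun y => G y a b) x = pd i (fun y => G y b a) x := by
  have := congrFun (congrFun (h.mpd_symm hx i) b) a
  simpa [mpd] using this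

theorem christoffel_symm (h : IsMetricOn G U) {x : E n} (hx : x ∈ U) (k i j : Fin n) :
    christoffel G k i j x = christoffel G k j i x := by
  unfold christoffel
  congr 1
  refine Finset.sum_congr rfl fun l _ => ?_
  rw [h.pd_symm hx l i j]; ring

/-- The Christoffel symbols of the first kind. -/
theorem mul_conn (h : IsMetricOn G U) {x : E n} (hx : x ∈ U) (l i j : Fin n) :
    (G x * conn G i x) l j = (1 / 2) *
      (pd i (fun y => G y j l) x + pd j (fun y => G y i l) x - pd l (fun y => G y i j) x) := by
  set v : Fin n → ℝ := fun l =>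
    pd i (fun y => G y j l) x + pd j (fun y => G y i l) x - pd l (fun y => G y i j) x with hv
  have h1 : (fun k => conn G i x k j) = (1 / 2 : ℝ) • ((G x)⁻¹ *ᵥ v) := by
    ext k
    simp [conn, christoffel, Matrix.mulVec, dotProduct, hv]
  have h2 : (G x * conn G i x) l j = (G x *ᵥ fun k => conn G i x k j) l := rfl
  rw [h2, h1, Matrix.mulVec_smul, Matrix.mulVec_mulVec, Matrix.mul_nonsing_inv _ (h.isUnit_det hx)]
  simp [hv]

/-- The Levi-Civita connection is metric. -/
theorem mpd_eq (h : IsMetricOn G U) {x : E n} (hx : x ∈ U) (i : Fin n) :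
    mpd i G x = (conn G i x)ᵀ * G x + G x * conn G i x := by
  have h1 : (conn G i x)ᵀ * G x = (G x * conn G i x)ᵀ := by
    rw [Matrix.transpose_mul, h.symm x hx]
  ext a b
  rw [h1, Matrix.add_apply, Matrix.transpose_apply, h.mul_conn hx, h.mul_conn hx, mpd,
    Matrix.of_apply, h.pd_symm hx b i a, h.pd_symm hx a i b, h.pd_symm hx i b a]
  rw [h.pd_symm hx a b i]
  ring

/-- The Levi-Civita connection is the only symmetric metric connection. -/
theorem conn_unique (h : IsMetricOn G U) {x : E n} (hx : x ∈ U)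
    (A : Fin n → Matrix (Fin n) (Fin n) ℝ) (hs : ∀ i j k, A i k j = A j k i)
    (hm : ∀ i, mpd i G x = (A i)ᵀ * G x + G x * A i) (i : Fin n) : conn G i x = A i := by
  have hS : ∀ l i j, (G x * A i) l j = (G x * A j) l i := by
    intro l i j
    simp only [Matrix.mul_apply]
    exact Finset.sum_congr rfl fun k _ => by rw [hs]
  have hd : ∀ i a b, pd i (fun y => G y a b) x = (G x * A i) b a + (G x * A i) a b := by
    intro i a b
    have h1 : (A i)ᵀ * G x = (G x * A i)ᵀ := by
      rw [Matrix.transpose_mul, h.symm x hx]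
    have := congrFun (congrFun (hm i) a) b
    rwa [h1] at this
  -- Koszul's argument: `hd` expresses each ∂G through the lowered coefficients, `hS` makes these
  -- symmetric in the two form indices, and the alternating sum of three derivatives isolates one of
  -- them.
  have key : G x * conn G i x = G x * A i := by
    ext l j
    rw [h.mul_conn hx, hd, hd, hd, hS j i l, hS i j l, hS l j i, hS i l j]
    ring
  have := congrArg (fun B => (G x)⁻¹ * B) key
  simpa [← mul_assoc, Matrix.nonsing_inv_mul _ (h.isUnit_det hx)] using this

theorem smooth_conn (h : IsMetricOn G U) (i : Fin n) : SmoothMat (conn G i) U := by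
  intro k j
  refine ContDiffOn.mul contDiffOn_const (ContDiffOn.sum fun l _ => ?_)
  exact (h.smooth_inv k l).mul (((contDiffOn_pd h.isOpen (h.smooth j l) i).add
    (contDiffOn_pd h.isOpen (h.smooth i l) j)).sub (contDiffOn_pd h.isOpen (h.smooth i j) l))

theorem mpd_inv_eq (h : IsMetricOn G U) {x : E n} (hx : x ∈ U) (i : Fin n) :
    mpd i (fun y => (G y)⁻¹) x
      = -(conn G i x * (G x)⁻¹ + (G x)⁻¹ * (conn G i x)ᵀ) := by
  rw [mpd_inv h.isOpen h.smooth h.det_ne hx, h.mpd_eq hx, mul_add, add_mul]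
  have hu := h.isUnit_det hx
  rw [mul_assoc, mul_assoc, Matrix.mul_nonsing_inv _ hu, mul_one, ← mul_assoc _ (G x),
    Matrix.nonsing_inv_mul _ hu, one_mul, add_comm]

theorem _root_.ConfQuant.christoffelTrace_eq (x : E n) (i : Fin n) :
    christoffelTrace G i x = (conn G i x).trace := by
  simp only [christoffelTrace, Matrix.trace, Matrix.diag, conn, Matrix.of_apply]

/-- Jacobi's formula and metricity: the trace of G⁻¹(ΓᵀG + GΓ) is twice the trace of Γ. -/
theorem pd_log_det (h : IsMetricOn G U) {x : E n} (hx : x ∈ U) (i : Fin n) :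
    pd i (fun y => Real.log (G y).det) x = 2 * christoffelTrace G i x := by
  have hu := h.isUnit_det hx
  have hd : DifferentiableAt ℝ (fun y => (G y).det) x := diffAt h.isOpen (contDiffOn_det h.smooth) hx
  have h1 : pd i (fun y => Real.log (G y).det) x = ((G x).det)⁻¹ * pd i (fun y => (G y).det) x := by
    unfold pd
    rw [(hd.hasFDerivAt.log (h.det_ne x hx)).fderiv]; simp
  have h2 : ((G x).det)⁻¹ • (G x).adjugate = (G x)⁻¹ := by simp [Matrix.inv_def]
  rw [h1, pd_det h.isOpen h.smooth hx, ← smul_eq_mul, ← Matrix.trace_smul, ← Matrix.smul_mul, h2,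
    h.mpd_eq hx, mul_add, Matrix.trace_add, ← mul_assoc (G x)⁻¹ (G x), Matrix.nonsing_inv_mul _ hu,
    one_mul, ← mul_assoc, Matrix.trace_mul_comm, ← mul_assoc, Matrix.mul_nonsing_inv _ hu, one_mul,
    Matrix.trace_transpose, christoffelTrace_eq]
  ring

/-- `Real.log` is the logarithm of the absolute value, so this exponential form holds in every
signature and makes derivatives of powers of |det g| immediate. -/
theorem volPow_eq (h : IsMetricOn G U) (w : ℂ) {x : E n} (hx : x ∈ U) :
    volPow G w x = Complex.exp ((Real.log (G x).det : ℝ) * (w / 2)) :=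
  absPow_eq_exp (h.det_ne x hx) _

theorem smooth_volPow (h : IsMetricOn G U) (w : ℂ) : ContDiffOn ℝ ∞ (volPow G w) U :=
  contDiffOn_volPow h.smooth h.det_ne w

theorem volPow_add (h : IsMetricOn G U) (w z : ℂ) {x : E n} (hx : x ∈ U) :
    volPow G (w + z) x = volPow G w x * volPow G z x := by
  rw [h.volPow_eq _ hx, h.volPow_eq _ hx, h.volPow_eq _ hx, ← Complex.exp_add]
  congr 1; ring

theorem volPow_neg (h : IsMetricOn G U) (w : ℂ) {x : E n} (hx : x ∈ U) :
    volPow G w x * volPow G (-w) x = 1 := by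
  rw [← h.volPow_add _ _ hx, h.volPow_eq _ hx]; simp

theorem pd_volPow (h : IsMetricOn G U) (w : ℂ) {x : E n} (hx : x ∈ U) (i : Fin n) :
    pd i (volPow G w) x = w * christoffelTrace G i x * volPow G w x := by
  have hl : ContDiffOn ℝ ∞ (fun y => Real.log (G y).det) U :=
    (contDiffOn_det h.smooth).log h.det_ne
  have hlC : DifferentiableAt ℝ (fun y => ((Real.log (G y).det : ℝ) : ℂ)) x :=
    diffAt h.isOpen (Complex.ofRealCLM.contDiff.comp_contDiffOn hl) hx
  rw [pd_congr h.isOpen (fun y hy => h.volPow_eq w hy) hx,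
    pd_cexp (hlC.mul_const _), pd_mul hlC (differentiableAt_const _), pd_const,
    pd_ofReal (diffAt h.isOpen hl hx), h.pd_log_det hx, h.volPow_eq w hx]
  push_cast
  ring

end IsMetricOn

end LeviCivita

/-! ### The intrinsic formula evaluated at the geodesic Hamiltonian -/

section Intrinsic

variable {n : ℕ} {G : E n → Matrix (Fin n) (Fin n) ℝ} {U : Set (E n)}

namespace IsMetricOn

/-- Since |vol|^w is parallel, covariant differentiation of a density is ordinary differentiation of
the function obtained by dividing by |vol|^w. The same principle gives `hessDensity_eq`, and is what
matches ∇ᵢ∇ⱼ with the Laplace–Beltrami operator. -/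
theorem covDensity_eq (h : IsMetricOn G U) (w : ℂ) {φ : E n → ℂ} (hφ : ContDiffOn ℝ ∞ φ U)
    {x : E n} (hx : x ∈ U) (i : Fin n) :
    covDensity G w φ i x = volPow G w x * pd i (fun y => volPow G (-w) y * φ y) x := by
  rw [pd_mul (diffAt h.isOpen (h.smooth_volPow _) hx) (diffAt h.isOpen hφ hx), h.pd_volPow _ hx,
    covDensity]
  linear_combination (-(pd i φ x) + w * christoffelTrace G i x * φ x) * h.volPow_neg w hx

theorem hessDensity_eq (h : IsMetricOn G U) (w : ℂ) {φ : E n → ℂ} (hφ : ContDiffOn ℝ ∞ φ U)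
    {x : E n} (hx : x ∈ U) (i j : Fin n) :
    hessDensity G w φ i j x = volPow G w x * (pd i (pd j (fun y => volPow G (-w) y * φ y)) x
      - ∑ k, christoffel G k i j x * pd k (fun y => volPow G (-w) y * φ y) x) := by
  have hψ : ContDiffOn ℝ ∞ (fun y => volPow G (-w) y * φ y) U := (h.smooth_volPow _).mul hφ
  rw [hessDensity, covCovector,
    pd_congr h.isOpen (fun y hy => h.covDensity_eq w hφ hy j) hx,
    pd_mul (diffAt h.isOpen (h.smooth_volPow _) hx) (diffAt h.isOpen (contDiffOn_pd h.isOpen hψ j) hx),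
    h.pd_volPow _ hx, h.covDensity_eq w hφ hx, mul_sub, Finset.mul_sum]
  have : ∀ k, (christoffel G k i j x : ℂ) * covDensity G w φ k x
      = volPow G w x * (christoffel G k i j x * pd k (fun y => volPow G (-w) y * φ y) x) := by
    intro k; rw [h.covDensity_eq w hφ hx]; ring
  simp only [this]
  ring

/-- The tensor densities `c |vol|^w gⁱʲ` are parallel. -/
theorem covTensor_eq_zero (h : IsMetricOn G U) (w c : ℂ) {P : E n → Matrix (Fin n) (Fin n) ℂ}
    (hP : ∀ y ∈ U, ∀ a b, P y a b = c * (volPow G w y * (((G y)⁻¹ a b : ℝ) : ℂ)))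
    {x : E n} (hx : x ∈ U) (i j k : Fin n) : covTensor G w P i j k x = 0 := by
  have hI : DifferentiableAt ℝ (fun y => (G y)⁻¹ j k) x := diffAt h.isOpen (h.smooth_inv j k) hx
  have hIC : DifferentiableAt ℝ (fun y => (((G y)⁻¹ j k : ℝ) : ℂ)) x :=
    Complex.ofRealCLM.differentiableAt.comp x hI
  have hv := diffAt h.isOpen (h.smooth_volPow w) hx
  have h1 : pd i (fun y => (G y)⁻¹ j k) x = -(∑ l, christoffel G j i l x * (G x)⁻¹ l k
      + ∑ l, christoffel G k i l x * (G x)⁻¹ j l) := by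
    have := congrFun (congrFun (h.mpd_inv_eq hx i) j) k
    simp only [mpd, Matrix.of_apply, Matrix.neg_apply, Matrix.add_apply, Matrix.mul_apply,
      Matrix.transpose_apply, conn] at this
    rw [this]
    congr 2
    exact Finset.sum_congr rfl fun l _ => mul_comm _ _
  rw [covTensor, pd_congr h.isOpen (fun y hy => hP y hy j k) hx, pd_const_mul (hv.fun_mul hIC),
    pd_mul hv hIC, pd_ofReal hI, h1, h.pd_volPow _ hx]
  simp only [hP x hx]
  push_cast
  have e1 : ∑ l, (christoffel G j i l x : ℂ) * (c * (volPow G w x * ((G x)⁻¹ l k : ℝ)))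
      = c * volPow G w x * ∑ l, (christoffel G j i l x : ℂ) * ((G x)⁻¹ l k : ℝ) := by
    rw [Finset.mul_sum]; exact Finset.sum_congr rfl fun _ _ => by ring
  have e2 : ∑ l, (christoffel G k i l x : ℂ) * (c * (volPow G w x * ((G x)⁻¹ j l : ℝ)))
      = c * volPow G w x * ∑ l, (christoffel G k i l x : ℂ) * ((G x)⁻¹ j l : ℝ) := by
    rw [Finset.mul_sum]; exact Finset.sum_congr rfl fun _ _ => by ring
  rw [e1, e2]
  ring

theorem hessTensor_eq_zero (h : IsMetricOn G U) (w c : ℂ) {P : E n → Matrix (Fin n) (Fin n) ℂ}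
    (hP : ∀ y ∈ U, ∀ a b, P y a b = c * (volPow G w y * (((G y)⁻¹ a b : ℝ) : ℂ)))
    {x : E n} (hx : x ∈ U) (i j k l : Fin n) : hessTensor G w P i j k l x = 0 := by
  rw [hessTensor, covTensor',
    pd_congr h.isOpen (fun y hy => h.covTensor_eq_zero w c hP hy j k l) hx, pd_const]
  simp [h.covTensor_eq_zero w c hP hx]

theorem sum_inv_mul (h : IsMetricOn G U) {x : E n} (hx : x ∈ U) :
    ∑ i, ∑ j, G x i j * (G x)⁻¹ i j = n := by
  have h1 : ∀ i, ∑ j, G x i j * (G x)⁻¹ i j = (G x * (G x)⁻¹) i i := by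
    intro i
    rw [Matrix.mul_apply]
    refine Finset.sum_congr rfl fun j _ => ?_
    conv_lhs => rw [← h.inv_symm hx]
    rfl
  simp [h1, Matrix.mul_nonsing_inv _ (h.isUnit_det hx)]

/-- P₂ is parallel, so the terms in β₁, …, β₄ drop out. The β₅ term traces the Ricci tensor to R,
and the β₆ term acquires the factor gᵢⱼgⁱʲ = n. The constant c is there to receive the factor −ħ².
-/
theorem quantizeLocal_eq (h : IsMetricOn G U) (lam mu c : ℂ)
    {P2 : E n → Matrix (Fin n) (Fin n) ℂ}
    (hP : ∀ y ∈ U, ∀ a b, P2 y a b = c * (volPow G (mu - lam) y * (((G y)⁻¹ a b : ℝ) : ℂ)))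
    {φ : E n → ℂ} (hφ : ContDiffOn ℝ ∞ φ U) {x : E n} (hx : x ∈ U) :
    quantizeLocal G lam mu P2 (fun _ => 0) (fun _ => 0) φ x
      = c * (laplace G lam mu φ x + (coeffBeta5 n lam mu + n * coeffBeta6 n lam mu) *
          curvatureOp G lam mu φ x) := by
  have hz : ∀ (i : Fin n) (y : E n), covVector G (mu - lam) (fun _ => 0) i i y = 0 := by
    intro i y
    simp [covVector, pd_const]
  unfold quantizeLocal
  simp only [h.covTensor_eq_zero _ c hP hx, h.hessTensor_eq_zero _ c hP hx, hz, hP x hx]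
  have h1 : ∑ i, ∑ j, c * (volPow G (mu - lam) x * (((G x)⁻¹ i j : ℝ) : ℂ)) *
      hessDensity G lam φ i j x = c * laplace G lam mu φ x := by
    have hv : volPow G mu x = volPow G (mu - lam) x * volPow G lam x := by
      rw [← h.volPow_add _ _ hx]; congr 1; ring
    rw [laplace, hv]
    simp only [Finset.mul_sum]
    refine Finset.sum_congr rfl fun i _ => Finset.sum_congr rfl fun j _ => ?_
    rw [h.hessDensity_eq lam hφ hx]; ring
  have h2 : ∑ i, ∑ j, ((ricci G i j x : ℝ) : ℂ) *
      (c * (volPow G (mu - lam) x * (((G x)⁻¹ i j : ℝ) : ℂ)))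
      = c * volPow G (mu - lam) x * (scalarCurvature G x : ℝ) := by
    simp only [scalarCurvature]
    push_cast
    simp only [Finset.mul_sum]
    exact Finset.sum_congr rfl fun i _ => Finset.sum_congr rfl fun j _ => by ring
  have h3 : ∑ i, ∑ j, ((G x i j : ℝ) : ℂ) *
      (c * (volPow G (mu - lam) x * (((G x)⁻¹ i j : ℝ) : ℂ)))
      = c * volPow G (mu - lam) x * n := by
    have := congrArg (fun r : ℝ => (r : ℂ)) (h.sum_inv_mul hx)
    push_cast at this
    rw [← this]
    simp only [Finset.mul_sum]
    exact Finset.sum_congr rfl fun i _ => Finset.sum_congr rfl fun j _ => by ring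
  rw [h1, h2, h3, curvatureOp]
  simp
  ring

end IsMetricOn

/-- These are the denominators met in the proof; in order they come from excluding δ = 2/n,
(n+2)/(2n) and (n+1)/n. -/
theorem NonResonant.ne {n : ℕ} (hn : 2 ≤ n) {δ : ℂ} (h : NonResonant n δ) :
    (n : ℂ) * δ - 2 ≠ 0 ∧ (n : ℂ) + 2 - 2 * n * δ ≠ 0 ∧ 1 + n * (1 - δ) ≠ 0 := by
  have hn0 : (n : ℂ) ≠ 0 := by
    have : n ≠ 0 := by omega
    exact_mod_cast this
  simp only [NonResonant, Set.mem_insert_iff, Set.mem_singleton_iff, not_or] at h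
  obtain ⟨h1, h2, -, h4, -⟩ := h
  refine ⟨fun h0 => h1 ?_, fun h0 => h2 ?_, fun h0 => h4 ?_⟩ <;> rw [eq_div_iff (by simp [hn0])]
  · linear_combination h0
  · linear_combination -h0
  · linear_combination -h0

/-- Over a common denominator the identity is (n−1)(n+2−2nδ) + n(nδ−2) = (n−2)(1+n(1−δ)), whose
right side cancels the factors of β₅ and β₆ that are absent from C. -/
theorem coeffBeta_add {n : ℕ} (hn : 3 ≤ n) {lam mu : ℂ} (h : NonResonant n (mu - lam)) :
    coeffBeta5 n lam mu + n * coeffBeta6 n lam mu = curvatureCoupling n lam mu := by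
  obtain ⟨-, h2, h3⟩ := h.ne (by omega)
  have e1 : (n : ℂ) - 1 ≠ 0 := by
    rw [sub_ne_zero]; exact_mod_cast (by omega : n ≠ 1)
  have e2 : (n : ℂ) - 2 ≠ 0 := by
    rw [sub_ne_zero]; exact_mod_cast (by omega : n ≠ 2)
  have e3 : (n : ℂ) + 2 - 2 * n * (mu - lam) = 2 + n * (1 - 2 * (mu - lam)) := by ring
  unfold coeffBeta5 coeffBeta6 curvatureCoupling
  rw [e3] at h2 ⊢
  field_simp
  ring

end Intrinsic

/-! ### The intrinsic formula at the Hamiltonian, chart by chart on the manifold. -/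

section Manifold

variable {n : ℕ} {M : Type*} [TopologicalSpace M] [ChartedSpace (E n) M]

theorem PseudoRiemannianMetric.isMetricOn (g : PseudoRiemannianMetric n M) (e : Chart n M) :
    IsMetricOn (g.coeff e) e.1.target :=
  ⟨e.1.open_target, g.smooth e, g.symm e, g.nondegenerate e⟩

theorem symbolScale_hamiltonian_two (g : PseudoRiemannianMetric n M) (w : ℂ) (hbar : ℝ)
    (e : Chart n M) {y : E n} (hy : y ∈ e.1.target) (a b : Fin n) :
    (symbolScale n M w hbar (geodesicHamiltonian g w)).1.1 e y a b
      = -(hbar : ℂ) ^ 2 * (volPow (g.coeff e) w y * (((g.coeff e y)⁻¹ a b : ℝ) : ℂ)) := by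
  simp [symbolScale, geodesicHamiltonian, hy, mul_pow]

theorem quantize_hamiltonian (hn : 3 ≤ n) (g : PseudoRiemannianMetric n M) (hbar : ℝ)
    {lam mu : ℂ} (h : NonResonant n (mu - lam)) (φ : Density n M lam) (e : Chart n M)
    {x : E n} (hx : x ∈ e.1.target) :
    quantize g lam mu (symbolScale n M _ hbar (geodesicHamiltonian g (mu - lam))) φ e x =
      -(hbar : ℂ) ^ 2 * laplacePlusCurvature g lam mu (curvatureCoupling n lam mu) φ e x := by
  have h1 : (symbolScale n M _ hbar (geodesicHamiltonian g (mu - lam))).2.1.1 e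
      = fun _ => 0 := by
    ext y i; simp [symbolScale, geodesicHamiltonian]
  have h2 : (symbolScale n M _ hbar (geodesicHamiltonian g (mu - lam))).2.2.1 e
      = fun _ => 0 := by
    ext y; simp [symbolScale, geodesicHamiltonian]
  rw [quantize, h1, h2, (g.isMetricOn e).quantizeLocal_eq lam mu (-(hbar : ℂ) ^ 2)
    (fun y hy a b => symbolScale_hamiltonian_two g _ hbar e hy a b) (φ.2.2.1 e) hx,
    coeffBeta_add hn h, laplacePlusCurvature]

end Manifold

/-! ### Invariance under changes of coordinates -/

section Invariance

variable {n : ℕ}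

/-- The Jacobian matrix of a map `ℝⁿ → ℝⁿ`. -/
def jacobian (φ : E n → E n) (x : E n) : Matrix (Fin n) (Fin n) ℝ :=
  Matrix.of fun i a => (pd a φ x) i

/-- The curvature of the Levi-Civita connection as a matrix-valued two-form. -/
def curv (G : E n → Matrix (Fin n) (Fin n) ℝ) (i j : Fin n) (x : E n) :
    Matrix (Fin n) (Fin n) ℝ :=
  mpd i (conn G j) x - mpd j (conn G i) x + (conn G i x * conn G j x - conn G j x * conn G i x)

/-- Expressing Ricci as a contraction of the matrix-valued curvature reduces its transformation law
to matrix algebra; the symmetry of the Christoffel symbols aligns the lower indices. -/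
theorem IsMetricOn.ricci_eq {G : E n → Matrix (Fin n) (Fin n) ℝ} {U : Set (E n)}
    (h : IsMetricOn G U) {x : E n} (hx : x ∈ U) (i j : Fin n) :
    ricci G i j x = ∑ k, curv G k j x k i := by
  unfold ricci curv
  refine Finset.sum_congr rfl fun k _ => ?_
  simp only [Matrix.add_apply, Matrix.sub_apply, Matrix.mul_apply, mpd, conn, Matrix.of_apply]
  rw [Finset.sum_sub_distrib,
    pd_congr h.isOpen (fun y hy => h.christoffel_symm hy k i j) hx k,
    pd_congr h.isOpen (fun y hy => h.christoffel_symm hy k i k) hx j]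
  congr 2 <;> refine Finset.sum_congr rfl fun l _ => ?_
  · rw [h.christoffel_symm hx l i j]
  · rw [h.christoffel_symm hx l i k]

/-- `φ` is a smooth isometry from the metric `G` on `U` to the metric `G'` on `U'`. -/
structure IsIsometry (φ : E n → E n) (G G' : E n → Matrix (Fin n) (Fin n) ℝ)
    (U U' : Set (E n)) : Prop where
  source : IsMetricOn G U
  target : IsMetricOn G' U'
  smooth : ContDiffOn ℝ ∞ φ U
  mapsTo : Set.MapsTo φ U U'
  eq : ∀ x ∈ U, G x = (jacobian φ x)ᵀ * G' (φ x) * jacobian φ x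

variable {φ : E n → E n} {G G' : E n → Matrix (Fin n) (Fin n) ℝ} {U U' : Set (E n)}

namespace IsIsometry

theorem comp_coord (h : IsIsometry φ G G' U U') (m : Fin n) :
    ContDiffOn ℝ ∞ (fun y => φ y m) U :=
  (EuclideanSpace.proj (𝕜 := ℝ) m).contDiff.comp_contDiffOn h.smooth

theorem jacobian_apply (h : IsIsometry φ G G' U U') {x : E n} (hx : x ∈ U) (m a : Fin n) :
    jacobian φ x m a = pd a (fun y => φ y m) x :=
  (pd_apply (diffAt h.source.isOpen h.smooth hx) a m).symm

theorem smooth_jacobian (h : IsIsometry φ G G' U U') : SmoothMat (jacobian φ) U := by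
  intro m a
  exact (contDiffOn_pd h.source.isOpen (h.comp_coord m) a).congr
    fun x hx => h.jacobian_apply hx m a

/-- Both sides are second derivatives of one component of φ. This symmetry is what removes the
inhomogeneous terms from the curvature below. -/
theorem pd_jacobian_symm (h : IsIsometry φ G G' U U') {x : E n} (hx : x ∈ U) (m i j : Fin n) :
    pd i (fun y => jacobian φ y m j) x = pd j (fun y => jacobian φ y m i) x := by
  rw [pd_congr h.source.isOpen (fun y hy => h.jacobian_apply hy m j) hx,
    pd_congr h.source.isOpen (fun y hy => h.jacobian_apply hy m i) hx]
  exact pd_comm h.source.isOpen (h.comp_coord m) hx i j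

theorem det_eq (h : IsIsometry φ G G' U U') {x : E n} (hx : x ∈ U) :
    (G x).det = (jacobian φ x).det * (G' (φ x)).det * (jacobian φ x).det := by
  rw [h.eq x hx, Matrix.det_mul, Matrix.det_mul, Matrix.det_transpose]

theorem det_jacobian_ne (h : IsIsometry φ G G' U U') {x : E n} (hx : x ∈ U) :
    (jacobian φ x).det ≠ 0 := by
  intro h0
  exact h.source.det_ne x hx (by rw [h.det_eq hx, h0]; simp)

theorem isUnit_jacobian (h : IsIsometry φ G G' U U') {x : E n} (hx : x ∈ U) :
    IsUnit (jacobian φ x).det :=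
  isUnit_iff_ne_zero.2 (h.det_jacobian_ne hx)

theorem jacobian_mul_inv_mul (h : IsIsometry φ G G' U U') {x : E n} (hx : x ∈ U) :
    jacobian φ x * (G x)⁻¹ * (jacobian φ x)ᵀ = (G' (φ x))⁻¹ := by
  have hJt : IsUnit ((jacobian φ x)ᵀ).det := by
    rw [Matrix.det_transpose]; exact h.isUnit_jacobian hx
  rw [h.eq x hx, Matrix.mul_inv_rev, Matrix.mul_inv_rev, ← mul_assoc,
    Matrix.mul_nonsing_inv _ (h.isUnit_jacobian hx), one_mul, mul_assoc,
    Matrix.nonsing_inv_mul _ hJt, mul_one]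

theorem volPow_eq (h : IsIsometry φ G G' U U') (w : ℂ) {x : E n} (hx : x ∈ U) :
    volPow G w x = absPow (jacobian φ x).det w * volPow G' w (φ x) := by
  rw [volPow, h.det_eq hx, absPow_mul, absPow_mul, ← absPow_sq (h.det_jacobian_ne hx) w, volPow]
  ring

theorem smooth_comp (h : IsIsometry φ G G' U U') {F : Type*} [NormedAddCommGroup F]
    [NormedSpace ℝ F] {f : E n → F} (hf : ContDiffOn ℝ ∞ f U') :
    ContDiffOn ℝ ∞ (fun y => f (φ y)) U :=
  hf.comp h.smooth h.mapsTo

theorem pd_comp' (h : IsIsometry φ G G' U U') {F : Type*} [NormedAddCommGroup F]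
    [NormedSpace ℝ F] {f : E n → F} (hf : ContDiffOn ℝ ∞ f U') {x : E n} (hx : x ∈ U)
    (i : Fin n) : pd i (fun y => f (φ y)) x = ∑ b, jacobian φ x b i • pd b f (φ x) :=
  pd_comp (diffAt h.target.isOpen hf (h.mapsTo hx)) (diffAt h.source.isOpen h.smooth hx) i

theorem mpd_comp (h : IsIsometry φ G G' U U') {B : E n → Matrix (Fin n) (Fin n) ℝ}
    (hB : SmoothMat B U') {x : E n} (hx : x ∈ U) (i : Fin n) :
    mpd i (fun y => B (φ y)) x = ∑ c, jacobian φ x c i • mpd c B (φ x) := by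
  ext a b
  simp only [Matrix.sum_apply, Matrix.smul_apply, mpd, Matrix.of_apply]
  exact h.pd_comp' (hB a b) hx i

/-- The pull-back of a matrix-valued one-form. -/
def pull (φ : E n → E n) (B : Fin n → E n → Matrix (Fin n) (Fin n) ℝ) (i : Fin n) (x : E n) :
    Matrix (Fin n) (Fin n) ℝ :=
  ∑ c, jacobian φ x c i • B c (φ x)

theorem smooth_pull (h : IsIsometry φ G G' U U') {B : Fin n → E n → Matrix (Fin n) (Fin n) ℝ}
    (hB : ∀ c, SmoothMat (B c) U') (i : Fin n) : SmoothMat (pull φ B i) U := by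
  intro a b
  simp only [pull, Matrix.sum_apply, Matrix.smul_apply, smul_eq_mul]
  exact ContDiffOn.sum fun c _ => (h.smooth_jacobian c i).mul (h.smooth_comp (hB c a b))

theorem mpd_pull (h : IsIsometry φ G G' U U') {B : Fin n → E n → Matrix (Fin n) (Fin n) ℝ}
    (hB : ∀ c, SmoothMat (B c) U') {x : E n} (hx : x ∈ U) (i j : Fin n) :
    mpd i (pull φ B j) x = ∑ c, pd i (fun y => jacobian φ y c j) x • B c (φ x)
      + ∑ c, ∑ d, (jacobian φ x c i * jacobian φ x d j) • mpd c (B d) (φ x) := by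
  ext a b
  have hd1 : ∀ c, DifferentiableAt ℝ (fun y => jacobian φ y c j) x := fun c =>
    diffAt h.source.isOpen (h.smooth_jacobian c j) hx
  have hd2 : ∀ c, DifferentiableAt ℝ (fun y => B c (φ y) a b) x := fun c =>
    diffAt h.source.isOpen (h.smooth_comp (hB c a b)) hx
  have h1 : mpd i (pull φ B j) x a b
      = pd i (fun y => ∑ c, jacobian φ y c j * B c (φ y) a b) x := by
    simp only [mpd, Matrix.of_apply, pull, Matrix.sum_apply, Matrix.smul_apply, smul_eq_mul]
  rw [h1, pd_sum _ fun c _ => (hd1 c).fun_mul (hd2 c)]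
  simp only [Matrix.add_apply, Matrix.sum_apply, Matrix.smul_apply, smul_eq_mul]
  rw [Finset.sum_comm, ← Finset.sum_add_distrib]
  refine Finset.sum_congr rfl fun c _ => ?_
  rw [pd_mul (hd1 c) (hd2 c), h.pd_comp' (hB c a b) hx, Finset.mul_sum]
  congr 1
  refine Finset.sum_congr rfl fun d _ => ?_
  simp only [smul_eq_mul, mpd, Matrix.of_apply]
  ring

/-- The transformation law of the Christoffel symbols. -/
theorem jacobian_mul_conn (h : IsIsometry φ G G' U U') {x : E n} (hx : x ∈ U) (i : Fin n) :
    jacobian φ x * conn G i x = pull φ (conn G') i x * jacobian φ x + mpd i (jacobian φ) x := by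
  set J := jacobian φ x with hJ
  have hu := h.isUnit_jacobian hx
  have hGφ : SmoothMat (fun y => G' (φ y)) U := fun a b => h.smooth_comp (h.target.smooth a b)
  set B : Fin n → Matrix (Fin n) (Fin n) ℝ := fun i =>
    pull φ (conn G') i x * J + mpd i (jacobian φ) x with hB
  have hJB : ∀ i, J * (J⁻¹ * B i) = B i := fun i => by
    rw [← mul_assoc, Matrix.mul_nonsing_inv _ hu, one_mul]
  have hBs : ∀ i j k, B i k j = B j k i := by
    intro i j k
    simp only [hB, Matrix.add_apply, Matrix.mul_apply, pull, Matrix.sum_apply, Matrix.smul_apply,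
      smul_eq_mul, mpd, Matrix.of_apply, h.pd_jacobian_symm hx k i j]
    congr 1
    simp only [Finset.sum_mul]
    rw [Finset.sum_comm]
    refine Finset.sum_congr rfl fun c _ => Finset.sum_congr rfl fun d _ => ?_
    simp only [conn, Matrix.of_apply]
    rw [h.target.christoffel_symm (h.mapsTo hx) k c d]; ring
  -- The candidate J⁻¹B is symmetric in its lower indices by `hBs` and metric for the pulled-back
  -- metric, so uniqueness of the Levi-Civita connection identifies it.
  have key : conn G i x = J⁻¹ * B i := by
    refine h.source.conn_unique hx (fun i => J⁻¹ * B i) (fun i j k => ?_) (fun i => ?_) i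
    · simp only [Matrix.mul_apply]
      exact Finset.sum_congr rfl fun c _ => by rw [hBs]
    · have hcomp : mpd i (fun y => G' (φ y)) x = (pull φ (conn G') i x)ᵀ * G' (φ x)
          + G' (φ x) * pull φ (conn G') i x := by
        rw [h.mpd_comp h.target.smooth hx]
        simp only [h.target.mpd_eq (h.mapsTo hx), pull, Matrix.transpose_sum,
          Matrix.transpose_smul, Finset.sum_mul, Finset.mul_sum, smul_add,
          Finset.sum_add_distrib, Matrix.smul_mul, Matrix.mul_smul]
      have e1 : G x * (J⁻¹ * B i) = Jᵀ * G' (φ x) * B i := by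
        rw [h.eq x hx, mul_assoc, ← hJ, hJB]
      have e2 : (J⁻¹ * B i)ᵀ * G x = (B i)ᵀ * G' (φ x) * J := by
        rw [h.eq x hx, ← hJ, mul_assoc, ← mul_assoc, ← Matrix.transpose_mul, hJB, mul_assoc]
      rw [e1, e2, mpd_congr h.source.isOpen h.eq hx,
        mpd_mul h.source.isOpen (h.smooth_jacobian.transpose.mul hGφ) h.smooth_jacobian hx,
        mpd_mul h.source.isOpen h.smooth_jacobian.transpose hGφ hx, hcomp, mpd_transpose, ← hJ]
      simp only [hB, Matrix.transpose_add, Matrix.transpose_mul]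
      noncomm_ring
  rw [key, hJB]

/-- In the antisymmetrized derivative of the pulled-back connection form, the terms carrying second
derivatives of φ are symmetric in i and j and cancel; the quadratic terms pull back factor by
factor. -/
theorem curv_pull (h : IsIsometry φ G G' U U') {x : E n} (hx : x ∈ U) (i j : Fin n) :
    mpd i (pull φ (conn G') j) x - mpd j (pull φ (conn G') i) x
      + (pull φ (conn G') i x * pull φ (conn G') j x
        - pull φ (conn G') j x * pull φ (conn G') i x)
      = ∑ c, ∑ d, (jacobian φ x c i * jacobian φ x d j) • curv G' c d (φ x) := by
  have hs := h.target.smooth_conn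
  rw [h.mpd_pull hs hx, h.mpd_pull hs hx]
  have e1 : ∀ c, pd i (fun y => jacobian φ y c j) x • conn G' c (φ x)
      = pd j (fun y => jacobian φ y c i) x • conn G' c (φ x) := fun c => by
    rw [h.pd_jacobian_symm hx]
  simp only [e1]
  have e2 : pull φ (conn G') i x * pull φ (conn G') j x
      = ∑ c, ∑ d, (jacobian φ x c i * jacobian φ x d j) • (conn G' c (φ x) * conn G' d (φ x)) := by
    simp only [pull, Finset.sum_mul, Finset.mul_sum, Matrix.smul_mul, Matrix.mul_smul, smul_smul]
    rw [Finset.sum_comm]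
    exact Finset.sum_congr rfl fun c _ => Finset.sum_congr rfl fun d _ => by rw [mul_comm]
  have e3 : pull φ (conn G') j x * pull φ (conn G') i x
      = ∑ c, ∑ d, (jacobian φ x c i * jacobian φ x d j) • (conn G' d (φ x) * conn G' c (φ x)) := by
    simp only [pull, Finset.sum_mul, Finset.mul_sum, Matrix.smul_mul, Matrix.mul_smul, smul_smul]
  have e4 : ∑ c, ∑ d, (jacobian φ x c j * jacobian φ x d i) • mpd c (conn G' d) (φ x)
      = ∑ c, ∑ d, (jacobian φ x c i * jacobian φ x d j) • mpd d (conn G' c) (φ x) := by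
    rw [Finset.sum_comm]
    exact Finset.sum_congr rfl fun c _ => Finset.sum_congr rfl fun d _ => by rw [mul_comm]
  rw [e2, e3, e4, add_sub_add_left_eq_sub]
  simp only [curv, smul_add, smul_sub, Finset.sum_add_distrib, Finset.sum_sub_distrib]

/-- The transformation law of the curvature. -/
theorem jacobian_mul_curv (h : IsIsometry φ G G' U U') {x : E n} (hx : x ∈ U) (i j : Fin n) :
    jacobian φ x * curv G i j x
      = (∑ c, ∑ d, (jacobian φ x c i * jacobian φ x d j) • curv G' c d (φ x)) * jacobian φ x := by
  have hU := h.source.isOpen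
  have hJ := h.smooth_jacobian
  have hA := h.source.smooth_conn
  have hP := h.smooth_pull h.target.smooth_conn
  -- Differentiate the transformation law J Γⱼ = Aⱼ J + ∂ⱼJ, with A the pulled-back connection.
  -- After antisymmetrization ∂ᵢ∂ⱼJ disappears, and the first derivatives of J are eliminated by the
  -- same law.
  have hder : ∀ i j, jacobian φ x * mpd i (conn G j) x
      = mpd i (pull φ (conn G') j) x * jacobian φ x + pull φ (conn G') j x * mpd i (jacobian φ) x
        + mpd i (mpd j (jacobian φ)) x - mpd i (jacobian φ) x * conn G j x := by
    intro i j
    have := mpd_congr hU (fun y hy => h.jacobian_mul_conn hy j) hx i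
    rw [mpd_mul hU hJ (hA j) hx, mpd_add hU ((hP j).mul hJ) (hJ.mpd hU j) hx,
      mpd_mul hU (hP j) hJ hx] at this
    rw [← this]; abel
  rw [← h.curv_pull hx, curv, mul_add, mul_sub, mul_sub, hder, hder, mpd_comm hU hJ hx j i]
  have g1 := fun i => (eq_sub_of_add_eq' (h.jacobian_mul_conn hx i).symm)
  have g2 := fun i => h.jacobian_mul_conn hx i
  rw [← mul_assoc, ← mul_assoc, g2, g2]
  have g3 : ∀ i, mpd i (jacobian φ) x
      = jacobian φ x * conn G i x - pull φ (conn G') i x * jacobian φ x := fun i => by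
    rw [g2]; abel
  simp only [add_mul, sub_mul]
  simp only [mul_assoc, g2]
  noncomm_ring

theorem ricci_eq (h : IsIsometry φ G G' U U') {x : E n} (hx : x ∈ U) (i j : Fin n) :
    ricci G i j x
      = ∑ a, ∑ b, (jacobian φ x a i * jacobian φ x b j) • ricci G' a b (φ x) := by
  have hu := h.isUnit_jacobian hx
  set J := jacobian φ x with hJ
  have hc : ∀ k, curv G k j x k i
      = ∑ m, J⁻¹ k m * ∑ c, J c k * ∑ d, J d j * (curv G' c d (φ x) * J) m i := by
    intro k
    have h1 : curv G k j x
        = J⁻¹ * ∑ c, J c k • ∑ d, J d j • (curv G' c d (φ x) * J) := by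
      have h2 := h.jacobian_mul_curv hx k j
      simp only [Finset.sum_mul, Matrix.smul_mul, mul_smul, ← Finset.smul_sum] at h2
      rw [← hJ] at h2
      rw [← h2, ← mul_assoc, Matrix.nonsing_inv_mul _ hu, one_mul]
    rw [h1, Matrix.mul_apply]
    simp only [Matrix.sum_apply, Matrix.smul_apply, smul_eq_mul]
  have hK : ∀ c m, ∑ k, J c k * J⁻¹ k m = if c = m then 1 else 0 := by
    intro c m
    rw [← Matrix.mul_apply, Matrix.mul_nonsing_inv _ hu, Matrix.one_apply]
  -- The contracted upper index brings J⁻¹ and the contracted form index brings J; they meet and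
  -- give the identity, so the contraction is invariant.
  have hswap : ∀ N : Fin n → Fin n → ℝ,
      ∑ k, ∑ m, J⁻¹ k m * ∑ c, J c k * N c m = ∑ m, N m m := by
    intro N
    rw [Finset.sum_comm]
    refine Finset.sum_congr rfl fun m _ => ?_
    have : ∀ k, J⁻¹ k m * ∑ c, J c k * N c m = ∑ c, J c k * J⁻¹ k m * N c m := by
      intro k
      rw [Finset.mul_sum]
      exact Finset.sum_congr rfl fun c _ => by ring
    simp only [this]
    rw [Finset.sum_comm]
    simp only [← Finset.sum_mul, hK]
    simp
  rw [h.source.ricci_eq hx]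
  simp only [hc]
  rw [hswap fun c m => ∑ d, J d j * (curv G' c d (φ x) * J) m i]
  simp only [h.target.ricci_eq (h.mapsTo hx), Matrix.mul_apply, smul_eq_mul, Finset.mul_sum]
  calc ∑ m, ∑ d, ∑ a, J d j * (curv G' m d (φ x) m a * J a i)
      = ∑ m, ∑ a, ∑ d, J d j * (curv G' m d (φ x) m a * J a i) :=
        Finset.sum_congr rfl fun m _ => Finset.sum_comm
    _ = ∑ a, ∑ d, ∑ m, J d j * (curv G' m d (φ x) m a * J a i) := by
        rw [Finset.sum_comm]
        exact Finset.sum_congr rfl fun a _ => Finset.sum_comm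
    _ = _ := Finset.sum_congr rfl fun a _ => Finset.sum_congr rfl fun d _ =>
        Finset.sum_congr rfl fun m _ => by ring

/-- Contraction of a covariant two-tensor with the metric. -/
theorem contract_eq (h : IsIsometry φ G G' U U') {V : Type*} [AddCommGroup V] [Module ℝ V]
    {x : E n} (hx : x ∈ U) {T T' : Fin n → Fin n → V}
    (hT : ∀ i j, T i j = ∑ a, ∑ b, (jacobian φ x a i * jacobian φ x b j) • T' a b) :
    ∑ i, ∑ j, (G x)⁻¹ i j • T i j = ∑ a, ∑ b, (G' (φ x))⁻¹ a b • T' a b := by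
  rw [← h.jacobian_mul_inv_mul hx]
  simp only [hT, Finset.smul_sum, smul_smul, Matrix.mul_apply, Matrix.transpose_apply,
    Finset.sum_mul, Finset.sum_smul]
  calc ∑ i, ∑ j, ∑ a, ∑ b, ((G x)⁻¹ i j * (jacobian φ x a i * jacobian φ x b j)) • T' a b
      = ∑ i, ∑ a, ∑ b, ∑ j, ((G x)⁻¹ i j * (jacobian φ x a i * jacobian φ x b j)) • T' a b := by
        refine Finset.sum_congr rfl fun i _ => ?_
        rw [Finset.sum_comm]
        exact Finset.sum_congr rfl fun a _ => Finset.sum_comm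
    _ = ∑ a, ∑ b, ∑ i, ∑ j, ((G x)⁻¹ i j * (jacobian φ x a i * jacobian φ x b j)) • T' a b := by
        rw [Finset.sum_comm]
        exact Finset.sum_congr rfl fun a _ => Finset.sum_comm
    _ = _ := by
        refine Finset.sum_congr rfl fun a _ => Finset.sum_congr rfl fun b _ => ?_
        rw [Finset.sum_comm]
        refine Finset.sum_congr rfl fun i _ => Finset.sum_congr rfl fun j _ => ?_
        congr 1; ring

theorem scalarCurvature_eq (h : IsIsometry φ G G' U U') {x : E n} (hx : x ∈ U) :
    scalarCurvature G x = scalarCurvature G' (φ x) :=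
  h.contract_eq hx fun i j => h.ricci_eq hx i j

/-- The second derivatives of φ produced by the chain rule are exactly the inhomogeneous term in the
transformation law of the Christoffel symbols, so the covariant Hessian is tensorial. -/
theorem hess_eq (h : IsIsometry φ G G' U U') {ψ : E n → ℂ} (hψ : ContDiffOn ℝ ∞ ψ U')
    {x : E n} (hx : x ∈ U) (i j : Fin n) :
    pd i (pd j (fun y => ψ (φ y))) x
        - ∑ k, (christoffel G k i j x : ℂ) * pd k (fun y => ψ (φ y)) x
      = ∑ a, ∑ b, (jacobian φ x a i * jacobian φ x b j) • (pd a (pd b ψ) (φ x)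
        - ∑ m, (christoffel G' m a b (φ x) : ℂ) * pd m ψ (φ x)) := by
  have hU := h.source.isOpen
  have hJd : ∀ b, DifferentiableAt ℝ (fun y => (jacobian φ y b j : ℂ)) x := fun b =>
    Complex.ofRealCLM.differentiableAt.comp x (diffAt hU (h.smooth_jacobian b j) hx)
  have hp : ∀ b, ContDiffOn ℝ ∞ (pd b ψ) U' := fun b => contDiffOn_pd h.target.isOpen hψ b
  have hpd : ∀ b, DifferentiableAt ℝ (fun y => pd b ψ (φ y)) x := fun b =>
    diffAt hU (h.smooth_comp (hp b)) hx
  have h1 : pd i (pd j (fun y => ψ (φ y))) x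
      = ∑ b, ((pd i (fun y => jacobian φ y b j) x : ℝ) * pd b ψ (φ x)
        + (jacobian φ x b j : ℂ) * ∑ a, (jacobian φ x a i : ℂ) * pd a (pd b ψ) (φ x)) := by
    have : ∀ y ∈ U, pd j (fun y => ψ (φ y)) y = ∑ b, (jacobian φ y b j : ℂ) * pd b ψ (φ y) := by
      intro y hy
      rw [h.pd_comp' hψ hy]; simp
    rw [pd_congr hU this hx, pd_sum _ fun b _ => (hJd b).fun_mul (hpd b)]
    refine Finset.sum_congr rfl fun b _ => ?_
    rw [pd_mul (hJd b) (hpd b), pd_ofReal (diffAt hU (h.smooth_jacobian b j) hx),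
      h.pd_comp' (hp b) hx]
    simp
  have h2 : ∑ k, (christoffel G k i j x : ℂ) * pd k (fun y => ψ (φ y)) x
      = ∑ b, (((jacobian φ x * conn G i x) b j : ℝ) : ℂ) * pd b ψ (φ x) := by
    simp only [h.pd_comp' hψ hx, Finset.mul_sum, Matrix.mul_apply, Complex.ofReal_sum,
      Finset.sum_mul]
    rw [Finset.sum_comm]
    refine Finset.sum_congr rfl fun b _ => Finset.sum_congr rfl fun k _ => ?_
    simp [conn]; ring
  rw [h1, h2]
  have h3 : ∀ b, (jacobian φ x * conn G i x) b j
      = ∑ c, ∑ a, jacobian φ x a i * jacobian φ x c j * christoffel G' b a c (φ x)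
        + pd i (fun y => jacobian φ y b j) x := by
    intro b
    rw [h.jacobian_mul_conn hx]
    simp only [Matrix.add_apply, Matrix.mul_apply, pull, Matrix.sum_apply, Matrix.smul_apply,
      smul_eq_mul, mpd, conn, Matrix.of_apply, Finset.sum_mul]
    congr 1
    rw [Finset.sum_comm]
    exact Finset.sum_congr rfl fun c _ => Finset.sum_congr rfl fun a _ => by ring
  simp only [h3, Complex.ofReal_add, Complex.ofReal_sum, Complex.ofReal_mul, add_mul,
    Finset.sum_add_distrib, smul_sub, Finset.sum_sub_distrib, Finset.mul_sum, Finset.sum_mul,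
    Complex.real_smul]
  have h4 : ∑ b, ∑ a, (jacobian φ x b j : ℂ) * ((jacobian φ x a i : ℂ) * pd a (pd b ψ) (φ x))
      = ∑ a, ∑ b, (jacobian φ x a i : ℂ) * (jacobian φ x b j : ℂ) * pd a (pd b ψ) (φ x) := by
    rw [Finset.sum_comm]
    exact Finset.sum_congr rfl fun a _ => Finset.sum_congr rfl fun b _ => by ring
  have h5 : ∑ b, ∑ c, ∑ a, (jacobian φ x a i : ℂ) * (jacobian φ x c j : ℂ)
        * (christoffel G' b a c (φ x) : ℂ) * pd b ψ (φ x)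
      = ∑ a, ∑ c, ∑ b, (jacobian φ x a i : ℂ) * (jacobian φ x c j : ℂ)
        * ((christoffel G' b a c (φ x) : ℂ) * pd b ψ (φ x)) := by
    rw [Finset.sum_comm, Finset.sum_comm' (t' := Finset.univ) (s' := fun _ => Finset.univ) (by simp)]
    rw [Finset.sum_comm]
    have : ∀ c, ∑ b, ∑ a, (jacobian φ x a i : ℂ) * (jacobian φ x c j : ℂ)
        * (christoffel G' b a c (φ x) : ℂ) * pd b ψ (φ x)
        = ∑ a, ∑ b, (jacobian φ x a i : ℂ) * (jacobian φ x c j : ℂ)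
        * ((christoffel G' b a c (φ x) : ℂ) * pd b ψ (φ x)) := by
      intro c
      rw [Finset.sum_comm]
      exact Finset.sum_congr rfl fun a _ => Finset.sum_congr rfl fun b _ => by ring
    simp only [this]
    exact Finset.sum_comm
  rw [h4, h5]
  ring

/-- The Laplace operator commutes with changes of coordinates. -/
theorem laplace_eq (h : IsIsometry φ G G' U U') (lam mu : ℂ) {f f' : E n → ℂ}
    (hf' : ContDiffOn ℝ ∞ f' U')
    (hff' : ∀ x ∈ U, f x = absPow (jacobian φ x).det lam * f' (φ x)) {x : E n} (hx : x ∈ U) :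
    laplace G lam mu f x = absPow (jacobian φ x).det mu * laplace G' lam mu f' (φ x) := by
  have hU := h.source.isOpen
  set ψ : E n → ℂ := fun y => volPow G' (-lam) y * f' y with hψ
  have hψs : ContDiffOn ℝ ∞ ψ U' := (h.target.smooth_volPow _).mul hf'
  -- Dividing a density by |vol|^lam gives a scalar function: the powers of the Jacobian determinant
  -- have opposite exponents.
  have e1 : ∀ y ∈ U, volPow G (-lam) y * f y = ψ (φ y) := by
    intro y hy
    have h0 : absPow (jacobian φ y).det (-lam) * absPow (jacobian φ y).det lam = 1 := by
      rw [absPow_eq_exp (h.det_jacobian_ne hy), absPow_eq_exp (h.det_jacobian_ne hy),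
        ← Complex.exp_add]
      simp
    rw [h.volPow_eq _ hy, hff' y hy, hψ]
    linear_combination volPow G' (-lam) (φ y) * f' (φ y) * h0
  have e2 : ∀ i, ∀ y ∈ U, pd i (fun y => volPow G (-lam) y * f y) y
      = pd i (fun y => ψ (φ y)) y := fun i y hy => pd_congr hU e1 hy i
  unfold laplace
  rw [h.volPow_eq _ hx, mul_assoc]
  congr 2
  have := h.contract_eq hx fun i j => h.hess_eq hψs hx i j
  simp only [Complex.real_smul] at this
  rw [← this]
  refine Finset.sum_congr rfl fun i _ => Finset.sum_congr rfl fun j _ => ?_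
  rw [pd_congr hU (e2 j) hx]
  simp only [e2 _ x hx]

theorem curvatureOp_eq (h : IsIsometry φ G G' U U') (lam mu : ℂ) {f f' : E n → ℂ}
    (hff' : ∀ x ∈ U, f x = absPow (jacobian φ x).det lam * f' (φ x)) {x : E n} (hx : x ∈ U) :
    curvatureOp G lam mu f x = absPow (jacobian φ x).det mu * curvatureOp G' lam mu f' (φ x) := by
  have h0 : absPow (jacobian φ x).det (mu - lam) * absPow (jacobian φ x).det lam
      = absPow (jacobian φ x).det mu := by
    rw [absPow_eq_exp (h.det_jacobian_ne hx), absPow_eq_exp (h.det_jacobian_ne hx),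
      absPow_eq_exp (h.det_jacobian_ne hx), ← Complex.exp_add]
    congr 1; ring
  unfold curvatureOp
  rw [h.volPow_eq _ hx, hff' x hx, h.scalarCurvature_eq hx, ← h0]
  ring

end IsIsometry

end Invariance

/-! ### Invariance of Δ + c R under changes of charts. -/

section Manifold

variable {n : ℕ} {M : Type*} [TopologicalSpace M] [ChartedSpace (E n) M]

theorem isOpen_overlap (e e' : Chart n M) : IsOpen (overlap e e') :=
  (e.1.symm.trans e'.1).open_source

theorem contDiffOn_transition [IsManifold (𝓡 n) ∞ M] (e e' : Chart n M) :
    ContDiffOn ℝ ∞ (transition e e') (overlap e e') := by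
  have h1 := contMDiffOn_symm_of_mem_maximalAtlas e.2
  have h2 := contMDiffOn_of_mem_maximalAtlas e'.2
  have := h2.comp' h1
  refine (contMDiffOn_iff_contDiffOn.1 this).mono fun x hx => ?_
  exact ⟨hx.1, hx.2⟩

theorem PseudoRiemannianMetric.isIsometry [IsManifold (𝓡 n) ∞ M]
    (g : PseudoRiemannianMetric n M) (e e' : Chart n M) :
    IsIsometry (transition e e') (g.coeff e) (g.coeff e') (overlap e e') e'.1.target :=
  ⟨(g.isMetricOn e).mono (isOpen_overlap e e') fun _ hx => hx.1, g.isMetricOn e',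
    contDiffOn_transition e e', fun _ hx => e'.1.map_source hx.2, fun x hx => g.transform e e' x hx⟩

/-- Equivariance is only available in adapted charts; this law carries the resulting identity to an
arbitrary chart. -/
theorem laplacePlusCurvature_transform [IsManifold (𝓡 n) ∞ M] (g : PseudoRiemannianMetric n M)
    (lam mu c : ℂ) (φ : Density n M lam) (e e' : Chart n M) {x : E n} (hx : x ∈ overlap e e') :
    laplacePlusCurvature g lam mu c φ e x = absPow (jac e e' x).det mu *
      laplacePlusCurvature g lam mu c φ e' (transition e e' x) := by
  have h := g.isIsometry e e'
  unfold laplacePlusCurvature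
  rw [h.laplace_eq lam mu (φ.2.2.1 e') (fun x hx => φ.2.2.2 e e' x hx) hx,
    h.curvatureOp_eq lam mu (fun x hx => φ.2.2.2 e e' x hx) hx]
  change absPow (jac e e' x).det mu * _ + c * (absPow (jac e e' x).det mu * _) = _
  ring

end Manifold

/-! ### Conformally flat metrics -/

section ConformallyFlat

variable {n : ℕ}

/-- `G = exp κ · diag(η)` on the open set `U`, where the `η i` are signs. -/
structure IsConformalOn (G : E n → Matrix (Fin n) (Fin n) ℝ) (η : Fin n → ℝ) (κ : E n → ℝ)
    (U : Set (E n)) : Prop where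
  isOpen : IsOpen U
  sign : ∀ i, η i * η i = 1
  smooth : ContDiffOn ℝ ∞ κ U
  eq : ∀ x ∈ U, G x = Real.exp (κ x) • Matrix.diagonal η

variable {G : E n → Matrix (Fin n) (Fin n) ℝ} {η : Fin n → ℝ} {κ : E n → ℝ} {U : Set (E n)}

theorem pd_pd_mul {f g : E n → ℂ} (hU : IsOpen U) (hf : ContDiffOn ℝ ∞ f U)
    (hg : ContDiffOn ℝ ∞ g U) {x : E n} (hx : x ∈ U) (i : Fin n) :
    pd i (pd i fun y => f y * g y) x
      = pd i (pd i f) x * g x + 2 * pd i f x * pd i g x + f x * pd i (pd i g) x := by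
  have hf' := contDiffOn_pd hU hf i
  have hg' := contDiffOn_pd hU hg i
  have h1 : ∀ y ∈ U, pd i (fun y => f y * g y) y = pd i f y * g y + f y * pd i g y :=
    fun y hy => pd_mul (diffAt hU hf hy) (diffAt hU hg hy) i
  rw [pd_congr hU h1 hx, pd_add ((diffAt hU hf' hx).fun_mul (diffAt hU hg hx))
    ((diffAt hU hf hx).fun_mul (diffAt hU hg' hx)), pd_mul (diffAt hU hf' hx) (diffAt hU hg hx),
    pd_mul (diffAt hU hf hx) (diffAt hU hg' hx)]
  ring

theorem contDiffOn_exp_mul (hκ : ContDiffOn ℝ ∞ κ U) (a : ℂ) :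
    ContDiffOn ℝ ∞ (fun y => Complex.exp (a * (κ y : ℂ))) U :=
  (contDiffOn_const.mul (Complex.ofRealCLM.contDiff.comp_contDiffOn hκ)).cexp

theorem pd_exp_mul (hU : IsOpen U) (hκ : ContDiffOn ℝ ∞ κ U) (a : ℂ) {x : E n} (hx : x ∈ U)
    (i : Fin n) : pd i (fun y => Complex.exp (a * (κ y : ℂ))) x
      = Complex.exp (a * (κ x : ℂ)) * (a * ((pd i κ x : ℝ) : ℂ)) := by
  have hd : DifferentiableAt ℝ (fun y => (κ y : ℂ)) x :=
    diffAt hU (Complex.ofRealCLM.contDiff.comp_contDiffOn hκ) hx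
  rw [pd_cexp (hd.const_mul a), pd_const_mul hd, pd_ofReal (diffAt hU hκ hx)]

theorem pd_pd_exp_mul (hU : IsOpen U) (hκ : ContDiffOn ℝ ∞ κ U) (a : ℂ) {x : E n} (hx : x ∈ U)
    (i : Fin n) : pd i (pd i fun y => Complex.exp (a * (κ y : ℂ))) x
      = Complex.exp (a * (κ x : ℂ)) * (a ^ 2 * ((pd i κ x : ℝ) : ℂ) ^ 2 + a * ((pd i (pd i κ) x : ℝ) : ℂ)) := by
  have h1 := contDiffOn_exp_mul hκ a
  have h2 := contDiffOn_pd hU hκ i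
  have hd : DifferentiableAt ℝ (fun y => ((pd i κ y : ℝ) : ℂ)) x :=
    diffAt hU (Complex.ofRealCLM.contDiff.comp_contDiffOn h2) hx
  rw [pd_congr hU (fun y hy => pd_exp_mul hU hκ a hy i) hx,
    pd_mul (diffAt hU h1 hx) (hd.const_mul a), pd_exp_mul hU hκ a hx, pd_const_mul hd,
    pd_ofReal (diffAt hU h2 hx)]
  ring

/-- The flat Laplacian `ηⁱⁱ ∂_i ∂_i f`. -/
def flatLaplace (η : Fin n → ℝ) (f : E n → ℂ) (x : E n) : ℂ :=
  ∑ i, (η i : ℂ) * pd i (pd i f) x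

/-- The flat inner product `ηⁱⁱ ∂_i f ∂_i g` of two gradients. -/
def flatGrad (η : Fin n → ℝ) (f g : E n → ℂ) (x : E n) : ℂ :=
  ∑ i, (η i : ℂ) * (pd i f x * pd i g x)

theorem flatLaplace_mul {f g : E n → ℂ} (hU : IsOpen U) (hf : ContDiffOn ℝ ∞ f U)
    (hg : ContDiffOn ℝ ∞ g U) {x : E n} (hx : x ∈ U) :
    flatLaplace η (fun y => f y * g y) x
      = flatLaplace η f x * g x + 2 * flatGrad η f g x + f x * flatLaplace η g x := by
  simp only [flatLaplace, flatGrad, pd_pd_mul hU hf hg hx, Finset.sum_mul, Finset.mul_sum,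
    ← Finset.sum_add_distrib]
  exact Finset.sum_congr rfl fun i _ => by ring

namespace IsConformalOn

theorem inv_eq (h : IsConformalOn G η κ U) {x : E n} (hx : x ∈ U) :
    (G x)⁻¹ = Real.exp (-κ x) • Matrix.diagonal η := by
  refine Matrix.inv_eq_right_inv ?_
  rw [h.eq x hx, Matrix.smul_mul, Matrix.mul_smul, smul_smul, ← Real.exp_add,
    Matrix.diagonal_mul_diagonal]
  simp [h.sign]

theorem det_ne (h : IsConformalOn G η κ U) {x : E n} (hx : x ∈ U) : (G x).det ≠ 0 := by
  rw [h.eq x hx, Matrix.det_smul, Matrix.det_diagonal]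
  refine mul_ne_zero (pow_ne_zero _ (Real.exp_ne_zero _)) (Finset.prod_ne_zero_iff.2 fun i _ => ?_)
  intro h0
  have := h.sign i
  simp [h0] at this

theorem volPow_eq (h : IsConformalOn G η κ U) (w : ℂ) {x : E n} (hx : x ∈ U) :
    volPow G w x = Complex.exp (n * w / 2 * (κ x : ℂ)) := by
  have habs : ∀ i, |η i| = 1 := fun i => by
    have := h.sign i
    rw [← abs_mul_abs_self] at this
    nlinarith [abs_nonneg (η i)]
  rw [volPow, absPow_eq_exp (h.det_ne hx), h.eq x hx, Matrix.det_smul, Matrix.det_diagonal,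
    ← Real.log_abs, abs_mul, Finset.abs_prod]
  simp only [habs, Finset.prod_const_one, mul_one, Fintype.card_fin, ← Real.exp_nat_mul,
    Real.abs_exp, Real.log_exp]
  congr 1
  push_cast
  ring

theorem christoffel_eq (h : IsConformalOn G η κ U) {x : E n} (hx : x ∈ U) (k i j : Fin n) :
    christoffel G k i j x = (1 / 2) * ((if k = j then pd i κ x else 0)
      + (if k = i then pd j κ x else 0) - (if i = j then η i * η k * pd k κ x else 0)) := by
  have hd : DifferentiableAt ℝ (fun y => Real.exp (κ y)) x :=
    diffAt h.isOpen h.smooth.exp hx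
  have hG : ∀ a b c, pd a (fun y => G y b c) x
      = Real.exp (κ x) * (if b = c then η b * pd a κ x else 0) := by
    intro a b c
    have h1 : ∀ y ∈ U, G y b c = (if b = c then η b else 0) * Real.exp (κ y) := by
      intro y hy
      rw [h.eq y hy]
      simp [Matrix.diagonal_apply, mul_comm]
    rw [pd_congr h.isOpen h1 hx, pd_const_mul hd]
    have h2 : pd a (fun y => Real.exp (κ y)) x = Real.exp (κ x) * pd a κ x := by
      unfold pd
      rw [(diffAt h.isOpen h.smooth hx).hasFDerivAt.exp.fderiv]; simp
    rw [h2]; split_ifs <;> ring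
  unfold christoffel
  rw [Finset.sum_eq_single k]
  · have hinv : (G x)⁻¹ k k = Real.exp (-κ x) * η k := by
      rw [h.inv_eq hx]; simp
    have he : Real.exp (-κ x) * Real.exp (κ x) = 1 := by rw [← Real.exp_add]; simp
    have hk := h.sign k
    have e1 : ∀ a c, (if a = k then η a * pd c κ x else 0)
        = η k * if k = a then pd c κ x else 0 := by
      intro a c
      by_cases hak : a = k
      · subst hak; simp
      · simp [hak, Ne.symm hak]
    have e2 : (if i = j then η i * pd k κ x else 0)
        = η k * if i = j then η i * η k * pd k κ x else 0 := by
      split_ifs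
      · linear_combination (-(η i) * pd k κ x) * hk
      · ring
    rw [hinv, hG, hG, hG, e1, e1, e2]
    congr 1
    linear_combination ((if k = j then pd i κ x else 0) + (if k = i then pd j κ x else 0)
      - (if i = j then η i * η k * pd k κ x else 0)) * (η k * η k * he + hk)
  · intro l _ hl
    rw [h.inv_eq hx]
    simp [Ne.symm hl]
  · simp

/-- The metric is diagonal, so traces only involve Γᵏᵢᵢ. The values v lie in a general real module
because the lemma serves real functions in the Ricci tensor and complex ones in the Laplacian. -/
theorem sum_christoffel_diag {V : Type*} [AddCommGroup V] [Module ℝ V]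
    (h : IsConformalOn G η κ U) {x : E n} (hx : x ∈ U) (i : Fin n) (v : Fin n → V) :
    ∑ k, christoffel G k i i x • v k
      = pd i κ x • v i - (1 / 2 * η i) • ∑ k, (η k * pd k κ x) • v k := by
  have : ∀ k, christoffel G k i i x • v k = (if k = i then pd i κ x • v k else 0)
      - (1 / 2 * η i) • (η k * pd k κ x) • v k := by
    intro k
    rw [h.christoffel_eq hx]
    by_cases hk : k = i
    · simp only [hk, if_true, ← sub_smul, smul_smul]
      congr 1; ring
    · simp only [hk, if_false, if_true, smul_smul, zero_sub, ← neg_smul]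
      congr 1; ring
  simp only [this, Finset.sum_sub_distrib, ← Finset.smul_sum]
  simp

theorem pd_christoffel_eq (h : IsConformalOn G η κ U) {x : E n} (hx : x ∈ U) (a k i j : Fin n) :
    pd a (christoffel G k i j) x = (1 / 2) * ((if k = j then pd a (pd i κ) x else 0)
      + (if k = i then pd a (pd j κ) x else 0)
      - (if i = j then η i * η k * pd a (pd k κ) x else 0)) := by
  have hd : ∀ b, DifferentiableAt ℝ (pd b κ) x :=
    fun b => diffAt h.isOpen (contDiffOn_pd h.isOpen h.smooth b) hx
  have hite : ∀ (p : Prop) [Decidable p] (c : ℝ) (b : Fin n),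
      DifferentiableAt ℝ (fun y => if p then c * pd b κ y else 0) x ∧
      pd a (fun y => if p then c * pd b κ y else 0) x
        = if p then c * pd a (pd b κ) x else 0 := by
    intro p _ c b
    by_cases hp : p
    · simp only [hp, if_true]
      exact ⟨(hd b).const_mul c, pd_const_mul (hd b) c a⟩
    · simp only [hp, if_false]
      exact ⟨differentiableAt_const _, pd_const a _ x⟩
  have h1 : ∀ y ∈ U, christoffel G k i j y = (1 / 2) * ((if k = j then 1 * pd i κ y else 0)
      + (if k = i then 1 * pd j κ y else 0) - (if i = j then (η i * η k) * pd k κ y else 0)) := by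
    intro y hy
    rw [h.christoffel_eq hy]; simp only [one_mul]
  rw [pd_congr h.isOpen h1 hx, pd_const_mul (((hite _ _ _).1.fun_add (hite _ _ _).1).fun_sub
    (hite _ _ _).1), pd_sub ((hite _ _ _).1.fun_add (hite _ _ _).1) (hite _ _ _).1,
    pd_add (hite _ _ _).1 (hite _ _ _).1, (hite _ _ _).2, (hite _ _ _).2, (hite _ _ _).2]
  simp only [one_mul]

theorem ricci_diag (h : IsConformalOn G η κ U) {x : E n} (hx : x ∈ U) (i : Fin n) :
    ricci G i i x = (2 - n) / 2 * pd i (pd i κ) x - 1 / 2 * η i * ∑ k, η k * pd k (pd k κ) x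
      + (n - 2) / 4 * (pd i κ x ^ 2 - η i * ∑ k, η k * pd k κ x ^ 2) := by
  have hi := h.sign i
  have t1 : ∑ k, pd k (christoffel G k i i) x
      = pd i (pd i κ) x - 1 / 2 * η i * ∑ k, η k * pd k (pd k κ) x := by
    simp only [h.pd_christoffel_eq hx, if_true, mul_sub, mul_add, Finset.sum_sub_distrib,
      Finset.sum_add_distrib, mul_ite, mul_zero, Finset.sum_ite_eq', Finset.mem_univ,
      Finset.mul_sum]
    rw [Finset.sum_congr rfl fun k _ => show 1 / 2 * (η i * η k * pd k (pd k κ) x)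
      = 1 / 2 * η i * (η k * pd k (pd k κ) x) by ring]
    ring
  have t2 : ∑ k, pd i (christoffel G k i k) x = n / 2 * pd i (pd i κ) x := by
    have : ∀ k, pd i (christoffel G k i k) x = 1 / 2 * pd i (pd i κ) x := by
      intro k
      rw [h.pd_christoffel_eq hx]
      by_cases hk : k = i
      · subst hk; simp [h.sign]
      · simp [hk, Ne.symm hk]
    simp only [this, Finset.sum_const, Finset.card_univ, Fintype.card_fin, nsmul_eq_mul]
    ring
  have tr : ∀ l, ∑ k, christoffel G k k l x = n / 2 * pd l κ x := by
    intro l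
    have : ∀ k, christoffel G k k l x = 1 / 2 * pd l κ x := by
      intro k
      rw [h.christoffel_eq hx]
      by_cases hk : k = l
      · subst hk; simp [h.sign]
      · simp [hk]
    simp only [this, Finset.sum_const, Finset.card_univ, Fintype.card_fin, nsmul_eq_mul]
    ring
  have t3 : ∑ k, ∑ l, christoffel G k k l x * christoffel G l i i x
      = n / 2 * (pd i κ x ^ 2 - 1 / 2 * η i * ∑ k, η k * pd k κ x ^ 2) := by
    rw [Finset.sum_comm]
    simp only [← Finset.sum_mul, tr]
    have := h.sum_christoffel_diag hx i (fun l => n / 2 * pd l κ x)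
    simp only [smul_eq_mul] at this
    rw [Finset.sum_congr rfl fun l _ => mul_comm _ _, this]
    have e : ∑ k, η k * pd k κ x * (n / 2 * pd k κ x) = n / 2 * ∑ k, η k * pd k κ x ^ 2 := by
      rw [Finset.mul_sum]; exact Finset.sum_congr rfl fun k _ => by ring
    rw [e]; ring
  have t4 : ∑ k, ∑ l, christoffel G k i l x * christoffel G l i k x
      = (n + 2) / 4 * pd i κ x ^ 2 - 1 / 2 * η i * ∑ k, η k * pd k κ x ^ 2 := by
    -- Away from k = i and l = i only k = l contributes; with exactly one of k, l equal to i, the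
    -- product is a term −¼ηᵢηₗ(∂ₗκ)² or its mirror image. At k = l = i the coefficients 4 and −2
    -- add up to 2 and compensate the two subtractions, leaving ¼(∂ᵢκ)².
    have hkl : ∀ k l, christoffel G k i l x * christoffel G l i k x
        = 1 / 4 * ((if k = l then pd i κ x ^ 2 else 0)
          + (if k = i then (if l = i then 4 * pd i κ x ^ 2 else 0) else 0)
          - (if k = i then η i * (η l * pd l κ x ^ 2) else 0)
          - (if l = i then η i * (η k * pd k κ x ^ 2) else 0)
          - (if k = i then (if l = i then 2 * pd i κ x ^ 2 else 0) else 0)) := by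
      intro k l
      rw [h.christoffel_eq hx, h.christoffel_eq hx]
      by_cases hk : k = i
      · subst hk
        by_cases hl : l = k
        · subst hl
          simp only [if_true]
          linear_combination (1 / 4) * pd l κ x ^ 2 * (η l * η l - 1) * hi
        · simp only [hl, Ne.symm hl, if_true, if_false]
          ring
      · by_cases hl : l = i
        · subst hl
          simp only [hk, Ne.symm hk, if_true, if_false]
          ring
        · by_cases hkl : k = l
          · subst hkl
            simp only [hk, Ne.symm hk, if_true, if_false]
            ring
          · simp only [hk, Ne.symm hk, hl, Ne.symm hl, hkl, Ne.symm hkl, if_false]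
            ring
    simp only [hkl, ← Finset.mul_sum, Finset.sum_add_distrib, Finset.sum_sub_distrib,
      Finset.sum_ite_eq, Finset.sum_ite_eq', Finset.mem_univ, if_true, Finset.sum_ite_irrel,
      Finset.sum_const_zero, Finset.sum_const, Finset.card_univ, Fintype.card_fin, nsmul_eq_mul]
    ring
  unfold ricci
  simp only [Finset.sum_add_distrib, Finset.sum_sub_distrib, t1, t2, t3, t4]
  ring

theorem scalarCurvature_eq (h : IsConformalOn G η κ U) {x : E n} (hx : x ∈ U) :
    scalarCurvature G x = -Real.exp (-κ x) * (n - 1) * (∑ i, η i * pd i (pd i κ) x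
      + (n - 2) / 4 * ∑ i, η i * pd i κ x ^ 2) := by
  have h1 : scalarCurvature G x = Real.exp (-κ x) * ∑ i, η i * ricci G i i x := by
    rw [scalarCurvature, h.inv_eq hx, Finset.mul_sum]
    refine Finset.sum_congr rfl fun i _ => ?_
    simp [Matrix.diagonal_apply]
    ring
  have h2 : ∀ i, η i * ricci G i i x = (2 - n) / 2 * (η i * pd i (pd i κ) x)
      - 1 / 2 * (∑ k, η k * pd k (pd k κ) x)
      + ((n - 2) / 4 * (η i * pd i κ x ^ 2) - (n - 2) / 4 * ∑ k, η k * pd k κ x ^ 2) := by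
    intro i
    rw [h.ricci_diag hx]
    linear_combination (-(1 / 2) * (∑ k, η k * pd k (pd k κ) x)
      - (n - 2) / 4 * ∑ k, η k * pd k κ x ^ 2) * h.sign i
  rw [h1]
  simp only [h2, Finset.sum_add_distrib, Finset.sum_sub_distrib, ← Finset.mul_sum,
    Finset.sum_const, Finset.card_univ, Fintype.card_fin, nsmul_eq_mul]
  ring

/-- On functions, Δ = e^{−κ}(□ + ((n−2)/2)⟨∇κ, ∇·⟩). It is applied to ψ = e^{aκ}φ with a = −nλ/2,
the function that corresponds to the density φ, and the product rule does the rest. -/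
theorem laplace_eq (h : IsConformalOn G η κ U) (lam mu : ℂ) {φ : E n → ℂ}
    (hφ : ContDiffOn ℝ ∞ φ U) {x : E n} (hx : x ∈ U) :
    laplace G lam mu φ x = Complex.exp ((n * (mu - lam) / 2 - 1) * (κ x : ℂ)) *
      (flatLaplace η φ x
        + (n - 2 - 2 * n * lam) / 2 * ∑ i, (η i : ℂ) * (((pd i κ x : ℝ) : ℂ) * pd i φ x)
        - (n * lam / 2 * (∑ i, (η i : ℂ) * ((pd i (pd i κ) x : ℝ) : ℂ))
          + n * lam * (n - 2 - n * lam) / 4 * ∑ i, (η i : ℂ) * ((pd i κ x : ℝ) : ℂ) ^ 2) * φ x) := by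
  have hU := h.isOpen
  set a : ℂ := -(n * lam / 2) with ha
  set u : E n → ℂ := fun y => Complex.exp (a * (κ y : ℂ)) with hu
  have hus : ContDiffOn ℝ ∞ u U := contDiffOn_exp_mul h.smooth a
  set ψ : E n → ℂ := fun y => u y * φ y with hψ
  have hψe : ∀ y ∈ U, volPow G (-lam) y * φ y = ψ y := by
    intro y hy
    rw [h.volPow_eq _ hy, hψ]
    congr 2; ring
  have e2 : ∀ i, ∀ y ∈ U, pd i (fun y => volPow G (-lam) y * φ y) y = pd i ψ y :=
    fun i y hy => pd_congr hU hψe hy i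
  have hpψ : ∀ i, pd i ψ x = u x * (a * ((pd i κ x : ℝ) : ℂ)) * φ x + u x * pd i φ x := by
    intro i
    rw [hψ, pd_mul (diffAt hU hus hx) (diffAt hU hφ hx), hu, pd_exp_mul hU h.smooth a hx]
  have h1 : laplace G lam mu φ x = Complex.exp (n * mu / 2 * (κ x : ℂ)) *
      (Complex.exp (-(κ x : ℂ)) * (flatLaplace η ψ x
        - ∑ i, (η i : ℂ) * ∑ k, christoffel G k i i x • pd k ψ x)) := by
    rw [laplace, h.volPow_eq _ hx, h.inv_eq hx, flatLaplace, ← Finset.sum_sub_distrib,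
      Finset.mul_sum (Finset.univ) _ (Complex.exp (-(κ x : ℂ)))]
    congr 1
    refine Finset.sum_congr rfl fun i _ => ?_
    rw [Finset.sum_eq_single i]
    · rw [pd_congr hU (e2 i) hx]
      simp only [e2 _ x hx, Complex.real_smul]
      simp
      ring
    · intro j _ hj
      simp [Ne.symm hj]
    · simp
  have h2 : ∑ i, (η i : ℂ) * ∑ k, christoffel G k i i x • pd k ψ x
      = (2 - n) / 2 * ∑ i, (η i : ℂ) * (((pd i κ x : ℝ) : ℂ) * pd i ψ x) := by
    have hS : ∑ k, (η k * pd k κ x) • pd k ψ x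
        = ∑ i, (η i : ℂ) * (((pd i κ x : ℝ) : ℂ) * pd i ψ x) := by
      refine Finset.sum_congr rfl fun k _ => ?_
      rw [Complex.real_smul]; push_cast; ring
    have : ∀ i, (η i : ℂ) * ∑ k, christoffel G k i i x • pd k ψ x
        = (η i : ℂ) * (((pd i κ x : ℝ) : ℂ) * pd i ψ x)
          - 1 / 2 * ∑ k, (η k : ℂ) * (((pd k κ x : ℝ) : ℂ) * pd k ψ x) := by
      intro i
      have hs : (η i : ℂ) * η i = 1 := by exact_mod_cast h.sign i
      rw [h.sum_christoffel_diag hx, hS, Complex.real_smul, Complex.real_smul]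
      push_cast
      linear_combination (-(1 / 2) * ∑ k, (η k : ℂ) * (((pd k κ x : ℝ) : ℂ) * pd k ψ x)) * hs
    simp only [this, Finset.sum_sub_distrib, Finset.sum_const, Finset.card_univ, Fintype.card_fin,
      nsmul_eq_mul]
    ring
  have h3 : ∑ i, (η i : ℂ) * (((pd i κ x : ℝ) : ℂ) * pd i ψ x)
      = u x * (a * (∑ i, (η i : ℂ) * ((pd i κ x : ℝ) : ℂ) ^ 2) * φ x
        + ∑ i, (η i : ℂ) * (((pd i κ x : ℝ) : ℂ) * pd i φ x)) := by
    simp only [hpψ, Finset.mul_sum, Finset.sum_mul, ← Finset.sum_add_distrib]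
    exact Finset.sum_congr rfl fun i _ => by ring
  have h4 : flatLaplace η ψ x = u x * (flatLaplace η φ x
      + 2 * a * (∑ i, (η i : ℂ) * (((pd i κ x : ℝ) : ℂ) * pd i φ x))
      + (a ^ 2 * (∑ i, (η i : ℂ) * ((pd i κ x : ℝ) : ℂ) ^ 2)
        + a * ∑ i, (η i : ℂ) * ((pd i (pd i κ) x : ℝ) : ℂ)) * φ x) := by
    rw [hψ, flatLaplace_mul hU hus hφ hx]
    simp only [flatLaplace, flatGrad, hu, pd_pd_exp_mul hU h.smooth a hx,
      pd_exp_mul hU h.smooth a hx, Finset.sum_mul, Finset.mul_sum, mul_add,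
      ← Finset.sum_add_distrib]
    exact Finset.sum_congr rfl fun i _ => by ring
  have h5 : Complex.exp ((n * (mu - lam) / 2 - 1) * (κ x : ℂ))
      = Complex.exp (n * mu / 2 * (κ x : ℂ)) * Complex.exp (-(κ x : ℂ)) * u x := by
    rw [hu, ← Complex.exp_add, ← Complex.exp_add]
    congr 1
    rw [ha]; ring
  rw [h1, h2, h3, h4, h5, ha]
  ring

/-- The conformal Laplacian in terms of the flat bidifferential operators. -/
theorem laplace_add_curvatureOp (h : IsConformalOn G η κ U) {lam mu : ℂ} (hn : (n : ℂ) - 1 ≠ 0)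
    (h1 : (n : ℂ) * (mu - lam) - 2 ≠ 0) (h2 : (n : ℂ) + 2 - 2 * n * (mu - lam) ≠ 0)
    {φ : E n → ℂ} (hφ : ContDiffOn ℝ ∞ φ U) {x : E n} (hx : x ∈ U) (f : E n → ℂ)
    (hf : ∀ y ∈ U, f y = Complex.exp ((n * (mu - lam) / 2 - 1) * (κ y : ℂ))) :
    laplace G lam mu φ x + curvatureCoupling n lam mu * curvatureOp G lam mu φ x
      = f x * flatLaplace η φ x
        + (n - 2 - 2 * n * lam) / (n * (mu - lam) - 2) * flatGrad η f φ x
        + n * lam * (n - 2 - 2 * n * lam) /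
          ((n * (mu - lam) - 2) * (n + 2 - 2 * n * (mu - lam))) * flatLaplace η f x * φ x := by
  have hU := h.isOpen
  set b : ℂ := n * (mu - lam) / 2 - 1 with hb
  have hb0 : (n : ℂ) * (mu - lam) - 2 = 2 * b := by rw [hb]; ring
  set S1 : ℂ := ∑ i, (η i : ℂ) * (((pd i κ x : ℝ) : ℂ) * pd i φ x) with hS1
  set S2 : ℂ := ∑ i, (η i : ℂ) * ((pd i (pd i κ) x : ℝ) : ℂ) with hS2
  set S3 : ℂ := ∑ i, (η i : ℂ) * ((pd i κ x : ℝ) : ℂ) ^ 2 with hS3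
  have g1 : flatGrad η f φ x = f x * (b * S1) := by
    rw [hf x hx, flatGrad]
    simp only [pd_congr hU hf hx, pd_exp_mul hU h.smooth b hx, hS1, Finset.mul_sum]
    exact Finset.sum_congr rfl fun i _ => by ring
  have g2 : flatLaplace η f x = f x * (b ^ 2 * S3 + b * S2) := by
    rw [hf x hx, flatLaplace]
    simp only [pd_congr hU (fun y hy => pd_congr hU hf hy _) hx, pd_pd_exp_mul hU h.smooth b hx,
      hS2, hS3, Finset.mul_sum, ← Finset.sum_add_distrib]
    exact Finset.sum_congr rfl fun i _ => by ring
  have g3 : curvatureOp G lam mu φ x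
      = -f x * (n - 1) * (S2 + (n - 2) / 4 * S3) * φ x := by
    rw [curvatureOp, h.volPow_eq _ hx, h.scalarCurvature_eq hx, hf x hx]
    have : Complex.exp (b * (κ x : ℂ))
        = Complex.exp (n * (mu - lam) / 2 * (κ x : ℂ)) * Complex.exp (-(κ x : ℂ)) := by
      rw [← Complex.exp_add]; congr 1; rw [hb]; ring
    rw [this, hS2, hS3]
    push_cast
    ring
  -- Since f = e^{bκ}, one has ∇f = b f∇κ and □f = b f(S2 + b S3). The zeroth-order part of Δ + C R
  -- is a combination of S2 and S3; it is proportional to S2 + b S3, hence to □f, precisely when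
  -- (n−1)(n−2−4b)C = nλ(nλ+2b+2−n). As nμ = nλ+2b+2 and n−2−4b = n+2−2nδ, this is the defining
  -- value of the coupling.
  rw [h.laplace_eq lam mu hφ hx, ← hb, ← hf x hx, g1, g2, g3, curvatureCoupling, hb0]
  rw [hb0] at h1
  have hb1 : b ≠ 0 := fun h0 => h1 (by rw [h0, mul_zero])
  rw [← hS1, ← hS2, ← hS3]
  have hmu : (n : ℂ) * mu = n * lam + 2 * b + 2 := by rw [hb]; ring
  have hD : (n : ℂ) + 2 - 2 * n * (mu - lam) = n - 2 - 4 * b := by rw [hb]; ring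
  rw [hD] at h2 ⊢
  have hC : (n : ℂ) ^ 2 * lam * (mu - 1) = n * lam * (n * lam + 2 * b + 2 - n) := by
    linear_combination (n : ℂ) * lam * hmu
  rw [hC]
  field_simp
  ring

end IsConformalOn

end ConformallyFlat

/-! ### Smoothness of parametric integrals and Hadamard's lemma -/

section Parametric

/-- Differentiation under the integral sign; the dominating constant is the bound of the continuous
partial derivative on the compact set closed ball × [0,1]. -/
theorem hasFDerivAt_parametric_integral {H F : Type} [NormedAddCommGroup H] [NormedSpace ℝ H]
    [ProperSpace H] [NormedAddCommGroup F] [NormedSpace ℝ F] [CompleteSpace F]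
    {K : H × ℝ → F} (hK : ContDiff ℝ ∞ K) (x : H) :
    HasFDerivAt (fun x => ∫ t in (0 : ℝ)..1, K (x, t))
      (∫ t in (0 : ℝ)..1, (fderiv ℝ K (x, t)).comp (ContinuousLinearMap.inl ℝ H ℝ)) x := by
  have hd : Continuous fun z : H × ℝ =>
      (fderiv ℝ K z).comp (ContinuousLinearMap.inl ℝ H ℝ) :=
    (hK.continuous_fderiv (by simp)).clm_comp continuous_const
  obtain ⟨C, hC⟩ := (((isCompact_closedBall x 1).prod
    (isCompact_Icc (a := (0 : ℝ)) (b := 1))).image hd).isBounded.exists_norm_le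
  refine intervalIntegral.hasFDerivAt_integral_of_dominated_of_fderiv_le
    (F' := fun x t => (fderiv ℝ K (x, t)).comp (ContinuousLinearMap.inl ℝ H ℝ))
    (bound := fun _ => C) (Metric.ball_mem_nhds x one_pos) ?_ ?_ ?_ ?_ ?_ ?_
  · exact Filter.Eventually.of_forall fun y =>
      (hK.continuous.comp (by fun_prop)).aestronglyMeasurable
  · exact (hK.continuous.comp (by fun_prop)).intervalIntegrable _ _
  · exact (hd.comp (by fun_prop : Continuous fun t : ℝ => (x, t))).aestronglyMeasurable
  · refine Filter.Eventually.of_forall fun t ht y hy => hC _ ⟨(y, t), ⟨?_, ?_⟩, rfl⟩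
    · exact Metric.ball_subset_closedBall hy
    · rw [Set.uIoc_of_le zero_le_one] at ht
      exact ⟨ht.1.le, ht.2⟩
  · exact continuous_const.intervalIntegrable _ _
  · refine Filter.Eventually.of_forall fun t _ y _ => ?_
    have h1 : HasFDerivAt K (fderiv ℝ K (y, t)) (y, t) :=
      (hK.differentiable (by simp) _).hasFDerivAt
    exact h1.comp y (hasFDerivAt_prodMk_left y t)

/-- The derivative is again a parametric integral, with values in a space of continuous linear maps;
the induction therefore runs over all target spaces F at once. -/
theorem contDiff_parametric_integral {H : Type} [NormedAddCommGroup H] [NormedSpace ℝ H]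
    [ProperSpace H] (m : ℕ) : ∀ {F : Type} [NormedAddCommGroup F] [NormedSpace ℝ F]
    [CompleteSpace F] {K : H × ℝ → F}, ContDiff ℝ ∞ K →
    ContDiff ℝ m (fun x => ∫ t in (0 : ℝ)..1, K (x, t)) := by
  induction m with
  | zero =>
    intro F _ _ _ K hK
    exact contDiff_zero.2 (continuous_iff_continuousAt.2 fun x =>
      (hasFDerivAt_parametric_integral hK x).continuousAt)
  | succ m ih =>
    intro F _ _ _ K hK
    have hd : ContDiff ℝ ∞ fun z : H × ℝ =>
        (fderiv ℝ K z).comp (ContinuousLinearMap.inl ℝ H ℝ) :=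
      (hK.fderiv_right (by simp)).clm_comp contDiff_const
    rw [Nat.cast_succ, contDiff_succ_iff_fderiv]
    refine ⟨fun x => (hasFDerivAt_parametric_integral hK x).differentiableAt, by simp, ?_⟩
    rw [show fderiv ℝ (fun x => ∫ t in (0 : ℝ)..1, K (x, t)) = _ from
      funext fun x => (hasFDerivAt_parametric_integral hK x).fderiv]
    exact ih hd

end Parametric

/-! ### The Euler operator, Hadamard's lemma, and functionals homogeneous under dilations. -/

section Radial

variable {n : ℕ}

/-- The coordinate `xⁱ - x₀ⁱ`, as a complex-valued function. -/
def coordAt (x₀ : E n) (i : Fin n) (x : E n) : ℂ := ((x i - x₀ i : ℝ) : ℂ)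

/-- The Euler operator centred at `x₀`. -/
def euler (x₀ : E n) (f : E n → ℂ) (x : E n) : ℂ := ∑ k, coordAt x₀ k x * pd k f x

variable {x₀ : E n}

theorem coordAt_self (i : Fin n) : coordAt x₀ i x₀ = 0 := by simp [coordAt]

theorem contDiff_coordAt (i : Fin n) : ContDiff ℝ ∞ (coordAt x₀ i) :=
  Complex.ofRealCLM.contDiff.comp
    (((EuclideanSpace.proj (𝕜 := ℝ) i).contDiff (E := E n)).sub contDiff_const)

theorem diff_of_contDiff {F : Type*} [NormedAddCommGroup F] [NormedSpace ℝ F] {f : E n → F}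
    (hf : ContDiff ℝ ∞ f) (x : E n) : DifferentiableAt ℝ f x :=
  hf.differentiable (by simp) x

theorem pd_coordAt (k i : Fin n) (x : E n) :
    pd k (coordAt x₀ i) x = if k = i then 1 else 0 := by
  have hc : DifferentiableAt ℝ (fun y : E n => y i) x :=
    (EuclideanSpace.proj (𝕜 := ℝ) i).differentiableAt
  unfold coordAt
  rw [pd_ofReal (hc.sub_const _), pd_sub hc (differentiableAt_const _), pd_const, pd_coord]
  split_ifs <;> simp

theorem contDiff_euler {f : E n → ℂ} (hf : ContDiff ℝ ∞ f) : ContDiff ℝ ∞ (euler x₀ f) :=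
  ContDiff.sum fun k _ => (contDiff_coordAt k).mul (contDiff_pd hf k)

theorem euler_mul {f g : E n → ℂ} (hf : ContDiff ℝ ∞ f) (hg : ContDiff ℝ ∞ g) (x : E n) :
    euler x₀ (fun y => f y * g y) x = euler x₀ f x * g x + f x * euler x₀ g x := by
  simp only [euler, pd_mul (diff_of_contDiff hf x) (diff_of_contDiff hg x), Finset.sum_mul,
    Finset.mul_sum, ← Finset.sum_add_distrib]
  exact Finset.sum_congr rfl fun _ _ => by ring

theorem euler_coordAt (i : Fin n) (x : E n) : euler x₀ (coordAt x₀ i) x = coordAt x₀ i x := by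
  simp [euler, pd_coordAt]

theorem euler_const (c : ℂ) (x : E n) : euler x₀ (fun _ => c) x = 0 := by
  simp [euler, pd_const]

theorem euler_eq_fderiv (f : E n → ℂ) (x : E n) : euler x₀ f x = fderiv ℝ f x (x - x₀) := by
  rw [fderiv_eq_sum_pd]
  simp [euler, coordAt]

theorem contDiff_segment_integral {g : E n → ℂ} (hg : ContDiff ℝ ∞ g) :
    ContDiff ℝ ∞ fun x => ∫ t in (0 : ℝ)..1, g (x₀ + t • (x - x₀)) := by
  refine contDiff_infty.2 fun m => ?_
  exact contDiff_parametric_integral m (K := fun z : E n × ℝ => g (x₀ + z.2 • (z.1 - x₀)))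
    (hg.comp (by fun_prop))

/-- The equation `(euler + 1) h = g` has a smooth solution. -/
theorem exists_euler_add (x₀ : E n) {g : E n → ℂ} (hg : ContDiff ℝ ∞ g) :
    ∃ h : E n → ℂ, ContDiff ℝ ∞ h ∧ ∀ x, euler x₀ h x + h x = g x := by
  refine ⟨_, contDiff_segment_integral (x₀ := x₀) hg, fun x => ?_⟩
  set h : E n → ℂ := fun x => ∫ t in (0 : ℝ)..1, g (x₀ + t • (x - x₀)) with hh
  have hs : ContDiff ℝ ∞ h := contDiff_segment_integral hg
  set v := x - x₀ with hv
  have hc : Continuous fun t : ℝ => g (x₀ + t • v) := hg.continuous.comp (by fun_prop)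
  have h1 : HasDerivAt (fun s : ℝ => ∫ t in (0 : ℝ)..s, g (x₀ + t • v)) (g (x₀ + (1 : ℝ) • v)) 1 :=
    intervalIntegral.integral_hasDerivAt_right (hc.intervalIntegrable _ _)
      hc.stronglyMeasurable.stronglyMeasurableAtFilter hc.continuousAt
  -- A change of variable gives s·h(x₀+sv) = ∫₀ˢ g(x₀+tv) dt. Differentiating both sides at s = 1
  -- yields h(x) plus the radial derivative of h on one side and g(x) on the other.
  have h2 : (fun s : ℝ => ∫ t in (0 : ℝ)..s, g (x₀ + t • v))
      = fun s : ℝ => s • h (x₀ + s • v) := by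
    ext s
    have := intervalIntegral.smul_integral_comp_mul_right (a := 0) (b := 1)
      (fun t => g (x₀ + t • v)) s
    simp only [zero_mul, one_mul] at this
    rw [← this, hh]
    congr 1
    refine intervalIntegral.integral_congr fun t _ => ?_
    simp [smul_smul]
  have h3 : HasDerivAt (fun s : ℝ => x₀ + s • v) v 1 := by
    simpa using ((hasDerivAt_id (1 : ℝ)).smul_const v).const_add x₀
  have h4 : HasFDerivAt h (fderiv ℝ h (x₀ + (1 : ℝ) • v)) (x₀ + (1 : ℝ) • v) :=
    (diff_of_contDiff hs _).hasFDerivAt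
  have h5 := (hasDerivAt_id (1 : ℝ)).smul (h4.comp_hasDerivAt (1 : ℝ) h3)
  rw [h2] at h1
  have h6 := h1.unique h5
  have hx : x₀ + (1 : ℝ) • v = x := by rw [hv]; simp
  simp only [id, one_smul, Function.comp_apply] at h6
  rw [one_smul] at hx
  rw [hx] at h6
  rw [h6, euler_eq_fderiv]

/-- Hadamard's lemma. -/
theorem exists_hadamard (x₀ : E n) {f : E n → ℂ} (hf : ContDiff ℝ ∞ f) :
    ∃ h : Fin n → E n → ℂ, (∀ i, ContDiff ℝ ∞ (h i)) ∧
      ∀ x, f x = f x₀ + ∑ i, coordAt x₀ i x * h i x := by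
  refine ⟨fun i x => ∫ t in (0 : ℝ)..1, pd i f (x₀ + t • (x - x₀)),
    fun i => contDiff_segment_integral (contDiff_pd hf i), fun x => ?_⟩
  set v := x - x₀ with hv
  have hc : ∀ i, Continuous fun t : ℝ => pd i f (x₀ + t • v) := fun i =>
    (contDiff_pd hf i).continuous.comp (by fun_prop)
  have hder : ∀ t : ℝ, HasDerivAt (fun t : ℝ => f (x₀ + t • v))
      (∑ i, coordAt x₀ i x * pd i f (x₀ + t • v)) t := by
    intro t
    have h3 : HasDerivAt (fun s : ℝ => x₀ + s • v) v t := by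
      simpa using ((hasDerivAt_id t).smul_const v).const_add x₀
    have h4 := (diff_of_contDiff hf (x₀ + t • v)).hasFDerivAt.comp_hasDerivAt t h3
    rw [fderiv_eq_sum_pd] at h4
    rw [show ∑ i, coordAt x₀ i x * pd i f (x₀ + t • v) = ∑ i, v i • pd i f (x₀ + t • v) by
      simp [coordAt, hv]]
    exact h4
  have h1 := intervalIntegral.integral_eq_sub_of_hasDerivAt (a := 0) (b := 1)
    (fun t _ => hder t)
    ((continuous_finsetSum _ fun i _ => continuous_const.mul (hc i)).intervalIntegrable _ _)
  rw [intervalIntegral.integral_finsetSum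
    fun i _ => (continuous_const.fun_mul (hc i)).intervalIntegrable _ _] at h1
  simp only [intervalIntegral.integral_const_mul] at h1
  rw [h1]
  simp [hv]

theorem pd_sum_coordAt_mul {k : Fin n → E n → ℂ} (hk : ∀ i, ContDiff ℝ ∞ (k i)) (a : Fin n)
    (x : E n) : pd a (fun x => ∑ i, coordAt x₀ i x * k i x) x
      = k a x + ∑ i, coordAt x₀ i x * pd a (k i) x := by
  rw [pd_sum _ fun i _ => (diff_of_contDiff (contDiff_coordAt i) x).fun_mul
    (diff_of_contDiff (hk i) x)]
  simp only [pd_mul (diff_of_contDiff (contDiff_coordAt _) x) (diff_of_contDiff (hk _) x),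
    pd_coordAt, Finset.sum_add_distrib]
  simp

/-- A linear functional on the space of smooth functions. -/
structure IsLinearFunctional (T : (E n → ℂ) → ℂ) : Prop where
  add : ∀ f g, ContDiff ℝ ∞ f → ContDiff ℝ ∞ g → T (fun x => f x + g x) = T f + T g
  smul : ∀ (c : ℂ) f, ContDiff ℝ ∞ f → T (fun x => c * f x) = c * T f

namespace IsLinearFunctional

variable {T : (E n → ℂ) → ℂ}

theorem zero (hT : IsLinearFunctional T) : T (fun _ => 0) = 0 := by
  have := hT.smul 0 (fun _ => 0) contDiff_const
  simpa using this

theorem sum (hT : IsLinearFunctional T) {ι : Type*} (s : Finset ι) {f : ι → E n → ℂ}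
    (hf : ∀ i, ContDiff ℝ ∞ (f i)) : T (fun x => ∑ i ∈ s, f i x) = ∑ i ∈ s, T (f i) := by
  classical
  induction s using Finset.induction_on with
  | empty => simpa using hT.zero
  | insert a s ha ih =>
    simp only [Finset.sum_insert ha]
    rw [hT.add _ _ (hf a) (ContDiff.sum fun i _ => hf i), ih]

/-- A functional of weight `1` under dilations about `x₀` depends only on the differential. -/
theorem eq_of_euler_one (hT : IsLinearFunctional T)
    (hE : ∀ f, ContDiff ℝ ∞ f → T (euler x₀ f) = T f) {f : E n → ℂ} (hf : ContDiff ℝ ∞ f) :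
    T f = ∑ i, pd i f x₀ * T (coordAt x₀ i) := by
  obtain ⟨h, hh, hfh⟩ := exists_hadamard x₀ hf
  choose k hk hhk using fun i => exists_hadamard x₀ (hh i)
  have hpd : ∀ i, pd i f x₀ = h i x₀ := by
    intro i
    rw [show f = _ from funext hfh, pd_add (differentiableAt_const _)
      (diff_of_contDiff (ContDiff.sum fun i _ => (contDiff_coordAt i).mul (hh i)) _), pd_const,
      pd_sum_coordAt_mul hh]
    simp [coordAt_self]
  have hconst : ∀ c : ℂ, T (fun _ => c) = 0 := by
    intro c
    rw [← hE _ contDiff_const, ← hT.zero]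
    congr 1
    exact funext fun x => euler_const c x
  -- With (euler + 1)u = k, the Euler operator satisfies (euler − 1)(xⁱxʲu) = xⁱxʲk in centred
  -- coordinates. So T vanishes on the second-order remainder by algebra alone, without any
  -- continuity.
  have hquad : ∀ i j, T (fun x => coordAt x₀ i x * (coordAt x₀ j x * k i j x)) = 0 := by
    intro i j
    obtain ⟨u, hu, hug⟩ := exists_euler_add x₀ (hk i j)
    have hs1 : ContDiff ℝ ∞ fun x => coordAt x₀ j x * u x := (contDiff_coordAt j).mul hu
    have hs : ContDiff ℝ ∞ fun x => coordAt x₀ i x * (coordAt x₀ j x * u x) :=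
      (contDiff_coordAt i).mul hs1
    have h1 := hE _ hs
    have h2 : euler x₀ (fun x => coordAt x₀ i x * (coordAt x₀ j x * u x))
        = fun x => coordAt x₀ i x * (coordAt x₀ j x * u x)
          + coordAt x₀ i x * (coordAt x₀ j x * k i j x) := by
      ext x
      rw [euler_mul (contDiff_coordAt i) hs1, euler_mul (contDiff_coordAt j) hu, euler_coordAt,
        euler_coordAt, ← hug]
      ring
    rw [h2, hT.add _ _ hs ((contDiff_coordAt i).mul ((contDiff_coordAt j).mul (hk i j)))] at h1
    simpa using h1
  have hf2 : f = fun x => f x₀ + (∑ i, h i x₀ * coordAt x₀ i x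
      + ∑ i, ∑ j, coordAt x₀ i x * (coordAt x₀ j x * k i j x)) := by
    ext x
    rw [hfh x, ← Finset.sum_add_distrib]
    congr 1
    refine Finset.sum_congr rfl fun i _ => ?_
    rw [hhk i x, ← Finset.mul_sum]; ring
  have hq : ∀ i j, ContDiff ℝ ∞ fun x => coordAt x₀ i x * (coordAt x₀ j x * k i j x) :=
    fun i j => (contDiff_coordAt i).mul ((contDiff_coordAt j).mul (hk i j))
  have hl : ∀ i, ContDiff ℝ ∞ fun x => h i x₀ * coordAt x₀ i x :=
    fun i => contDiff_const.mul (contDiff_coordAt i)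
  rw [hf2, hT.add _ _ contDiff_const ((ContDiff.sum fun i _ => hl i).add
    (ContDiff.sum fun i _ => ContDiff.sum fun j _ => hq i j)),
    hT.add _ _ (ContDiff.sum fun i _ => hl i)
      (ContDiff.sum fun i _ => ContDiff.sum fun j _ => hq i j), hT.sum _ hl,
    hT.sum _ fun i => ContDiff.sum fun j _ => hq i j, hconst, ← hf2]
  simp only [hT.sum _ (hq _), hquad, hT.smul _ _ (contDiff_coordAt _), hpd]
  simp

/-- A functional of weight `2` under dilations about `x₀` depends only on the Hessian. -/
theorem eq_of_euler_two (hT : IsLinearFunctional T)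
    (hE : ∀ f, ContDiff ℝ ∞ f → T (euler x₀ f) = 2 * T f) {f : E n → ℂ} (hf : ContDiff ℝ ∞ f) :
    T f = (1 / 2) * ∑ i, ∑ j, pd i (pd j f) x₀ *
      T (fun x => coordAt x₀ i x * coordAt x₀ j x) := by
  obtain ⟨h, hh, hfh⟩ := exists_hadamard x₀ hf
  choose k hk hhk using fun i => exists_hadamard x₀ (hh i)
  choose l hl hkl using fun i j => exists_hadamard x₀ (hk i j)
  have hpd1 : ∀ i j, pd j (h i) x₀ = k i j x₀ := by
    intro i j
    rw [show h i = _ from funext (hhk i), pd_add (differentiableAt_const _)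
      (diff_of_contDiff (ContDiff.sum fun j _ => (contDiff_coordAt j).mul (hk i j)) _), pd_const,
      pd_sum_coordAt_mul (hk i)]
    simp [coordAt_self]
  -- The iterated Hadamard coefficients k i j need not be symmetric at x₀; only their symmetrization
  -- is the Hessian, whence the factor 1/2 in the conclusion.
  have hpd : ∀ i j, pd i (pd j f) x₀ = k j i x₀ + k i j x₀ := by
    intro i j
    have h1 : pd j f = fun x => h j x + ∑ i, coordAt x₀ i x * pd j (h i) x := by
      ext x
      conv_lhs => rw [show f = _ from funext hfh]
      rw [pd_add (differentiableAt_const _)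
        (diff_of_contDiff (ContDiff.sum fun i _ => (contDiff_coordAt i).mul (hh i)) _), pd_const,
        pd_sum_coordAt_mul hh, zero_add]
    rw [h1, pd_add (diff_of_contDiff (hh j) _)
      (diff_of_contDiff (ContDiff.sum fun i _ =>
        (contDiff_coordAt i).mul (contDiff_pd (hh i) j)) _),
      pd_sum_coordAt_mul fun i => contDiff_pd (hh i) j]
    simp [coordAt_self, hpd1]
  have hconst : ∀ c : ℂ, T (fun _ => c) = 0 := by
    intro c
    have h1 := hE _ (contDiff_const (c := c))
    rw [show euler x₀ (fun _ => c) = fun _ => 0 from funext fun x => euler_const c x,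
      hT.zero] at h1
    simpa using h1
  have hlin : ∀ i, T (coordAt x₀ i) = 0 := by
    intro i
    have h1 := hE _ (contDiff_coordAt (x₀ := x₀) i)
    rw [show euler x₀ (coordAt x₀ i) = coordAt x₀ i from funext fun x => euler_coordAt i x] at h1
    linear_combination -h1
  have hcs : ∀ i j m {u : E n → ℂ}, ContDiff ℝ ∞ u → ContDiff ℝ ∞ fun x =>
      coordAt x₀ i x * (coordAt x₀ j x * (coordAt x₀ m x * u x)) := fun i j m u hu =>
    (contDiff_coordAt i).mul ((contDiff_coordAt j).mul ((contDiff_coordAt m).mul hu))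
  -- The cubic remainder is killed as in weight one: (euler − 2)(xⁱxʲxᵐu) = xⁱxʲxᵐ(euler + 1)u.
  have hcub : ∀ i j m,
      T (fun x => coordAt x₀ i x * (coordAt x₀ j x * (coordAt x₀ m x * l i j m x))) = 0 := by
    intro i j m
    obtain ⟨u, hu, hug⟩ := exists_euler_add x₀ (hl i j m)
    have hs := hcs i j m hu
    have h1 := hE _ hs
    have h2 : euler x₀ (fun x => coordAt x₀ i x * (coordAt x₀ j x * (coordAt x₀ m x * u x)))
        = fun x => 2 * (coordAt x₀ i x * (coordAt x₀ j x * (coordAt x₀ m x * u x)))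
          + coordAt x₀ i x * (coordAt x₀ j x * (coordAt x₀ m x * l i j m x)) := by
      ext x
      rw [euler_mul (contDiff_coordAt i) ((contDiff_coordAt j).mul ((contDiff_coordAt m).mul hu)),
        euler_mul (contDiff_coordAt j) ((contDiff_coordAt m).mul hu),
        euler_mul (contDiff_coordAt m) hu, euler_coordAt, euler_coordAt, euler_coordAt, ← hug]
      ring
    rw [h2, hT.add _ _ (contDiff_const.mul hs) (hcs i j m (hl i j m)), hT.smul _ _ hs] at h1
    simpa using h1
  have hq : ∀ i j, ContDiff ℝ ∞ fun x => coordAt x₀ i x * coordAt x₀ j x :=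
    fun i j => (contDiff_coordAt i).mul (contDiff_coordAt j)
  have hlc : ∀ i, ContDiff ℝ ∞ fun x => h i x₀ * coordAt x₀ i x :=
    fun i => contDiff_const.mul (contDiff_coordAt i)
  have hqc : ∀ i, ContDiff ℝ ∞ fun x => ∑ j, k i j x₀ * (coordAt x₀ i x * coordAt x₀ j x) :=
    fun i => ContDiff.sum fun j _ => contDiff_const.mul (hq i j)
  have hcc : ∀ i, ContDiff ℝ ∞ fun x => ∑ j, ∑ m,
      coordAt x₀ i x * (coordAt x₀ j x * (coordAt x₀ m x * l i j m x)) :=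
    fun i => ContDiff.sum fun j _ => ContDiff.sum fun m _ => hcs i j m (hl i j m)
  have hf2 : f = fun x => f x₀ + (∑ i, h i x₀ * coordAt x₀ i x
      + (∑ i, (∑ j, k i j x₀ * (coordAt x₀ i x * coordAt x₀ j x))
      + ∑ i, ∑ j, ∑ m, coordAt x₀ i x * (coordAt x₀ j x * (coordAt x₀ m x * l i j m x)))) := by
    ext x
    rw [hfh x]
    simp only [← Finset.sum_add_distrib]
    congr 1
    refine Finset.sum_congr rfl fun i _ => ?_
    rw [hhk i x, mul_add, Finset.mul_sum, mul_comm]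
    congr 1
    refine Finset.sum_congr rfl fun j _ => ?_
    rw [hkl i j x, ← Finset.mul_sum, ← Finset.mul_sum]
    ring
  have hTf : T f = ∑ i, ∑ j, k i j x₀ * T (fun x => coordAt x₀ i x * coordAt x₀ j x) := by
    rw [hf2, hT.add _ _ contDiff_const ((ContDiff.sum fun i _ => hlc i).add
      ((ContDiff.sum fun i _ => hqc i).add (ContDiff.sum fun i _ => hcc i))),
      hT.add _ _ (ContDiff.sum fun i _ => hlc i)
        ((ContDiff.sum fun i _ => hqc i).add (ContDiff.sum fun i _ => hcc i)),
      hT.add _ _ (ContDiff.sum fun i _ => hqc i) (ContDiff.sum fun i _ => hcc i),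
      hT.sum _ hlc, hT.sum _ hqc, hT.sum _ hcc, hconst]
    simp only [hT.smul _ _ (contDiff_coordAt _), hlin,
      hT.sum _ fun j => contDiff_const.mul (hq _ j), hT.smul _ _ (hq _ _),
      hT.sum _ fun j => ContDiff.sum fun m _ => hcs _ j m (hl _ j m),
      hT.sum _ fun m => hcs _ _ m (hl _ _ m), hcub]
    simp
  have hsym : ∑ i, ∑ j, k j i x₀ * T (fun x => coordAt x₀ i x * coordAt x₀ j x)
      = ∑ i, ∑ j, k i j x₀ * T (fun x => coordAt x₀ i x * coordAt x₀ j x) := by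
    rw [Finset.sum_comm]
    refine Finset.sum_congr rfl fun i _ => Finset.sum_congr rfl fun j _ => ?_
    simp only [mul_comm (coordAt x₀ j _)]
  simp only [hpd, add_mul, Finset.sum_add_distrib, hsym, hTf]
  ring

end IsLinearFunctional

end Radial

/-! ### Conformal vector fields centred at a point -/

section ConformalFields

variable {n : ℕ} (p : ℕ)

theorem flatDiag_mul_self (i : Fin n) : flatDiag n p i * flatDiag n p i = 1 := by
  unfold flatDiag; split_ifs <;> norm_num

/-- The homothety centred at `x₀`. -/
def homothetyAt (x₀ : E n) (x : E n) : E n := x - x₀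

/-- The infinitesimal rotations centred at `x₀`. -/
def rotationAt (x₀ : E n) (a b : Fin n) (x : E n) : E n :=
  lower p (x - x₀) a • EuclideanSpace.single b (1 : ℝ)
    - lower p (x - x₀) b • EuclideanSpace.single a (1 : ℝ)

/-- The infinitesimal inversions centred at `x₀`. -/
def inversionAt (x₀ : E n) (a : Fin n) (x : E n) : E n :=
  (∑ j, lower p (x - x₀) j * (x - x₀) j) • EuclideanSpace.single a (1 : ℝ)
    - (2 * lower p (x - x₀) a) • (x - x₀)

theorem translation_mem (i : Fin n) :
    (fun _ : E n => EuclideanSpace.single i (1 : ℝ)) ∈ confAlg n p :=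
  Submodule.subset_span (Or.inl (Or.inl (Or.inl ⟨i, rfl⟩)))

theorem const_mem (v : E n) : (fun _ : E n => v) ∈ confAlg n p := by
  have h : (fun _ : E n => v) = ∑ i, v i • fun _ : E n => EuclideanSpace.single i (1 : ℝ) := by
    ext x j
    simp [Finset.sum_apply, Pi.single_apply]
  rw [h]
  exact Submodule.sum_mem _ fun i _ => Submodule.smul_mem _ _ (translation_mem p i)

theorem homothety_mem : (fun x : E n => x) ∈ confAlg n p :=
  Submodule.subset_span (Or.inl (Or.inr rfl))

theorem homothetyAt_mem (x₀ : E n) : homothetyAt x₀ ∈ confAlg n p :=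
  Submodule.sub_mem _ (homothety_mem p) (const_mem p x₀)

theorem rotation_mem (a b : Fin n) :
    (fun x : E n => lower p x a • EuclideanSpace.single b (1 : ℝ)
      - lower p x b • EuclideanSpace.single a (1 : ℝ)) ∈ confAlg n p :=
  Submodule.subset_span (Or.inl (Or.inl (Or.inr ⟨(a, b), rfl⟩)))

theorem inversion_mem (a : Fin n) :
    (fun x : E n => (∑ j, lower p x j * x j) • EuclideanSpace.single a (1 : ℝ)
      - (2 * lower p x a) • x) ∈ confAlg n p :=
  Submodule.subset_span (Or.inr ⟨a, rfl⟩)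

theorem lower_sub (x y : E n) (a : Fin n) : lower p (x - y) a = lower p x a - lower p y a := by
  simp [lower, mul_sub]

theorem rotationAt_mem (x₀ : E n) (a b : Fin n) : rotationAt p x₀ a b ∈ confAlg n p := by
  have h : rotationAt p x₀ a b
      = (fun x : E n => lower p x a • EuclideanSpace.single b (1 : ℝ)
          - lower p x b • EuclideanSpace.single a (1 : ℝ))
        - fun _ : E n => lower p x₀ a • EuclideanSpace.single b (1 : ℝ)
          - lower p x₀ b • EuclideanSpace.single a (1 : ℝ) := by
    funext x
    simp only [rotationAt, lower_sub, Pi.sub_apply, sub_smul]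
    abel
  rw [h]
  exact Submodule.sub_mem _ (rotation_mem p a b) (const_mem p _)

/-- Expand the quadratic field about x₀: it is the inversion at the origin, corrected by rotations
with weights 2x₀ᵇ, a homothety with factor 2(x₀)ₐ, and a constant field. -/
theorem inversionAt_mem (x₀ : E n) (a : Fin n) : inversionAt p x₀ a ∈ confAlg n p := by
  have h : inversionAt p x₀ a
      = (fun x : E n => (∑ j, lower p x j * x j) • EuclideanSpace.single a (1 : ℝ)
          - (2 * lower p x a) • x)
        + (∑ b, (2 * x₀ b) • fun x : E n => lower p x a • EuclideanSpace.single b (1 : ℝ)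
          - lower p x b • EuclideanSpace.single a (1 : ℝ))
        + (2 * lower p x₀ a) • (fun x : E n => x)
        + fun _ : E n => (∑ j, lower p x₀ j * x₀ j) • EuclideanSpace.single a (1 : ℝ)
          - (2 * lower p x₀ a) • x₀ := by
    funext x
    ext i
    have e1 : ∑ j, lower p (x - x₀) j * (x - x₀) j
        = ∑ j, lower p x j * x j - ∑ j, 2 * x₀ j * lower p x j + ∑ j, lower p x₀ j * x₀ j := by
      rw [← Finset.sum_sub_distrib, ← Finset.sum_add_distrib]
      refine Finset.sum_congr rfl fun j _ => ?_
      simp [lower]; ring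
    have e2 : (∑ b, (2 * x₀ b) • fun x : E n => lower p x a • EuclideanSpace.single b (1 : ℝ)
          - lower p x b • EuclideanSpace.single a (1 : ℝ)) x i
        = 2 * x₀ i * lower p x a - (∑ j, 2 * x₀ j * lower p x j) * (if i = a then 1 else 0) := by
      simp only [Finset.sum_apply, Pi.smul_apply, WithLp.ofLp_sum, PiLp.smul_apply, PiLp.sub_apply,
        smul_eq_mul, PiLp.single_apply, mul_sub, Finset.sum_sub_distrib, Finset.sum_mul]
      congr 1
      · simp
      · exact Finset.sum_congr rfl fun j _ => by ring
    have e3 : inversionAt p x₀ a x i = (∑ j, lower p (x - x₀) j * (x - x₀) j) *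
        (if i = a then 1 else 0) - 2 * lower p (x - x₀) a * (x i - x₀ i) := by
      simp only [inversionAt, PiLp.sub_apply, PiLp.smul_apply, smul_eq_mul, PiLp.single_apply]
    simp only [Pi.add_apply, PiLp.add_apply, e2, Pi.smul_apply,
      PiLp.sub_apply, PiLp.smul_apply, smul_eq_mul, PiLp.single_apply]
    rw [e3, e1, lower_sub]
    ring
  rw [h]
  refine Submodule.add_mem _ (Submodule.add_mem _ (Submodule.add_mem _ (inversion_mem p a)
    (Submodule.sum_mem _ fun b _ => Submodule.smul_mem _ _ (rotation_mem p a b)))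
    (Submodule.smul_mem _ _ (homothety_mem p))) (const_mem p _)

variable (x₀ : E n)

theorem homothetyAt_self : homothetyAt x₀ x₀ = 0 := sub_self _

theorem rotationAt_self (a b : Fin n) : rotationAt p x₀ a b x₀ = 0 := by
  simp [rotationAt, lower]

theorem inversionAt_self (a : Fin n) : inversionAt p x₀ a x₀ = 0 := by
  simp [inversionAt, lower]

theorem pd_sub_coord (k i : Fin n) (x : E n) :
    pd k (fun y : E n => y i - x₀ i) x = if k = i then 1 else 0 := by
  have hc : DifferentiableAt ℝ (fun y : E n => y i) x :=
    (EuclideanSpace.proj (𝕜 := ℝ) i).differentiableAt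
  rw [pd_sub hc (differentiableAt_const _),
    pd_const, pd_coord, sub_zero]

theorem diff_sub_coord (i : Fin n) (x : E n) :
    DifferentiableAt ℝ (fun y : E n => y i - x₀ i) x :=
  (EuclideanSpace.proj (𝕜 := ℝ) i).differentiableAt.sub_const _

theorem divergence_homothetyAt (x : E n) : divergence (homothetyAt x₀) x = n := by
  simp [divergence, homothetyAt, pd_sub_coord]

theorem divergence_rotationAt {a b : Fin n} (hab : a ≠ b) (x : E n) :
    divergence (rotationAt p x₀ a b) x = 0 := by
  refine Finset.sum_eq_zero fun i _ => ?_
  have h : (fun y : E n => rotationAt p x₀ a b y i)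
      = fun y => (flatDiag n p a * if i = b then 1 else 0) * (y a - x₀ a)
        - (flatDiag n p b * if i = a then 1 else 0) * (y b - x₀ b) := by
    funext y
    simp [rotationAt, lower]
  rw [h, pd_sub ((diff_sub_coord x₀ a x).const_mul _) ((diff_sub_coord x₀ b x).const_mul _),
    pd_const_mul (diff_sub_coord x₀ a x), pd_const_mul (diff_sub_coord x₀ b x),
    pd_sub_coord, pd_sub_coord]
  by_cases h1 : i = a
  · subst h1; simp [hab]
  · by_cases h2 : i = b
    · subst h2; simp [Ne.symm hab]
    · simp [h1, h2]

theorem divergence_inversionAt (a : Fin n) (x : E n) :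
    divergence (inversionAt p x₀ a) x = -2 * n * (flatDiag n p a * (x a - x₀ a)) := by
  have hd := fun i => diff_sub_coord x₀ i x
  have hS : DifferentiableAt ℝ (fun y : E n => ∑ j, flatDiag n p j * ((y j - x₀ j) * (y j - x₀ j))) x :=
    DifferentiableAt.fun_sum fun j _ => ((hd j).fun_mul (hd j)).const_mul _
  have hi : ∀ i, pd i (fun y : E n => inversionAt p x₀ a y i) x
      = (if i = a then 2 * (flatDiag n p a * (x a - x₀ a)) else 0)
        - (if i = a then 2 * (flatDiag n p a * (x a - x₀ a)) else 0)
        - 2 * (flatDiag n p a * (x a - x₀ a)) := by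
    intro i
    have h : (fun y : E n => inversionAt p x₀ a y i)
        = fun y => (if i = a then 1 else 0) * (∑ j, flatDiag n p j * ((y j - x₀ j) * (y j - x₀ j)))
          - 2 * flatDiag n p a * ((y a - x₀ a) * (y i - x₀ i)) := by
      funext y
      simp [inversionAt, lower, mul_assoc]
    rw [h, pd_sub (hS.const_mul _) (((hd a).fun_mul (hd i)).const_mul _), pd_const_mul hS,
      pd_const_mul ((hd a).fun_mul (hd i)), pd_mul (hd a) (hd i),
      pd_sum _ fun j _ => ((hd j).fun_mul (hd j)).const_mul _]
    simp only [pd_const_mul ((hd _).fun_mul (hd _)), pd_mul (hd _) (hd _), pd_sub_coord]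
    by_cases hia : i = a
    · subst hia
      simp [Finset.sum_add_distrib, mul_add]
      ring
    · simp [hia]
      ring
  unfold divergence
  simp only [hi, sub_self, zero_sub, Finset.sum_const, Finset.card_univ, Fintype.card_fin,
    nsmul_eq_mul]
  ring

variable (w : ℂ)

/-- At a zero of X only the divergence survives. This is why fields centred at x₀ are used:
equivariance then involves the output density only through its value at x₀. -/
theorem lieDensity_of_zero {X : E n → E n} (hX : X x₀ = 0) (f : E n → ℂ) :
    lieDensity w X f x₀ = w * divergence X x₀ * f x₀ := by
  simp [lieDensity, hX]

theorem lieDensity_homothetyAt (f : E n → ℂ) :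
    lieDensity w (homothetyAt x₀) f = fun x => euler x₀ f x + w * n * f x := by
  funext x
  simp [lieDensity, divergence_homothetyAt, homothetyAt, euler, coordAt]

theorem lieDensity_rotationAt {a b : Fin n} (hab : a ≠ b) (f : E n → ℂ) :
    lieDensity w (rotationAt p x₀ a b) f = fun x => flatDiag n p a * (coordAt x₀ a x * pd b f x)
      - flatDiag n p b * (coordAt x₀ b x * pd a f x) := by
  funext x
  have : ∀ k, ((rotationAt p x₀ a b x k : ℝ) : ℂ) * pd k f x
      = (if k = b then flatDiag n p a * (coordAt x₀ a x * pd k f x) else 0)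
        - (if k = a then flatDiag n p b * (coordAt x₀ b x * pd k f x) else 0) := by
    intro k
    by_cases h1 : k = a
    · subst h1
      simp [rotationAt, lower, hab, coordAt]
      ring
    · by_cases h2 : k = b
      · subst h2
        simp [rotationAt, lower, Ne.symm hab, coordAt]
        ring
      · simp [rotationAt, lower, h1, h2]
  simp only [lieDensity, divergence_rotationAt p x₀ hab, this, Finset.sum_sub_distrib]
  simp

/-- The flat quadratic form centred at `x₀`. -/
def quadAt (x : E n) : ℂ := ∑ j, (flatDiag n p j : ℂ) * (coordAt x₀ j x * coordAt x₀ j x)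

theorem lieDensity_inversionAt (a : Fin n) (f : E n → ℂ) :
    lieDensity w (inversionAt p x₀ a) f = fun x => quadAt p x₀ x * pd a f x
      - 2 * flatDiag n p a * (coordAt x₀ a x * euler x₀ f x)
      - 2 * n * w * flatDiag n p a * (coordAt x₀ a x * f x) := by
  funext x
  have : ∀ k, ((inversionAt p x₀ a x k : ℝ) : ℂ) * pd k f x
      = (if k = a then quadAt p x₀ x * pd k f x else 0)
        - 2 * flatDiag n p a * coordAt x₀ a x * (coordAt x₀ k x * pd k f x) := by
    intro k
    by_cases h : k = a
    · subst h
      simp [inversionAt, lower, coordAt, quadAt, mul_assoc]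
      ring
    · simp [inversionAt, lower, coordAt, h]
      ring
  simp only [lieDensity, divergence_inversionAt, this, Finset.sum_sub_distrib, ← Finset.mul_sum]
  simp only [Finset.sum_ite_eq', Finset.mem_univ, if_true, euler, coordAt]
  push_cast
  ring

theorem contDiff_quadAt : ContDiff ℝ ∞ (quadAt p x₀) :=
  ContDiff.sum fun j _ => contDiff_const.mul ((contDiff_coordAt j).mul (contDiff_coordAt j))

end ConformalFields

/-! ### Conformally equivariant bidifferential operators on scalar densities -/

section Bilinear

variable {n : ℕ}

/-- A bilinear operation on densities of weights `ν` and `lam` with values in densities of weight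
`mu`, evaluated at `x₀`, which is a second-order differential operator with flat principal
symbol `f η` in the second argument and commutes with the conformal vector fields that vanish
at `x₀`. -/
structure IsConformalPairing (p : ℕ) (x₀ : E n) (ν lam mu : ℂ) (B : (E n → ℂ) → (E n → ℂ) → ℂ) :
    Prop where
  linear : ∀ φ, ContDiff ℝ ∞ φ → IsLinearFunctional fun f => B f φ
  form : ∀ f, ContDiff ℝ ∞ f → ∃ (a1 : Fin n → ℂ) (a0 : ℂ), ∀ φ, ContDiff ℝ ∞ φ →
    B f φ = f x₀ * flatLaplace (flatDiag n p) φ x₀ + ∑ i, a1 i * pd i φ x₀ + a0 * φ x₀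
  equivariant : ∀ X ∈ confAlg n p, X x₀ = 0 → ∀ f φ, ContDiff ℝ ∞ f → ContDiff ℝ ∞ φ →
    ContDiff ℝ ∞ (lieDensity ν X f) → ContDiff ℝ ∞ (lieDensity lam X φ) →
    B (lieDensity ν X f) φ = mu * divergence X x₀ * B f φ - B f (lieDensity lam X φ)

theorem flatLaplace_coordAt_mul (η : Fin n → ℝ) (x₀ : E n) (a b : Fin n) (x : E n) :
    flatLaplace η (fun y => coordAt x₀ a y * coordAt x₀ b y) x
      = if a = b then 2 * (η a : ℂ) else 0 := by
  have hpd : ∀ k i : Fin n, pd k (coordAt x₀ i) = fun _ => if k = i then 1 else 0 :=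
    fun k i => funext fun x => pd_coordAt k i x
  simp only [flatLaplace, pd_pd_mul isOpen_univ (contDiff_coordAt a).contDiffOn
    (contDiff_coordAt b).contDiffOn (Set.mem_univ x), hpd, pd_const]
  by_cases hab : a = b
  · subst hab; simp; ring
  · simp [hab, Ne.symm hab]

namespace IsConformalPairing

variable {p : ℕ} {x₀ : E n} {ν lam mu : ℂ} {B : (E n → ℂ) → (E n → ℂ) → ℂ}

/-- Testing on 1 and on the centred coordinates recovers the unknown coefficients, so B is
determined by the functionals f ↦ B(f, 1) and f ↦ B(f, xⁱ − x₀ⁱ). -/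
theorem eq_add (h : IsConformalPairing p x₀ ν lam mu B) {f φ : E n → ℂ} (hf : ContDiff ℝ ∞ f)
    (hφ : ContDiff ℝ ∞ φ) :
    B f φ = f x₀ * flatLaplace (flatDiag n p) φ x₀ + ∑ i, B f (coordAt x₀ i) * pd i φ x₀
      + B f (fun _ => 1) * φ x₀ := by
  obtain ⟨a1, a0, ha⟩ := h.form f hf
  have h0 : B f (fun _ => 1) = a0 := by
    rw [ha _ contDiff_const]
    simp [flatLaplace, show ∀ i, pd i (fun _ : E n => (1 : ℂ)) = fun _ => 0 from
      fun i => funext fun x => pd_const i _ x, pd_const]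
  have h1 : ∀ i, B f (coordAt x₀ i) = a1 i := by
    intro i
    have hpd : ∀ k : Fin n, pd k (coordAt x₀ i) = fun _ => if k = i then 1 else 0 :=
      fun k => funext fun x => pd_coordAt k i x
    rw [ha _ (contDiff_coordAt i)]
    simp [flatLaplace, hpd, pd_const, coordAt_self]
  rw [h0, ha φ hφ]
  simp only [h1]

theorem smul_right (h : IsConformalPairing p x₀ ν lam mu B) {f φ : E n → ℂ}
    (hf : ContDiff ℝ ∞ f) (hφ : ContDiff ℝ ∞ φ) (c : ℂ) :
    B f (fun x => c * φ x) = c * B f φ := by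
  obtain ⟨a1, a0, ha⟩ := h.form f hf
  have hpd : ∀ i x, pd i (fun y => c * φ y) x = c * pd i φ x :=
    fun i x => pd_const_mul (diff_of_contDiff hφ x) c i
  have hpd2 : ∀ i x, pd i (pd i fun y => c * φ y) x = c * pd i (pd i φ) x := by
    intro i x
    rw [show (pd i fun y => c * φ y) = fun y => c * pd i φ y from funext (hpd i)]
    exact pd_const_mul (diff_of_contDiff (contDiff_pd hφ i) x) c i
  rw [ha _ (contDiff_const.mul hφ), ha _ hφ]
  simp only [hpd, hpd2, flatLaplace, mul_add, Finset.mul_sum]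
  congr 1
  congr 1
  · exact Finset.sum_congr rfl fun _ _ => by ring
  · exact Finset.sum_congr rfl fun _ _ => by ring
  · ring

theorem add_right (h : IsConformalPairing p x₀ ν lam mu B) {f φ ψ : E n → ℂ}
    (hf : ContDiff ℝ ∞ f) (hφ : ContDiff ℝ ∞ φ) (hψ : ContDiff ℝ ∞ ψ) :
    B f (fun x => φ x + ψ x) = B f φ + B f ψ := by
  obtain ⟨a1, a0, ha⟩ := h.form f hf
  have hpd : ∀ i x, pd i (fun y => φ y + ψ y) x = pd i φ x + pd i ψ x :=
    fun i x => pd_add (diff_of_contDiff hφ x) (diff_of_contDiff hψ x) i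
  have hpd2 : ∀ i x, pd i (pd i fun y => φ y + ψ y) x = pd i (pd i φ) x + pd i (pd i ψ) x := by
    intro i x
    rw [show (pd i fun y => φ y + ψ y) = fun y => pd i φ y + pd i ψ y from funext (hpd i)]
    exact pd_add (diff_of_contDiff (contDiff_pd hφ i) x) (diff_of_contDiff (contDiff_pd hψ i) x) i
  rw [ha _ (hφ.add hψ), ha _ hφ, ha _ hψ]
  simp only [hpd, hpd2, flatLaplace, mul_add, Finset.sum_add_distrib]
  ring

/-- Equivariance under the centred homothety, whose divergence is n, for φ homogeneous of degree m.
When n(μ−λ−ν) = 2 the functional has weight 1 for linear φ and weight 2 for constant φ. -/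
theorem euler_of (h : IsConformalPairing p x₀ ν lam mu B) {f φ : E n → ℂ} (hf : ContDiff ℝ ∞ f)
    (hφ : ContDiff ℝ ∞ φ) {m : ℂ} (hm : euler x₀ φ = fun x => m * φ x) :
    B (euler x₀ f) φ = (n * (mu - lam - ν) - m) * B f φ := by
  have hL : lieDensity lam (homothetyAt x₀) φ = fun x => (m + lam * n) * φ x := by
    rw [lieDensity_homothetyAt, hm]; funext x; ring
  have h1 := h.equivariant _ (homothetyAt_mem p x₀) (homothetyAt_self x₀) f φ hf hφ
    (by rw [lieDensity_homothetyAt]; exact (contDiff_euler hf).add (contDiff_const.mul hf))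
    (by rw [hL]; exact contDiff_const.mul hφ)
  rw [hL, h.smul_right hf hφ, lieDensity_homothetyAt,
    (h.linear φ hφ).add _ _ (contDiff_euler hf) (contDiff_const.mul hf),
    (h.linear φ hφ).smul _ _ hf, divergence_homothetyAt] at h1
  push_cast at h1
  linear_combination h1

theorem flatLaplace_quadAt (x : E n) :
    flatLaplace (flatDiag n p) (quadAt p x₀) x = 2 * n := by
  have hs : ∀ j : Fin n, ContDiff ℝ ∞ fun y : E n => coordAt x₀ j y * coordAt x₀ j y :=
    fun j => (contDiff_coordAt j).mul (contDiff_coordAt j)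
  have hpd : ∀ i x, pd i (quadAt p x₀) x
      = ∑ j, (flatDiag n p j : ℂ) * pd i (fun y => coordAt x₀ j y * coordAt x₀ j y) x := by
    intro i x
    unfold quadAt
    rw [pd_sum _ fun j _ => (diff_of_contDiff (hs j) x).const_mul _]
    exact Finset.sum_congr rfl fun j _ => pd_const_mul (diff_of_contDiff (hs j) x) _ i
  have hpd2 : ∀ i x, pd i (pd i (quadAt p x₀)) x = ∑ j, (flatDiag n p j : ℂ) *
      pd i (pd i fun y => coordAt x₀ j y * coordAt x₀ j y) x := by
    intro i x
    rw [show pd i (quadAt p x₀) = _ from funext (hpd i),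
      pd_sum _ fun j _ => (diff_of_contDiff (contDiff_pd (hs j) i) x).const_mul _]
    exact Finset.sum_congr rfl fun j _ => pd_const_mul (diff_of_contDiff (contDiff_pd (hs j) i) x) _ i
  have hsum : flatLaplace (flatDiag n p) (quadAt p x₀) x
      = ∑ j, (flatDiag n p j : ℂ) *
        flatLaplace (flatDiag n p) (fun y => coordAt x₀ j y * coordAt x₀ j y) x := by
    simp only [flatLaplace, hpd2, Finset.mul_sum]
    rw [Finset.sum_comm]
    exact Finset.sum_congr rfl fun j _ => Finset.sum_congr rfl fun i _ => by ring
  have hsq : ∀ j : Fin n, (flatDiag n p j : ℂ) * (flatDiag n p j : ℂ) = 1 := fun j => by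
    exact_mod_cast flatDiag_mul_self p j
  rw [hsum]
  simp only [flatLaplace_coordAt_mul, if_true]
  rw [Finset.sum_congr rfl fun j _ => show (flatDiag n p j : ℂ) * (2 * (flatDiag n p j : ℂ)) = 2 by
    linear_combination 2 * hsq j]
  simp; ring

/-- On quadratic functions centred at `x₀`, the operator `B 1` is the flat Laplacian. -/
theorem apply_quadratic (h : IsConformalPairing p x₀ ν lam mu B) {q : E n → ℂ}
    (hq : ContDiff ℝ ∞ q) (h0 : q x₀ = 0) (h1 : ∀ i, pd i q x₀ = 0) :
    B (fun _ => 1) q = flatLaplace (flatDiag n p) q x₀ := by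
  rw [h.eq_add contDiff_const hq, h0]
  simp [h1]

/-- Apply the inversion to the pair (1, xⁱ − x₀ⁱ). It sends 1 to a multiple of the a-th centred
coordinate and the linear function to a quadratic one, on which B(1, ·) is the flat Laplacian; its
divergence vanishes at x₀. -/
theorem coord_coord (h : IsConformalPairing p x₀ ν lam mu B) (a i : Fin n) :
    n * ν * B (coordAt x₀ a) (coordAt x₀ i)
      = if a = i then (n - 2 - 2 * n * lam) * flatDiag n p a else 0 := by
  have hsq : (flatDiag n p a : ℂ) * (flatDiag n p a : ℂ) = 1 := by
    exact_mod_cast flatDiag_mul_self p a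
  have hL1 : lieDensity ν (inversionAt p x₀ a) (fun _ => 1)
      = fun x => -(2 * n * ν * flatDiag n p a) * coordAt x₀ a x := by
    rw [lieDensity_inversionAt]
    funext x
    simp only [pd_const, euler_const]; ring
  have hL2 : lieDensity lam (inversionAt p x₀ a) (coordAt x₀ i)
      = fun x => (if a = i then 1 else 0) * quadAt p x₀ x
        + -(2 * flatDiag n p a * (1 + n * lam)) * (coordAt x₀ a x * coordAt x₀ i x) := by
    rw [lieDensity_inversionAt]
    funext x
    simp only [pd_coordAt, euler_coordAt]; ring
  have hai : ContDiff ℝ ∞ fun x => coordAt x₀ a x * coordAt x₀ i x :=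
    (contDiff_coordAt a).mul (contDiff_coordAt i)
  have hs2 := (contDiff_const (c := if a = i then (1 : ℂ) else 0)).mul (contDiff_quadAt p x₀)
  have hs3 := (contDiff_const (c := -(2 * (flatDiag n p a : ℂ) * (1 + n * lam)))).mul hai
  have hpq : ∀ k, pd k (quadAt p x₀) x₀ = 0 := by
    intro k
    unfold quadAt
    rw [pd_sum _ fun j _ => (diff_of_contDiff
      ((contDiff_coordAt j).mul (contDiff_coordAt j)) x₀).const_mul _]
    refine Finset.sum_eq_zero fun j _ => ?_
    rw [pd_const_mul (diff_of_contDiff ((contDiff_coordAt j).mul (contDiff_coordAt j)) x₀),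
      pd_mul (diff_of_contDiff (contDiff_coordAt j) _) (diff_of_contDiff (contDiff_coordAt j) _)]
    simp [coordAt_self]
  have hpa : ∀ k, pd k (fun x => coordAt x₀ a x * coordAt x₀ i x) x₀ = 0 := by
    intro k
    rw [pd_mul (diff_of_contDiff (contDiff_coordAt a) _) (diff_of_contDiff (contDiff_coordAt i) _)]
    simp [coordAt_self]
  have hq0 : quadAt p x₀ x₀ = 0 := by simp [quadAt, coordAt_self]
  have hone := contDiff_const (𝕜 := ℝ) (E := E n) (n := ∞) (c := (1 : ℂ))
  have hLB : B (fun _ => 1) (lieDensity lam (inversionAt p x₀ a) (coordAt x₀ i))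
      = (if a = i then 1 else 0) * (2 * n)
        - 2 * flatDiag n p a * (1 + n * lam) * (if a = i then 2 * (flatDiag n p a : ℂ) else 0) := by
    rw [hL2, h.add_right hone hs2 hs3, h.smul_right hone (contDiff_quadAt p x₀), h.smul_right hone hai,
      h.apply_quadratic (contDiff_quadAt p x₀) hq0 hpq,
      h.apply_quadratic hai (by simp [coordAt_self]) hpa, flatLaplace_quadAt,
      flatLaplace_coordAt_mul]
    ring
  have hE := h.equivariant _ (inversionAt_mem p x₀ a) (inversionAt_self p x₀ a) (fun _ => 1)
    (coordAt x₀ i) hone (contDiff_coordAt i)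
    (by rw [hL1]; exact contDiff_const.mul (contDiff_coordAt a))
    (by rw [hL2]; exact hs2.add hs3)
  rw [hLB, hL1, (h.linear _ (contDiff_coordAt i)).smul _ _ (contDiff_coordAt a),
    divergence_inversionAt] at hE
  simp only [sub_self, mul_zero, Complex.ofReal_zero, zero_mul, zero_sub] at hE
  by_cases hai : a = i
  · subst hai
    simp only [if_true] at hE ⊢
    linear_combination (-(1 / 2) * (flatDiag n p a : ℂ)) * hE
      - (n * ν * B (coordAt x₀ a) (coordAt x₀ a) + 2 * (1 + n * lam) * flatDiag n p a) * hsq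
  · simp only [hai, if_false] at hE ⊢
    linear_combination (-(1 / 2) * (flatDiag n p a : ℂ)) * hE
      - (n * ν * B (coordAt x₀ a) (coordAt x₀ i)) * hsq

/-- Rotations are divergence-free and annihilate constants, so the functional f ↦ B(f, 1) is
rotation invariant. The next two lemmas read off from this that its values on quadratic monomials
are proportional to η. -/
theorem rotation_one (h : IsConformalPairing p x₀ ν lam mu B) {a b : Fin n} (hab : a ≠ b)
    {f : E n → ℂ} (hf : ContDiff ℝ ∞ f) :
    B (fun x => (flatDiag n p a : ℂ) * (coordAt x₀ a x * pd b f x)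
      - flatDiag n p b * (coordAt x₀ b x * pd a f x)) (fun _ => 1) = 0 := by
  have hL : lieDensity lam (rotationAt p x₀ a b) (fun _ => 1) = fun _ => 0 * 1 := by
    rw [lieDensity_rotationAt p x₀ lam hab]
    funext x; simp [pd_const]
  have hs : ∀ a b : Fin n, ContDiff ℝ ∞ fun x => (flatDiag n p a : ℂ) *
      (coordAt x₀ a x * pd b f x) := fun a b =>
    contDiff_const.mul ((contDiff_coordAt a).mul (contDiff_pd hf b))
  have hE := h.equivariant _ (rotationAt_mem p x₀ a b) (rotationAt_self p x₀ a b) f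
    (fun _ => 1) hf contDiff_const
    (by rw [lieDensity_rotationAt p x₀ ν hab]; exact (hs a b).sub (hs b a))
    (by rw [hL]; exact contDiff_const)
  rw [hL, h.smul_right hf contDiff_const, lieDensity_rotationAt p x₀ ν hab,
    divergence_rotationAt p x₀ hab] at hE
  rw [hE]; simp

theorem coord_mul_coord (h : IsConformalPairing p x₀ ν lam mu B) {a b : Fin n} (hab : a ≠ b) :
    B (fun x => coordAt x₀ a x * coordAt x₀ b x) (fun _ => 1) = 0 := by
  have hsq : (flatDiag n p a : ℂ) * (flatDiag n p a : ℂ) = 1 := by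
    exact_mod_cast flatDiag_mul_self p a
  -- Rotating the square of the b-th coordinate produces 2ηₐ times the mixed monomial.
  have h1 := h.rotation_one hab ((contDiff_coordAt (x₀ := x₀) b).mul
    (contDiff_coordAt (x₀ := x₀) b))
  have hd := fun i x => diff_of_contDiff (contDiff_coordAt (x₀ := x₀) i) x
  simp only [pd_mul (hd b _) (hd b _), pd_coordAt, if_true, hab, if_false] at h1
  rw [show (fun x => (flatDiag n p a : ℂ) * (coordAt x₀ a x * (1 * coordAt x₀ b x
      + coordAt x₀ b x * 1)) - flatDiag n p b * (coordAt x₀ b x * (0 * coordAt x₀ b x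
      + coordAt x₀ b x * 0))) = fun x => 2 * (flatDiag n p a : ℂ) *
      (coordAt x₀ a x * coordAt x₀ b x) from funext fun x => by ring,
    (h.linear _ contDiff_const).smul _ _ ((contDiff_coordAt a).mul (contDiff_coordAt b))] at h1
  linear_combination (1 / 2 * (flatDiag n p a : ℂ)) * h1
    - B (fun x => coordAt x₀ a x * coordAt x₀ b x) (fun _ => 1) * hsq

theorem coord_sq (h : IsConformalPairing p x₀ ν lam mu B) (a b : Fin n) :
    (flatDiag n p a : ℂ) * B (fun x => coordAt x₀ a x * coordAt x₀ a x) (fun _ => 1)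
      = flatDiag n p b * B (fun x => coordAt x₀ b x * coordAt x₀ b x) (fun _ => 1) := by
  by_cases hab : a = b
  · rw [hab]
  -- Rotating the mixed monomial produces the difference of the two signed squares.
  have h1 := h.rotation_one hab ((contDiff_coordAt (x₀ := x₀) a).mul
    (contDiff_coordAt (x₀ := x₀) b))
  have hd := fun i x => diff_of_contDiff (contDiff_coordAt (x₀ := x₀) i) x
  have hs : ∀ i : Fin n, ContDiff ℝ ∞ fun x => coordAt x₀ i x * coordAt x₀ i x :=
    fun i => (contDiff_coordAt i).mul (contDiff_coordAt i)
  simp only [pd_mul (hd a _) (hd b _), pd_coordAt, if_true, hab, Ne.symm hab, if_false] at h1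
  rw [show (fun x => (flatDiag n p a : ℂ) * (coordAt x₀ a x * (0 * coordAt x₀ b x
      + coordAt x₀ a x * 1)) - flatDiag n p b * (coordAt x₀ b x * (1 * coordAt x₀ b x
      + coordAt x₀ a x * 0))) = fun x => (flatDiag n p a : ℂ) * (coordAt x₀ a x * coordAt x₀ a x)
      + -(flatDiag n p b : ℂ) * (coordAt x₀ b x * coordAt x₀ b x) from funext fun x => by ring,
    (h.linear _ contDiff_const).add _ _ (contDiff_const.mul (hs a)) (contDiff_const.mul (hs b)),
    (h.linear _ contDiff_const).smul _ _ (hs a), (h.linear _ contDiff_const).smul _ _ (hs b)] at h1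
  linear_combination h1

/-- Apply the inversion to the pair (xᵃ − x₀ᵃ, 1). The flat quadratic form that appears is evaluated
through `coord_sq`, which makes all n of its terms equal. -/
theorem coord_sq_mul (h : IsConformalPairing p x₀ ν lam mu B) (a : Fin n) :
    (n - 2 - 2 * n * ν) * ((flatDiag n p a : ℂ) *
        B (fun x => coordAt x₀ a x * coordAt x₀ a x) (fun _ => 1))
      = 2 * n * lam * flatDiag n p a * B (coordAt x₀ a) (coordAt x₀ a) := by
  set T : (E n → ℂ) → ℂ := fun f => B f (fun _ => 1) with hT
  have hl : IsLinearFunctional T := h.linear _ contDiff_const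
  have hs : ∀ i : Fin n, ContDiff ℝ ∞ fun x => coordAt x₀ i x * coordAt x₀ i x :=
    fun i => (contDiff_coordAt i).mul (contDiff_coordAt i)
  have hL1 : lieDensity lam (inversionAt p x₀ a) (fun _ => 1)
      = fun x => -(2 * n * lam * flatDiag n p a) * coordAt x₀ a x := by
    rw [lieDensity_inversionAt]
    funext x
    simp only [pd_const, euler_const]; ring
  have hL2 : lieDensity ν (inversionAt p x₀ a) (coordAt x₀ a)
      = fun x => quadAt p x₀ x
        + -(2 * flatDiag n p a * (1 + n * ν)) * (coordAt x₀ a x * coordAt x₀ a x) := by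
    rw [lieDensity_inversionAt]
    funext x
    simp only [pd_coordAt, euler_coordAt, if_true]; ring
  have hE := h.equivariant _ (inversionAt_mem p x₀ a) (inversionAt_self p x₀ a) (coordAt x₀ a)
    (fun _ => 1) (contDiff_coordAt a) contDiff_const
    (by rw [hL2]; exact (contDiff_quadAt p x₀).add (contDiff_const.mul (hs a)))
    (by rw [hL1]; exact contDiff_const.mul (contDiff_coordAt a))
  rw [hL1, hL2, h.smul_right (contDiff_coordAt a) (contDiff_coordAt a),
    divergence_inversionAt] at hE
  have hQ : T (quadAt p x₀) = n * ((flatDiag n p a : ℂ) *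
      B (fun x => coordAt x₀ a x * coordAt x₀ a x) (fun _ => 1)) := by
    unfold quadAt
    rw [hl.sum _ fun j => contDiff_const.mul (hs j)]
    simp only [hl.smul _ _ (hs _)]
    rw [Finset.sum_congr rfl fun j _ => h.coord_sq j a]
    simp
  have hA := hl.add _ _ (contDiff_quadAt p x₀)
    ((contDiff_const (c := -(2 * (flatDiag n p a : ℂ) * (1 + n * ν)))).mul (hs a))
  rw [hl.smul _ _ (hs a), hQ] at hA
  simp only [hT] at hA
  rw [hA] at hE
  simp only [sub_self, mul_zero, Complex.ofReal_zero, zero_mul, zero_sub] at hE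
  linear_combination hE

/-- Classification of conformally equivariant pairings. -/
theorem eq (h : IsConformalPairing p x₀ ν lam mu B)
    (hmu : n * (mu - lam - ν) = 2) (h1 : (n : ℂ) * ν ≠ 0) (h2 : (n : ℂ) - 2 - 2 * n * ν ≠ 0)
    {f φ : E n → ℂ} (hf : ContDiff ℝ ∞ f) (hφ : ContDiff ℝ ∞ φ) :
    B f φ = f x₀ * flatLaplace (flatDiag n p) φ x₀
      + (n - 2 - 2 * n * lam) / (n * ν) * flatGrad (flatDiag n p) f φ x₀
      + n * lam * (n - 2 - 2 * n * lam) / (n * ν * (n - 2 - 2 * n * ν))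
        * flatLaplace (flatDiag n p) f x₀ * φ x₀ := by
  have hsq : ∀ a : Fin n, (flatDiag n p a : ℂ) * (flatDiag n p a : ℂ) = 1 := fun a => by
    exact_mod_cast flatDiag_mul_self p a
  have hcc : ∀ a i : Fin n, B (coordAt x₀ a) (coordAt x₀ i)
      = if a = i then (n - 2 - 2 * n * lam) / (n * ν) * flatDiag n p a else 0 := by
    intro a i
    have := h.coord_coord a i
    by_cases hai : a = i
    · simp only [hai, if_true] at this ⊢
      rw [div_mul_eq_mul_div, eq_div_iff h1, ← this]; ring
    · simp only [hai, if_false] at this ⊢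
      exact (mul_eq_zero.1 this).resolve_left h1
  -- Weight 1 under dilations: only the differential of f enters, with the coefficients found in
  -- `hcc`.
  have hT1 : ∀ i, B f (coordAt x₀ i)
      = (n - 2 - 2 * n * lam) / (n * ν) * (flatDiag n p i * pd i f x₀) := by
    intro i
    have := (h.linear _ (contDiff_coordAt i)).eq_of_euler_one (x₀ := x₀) (fun f hf => by
      rw [h.euler_of hf (contDiff_coordAt i) (m := 1)
        (funext fun x => by rw [euler_coordAt, one_mul]), hmu]; ring) hf
    rw [this]
    simp only [hcc]
    simp
    ring
  have hsqc : ∀ a : Fin n, B (fun x => coordAt x₀ a x * coordAt x₀ a x) (fun _ => 1)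
      = 2 * (n * lam * (n - 2 - 2 * n * lam) / (n * ν * (n - 2 - 2 * n * ν)))
        * flatDiag n p a := by
    intro a
    have := h.coord_sq_mul a
    rw [hcc, if_pos rfl] at this
    have h3 : (flatDiag n p a : ℂ) * B (fun x => coordAt x₀ a x * coordAt x₀ a x) (fun _ => 1)
        = 2 * (n * lam * (n - 2 - 2 * n * lam) / (n * ν * (n - 2 - 2 * n * ν))) := by
      apply mul_left_cancel₀ h2
      have e : ((n : ℂ) - 2 - 2 * n * ν) *
          (2 * (n * lam * (n - 2 - 2 * n * lam) / (n * ν * (n - 2 - 2 * n * ν))))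
          = 2 * n * lam * ((n - 2 - 2 * n * lam) / (n * ν)) := by
        have key : ∀ D b L N : ℂ, D ≠ 0 → D * (2 * (L * N / (b * D))) = 2 * (L * (N / b)) := by
          intro D b L N hD
          rw [mul_comm b D, mul_div_mul_comm]
          field_simp
        rw [key _ _ _ _ h2]; ring
      rw [this, e]
      linear_combination (2 * n * lam * ((n - 2 - 2 * n * lam) / (n * ν))) * hsq a
    linear_combination (flatDiag n p a : ℂ) * h3
      - B (fun x => coordAt x₀ a x * coordAt x₀ a x) (fun _ => 1) * hsq a
  -- Weight 2 under dilations: only the Hessian of f enters, and rotation invariance leaves its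
  -- trace.
  have hT0 : B f (fun _ => 1)
      = n * lam * (n - 2 - 2 * n * lam) / (n * ν * (n - 2 - 2 * n * ν))
        * flatLaplace (flatDiag n p) f x₀ := by
    have := (h.linear _ (contDiff_const (c := (1 : ℂ)))).eq_of_euler_two (x₀ := x₀) (fun f hf => by
      rw [h.euler_of hf (contDiff_const (c := (1 : ℂ))) (m := 0)
        (funext fun x => by rw [euler_const, zero_mul]), hmu]; ring) hf
    rw [this, flatLaplace, Finset.mul_sum, Finset.mul_sum]
    refine Finset.sum_congr rfl fun i _ => ?_
    rw [Finset.sum_eq_single i]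
    · rw [hsqc]; ring
    · intro j _ hj
      rw [h.coord_mul_coord (Ne.symm hj), mul_zero]
    · simp
  rw [h.eq_add hf hφ, hT0]
  simp only [hT1, flatGrad, Finset.mul_sum]
  congr 2
  exact Finset.sum_congr rfl fun i _ => by ring

end IsConformalPairing

end Bilinear

/-! ### The conformal Killing equation -/

section Killing

variable {n : ℕ}

/-- The conformal Killing equation for the flat metric. -/
theorem conformal_killing (p : ℕ) {X : E n → E n} (hX : X ∈ confAlg n p) :
    ContDiff ℝ ∞ X ∧ ∃ c : E n → ℝ, ∀ x i j,
      flatDiag n p j * pd j (fun y => X y i) x + flatDiag n p i * pd i (fun y => X y j) x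
        = if i = j then 2 * c x * flatDiag n p i else 0 := by
  have hd : ∀ (i : Fin n) x, DifferentiableAt ℝ (fun y : E n => y i) x := fun i x =>
    (EuclideanSpace.proj (𝕜 := ℝ) i).differentiableAt
  have hsm : ∀ {Y : E n → E n}, ContDiff ℝ ∞ Y → ∀ (i : Fin n) x,
      DifferentiableAt ℝ (fun y : E n => Y y i) x := fun hY i x =>
    (EuclideanSpace.proj (𝕜 := ℝ) i).differentiableAt.comp x (diff_of_contDiff hY x)
  have hlow : ∀ i : Fin n, ContDiff ℝ ∞ fun x : E n => lower p x i := fun i =>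
    contDiff_const.mul (EuclideanSpace.proj (𝕜 := ℝ) i).contDiff
  have hco : ∀ i : Fin n, ContDiff ℝ ∞ fun x : E n => x i := fun i =>
    (EuclideanSpace.proj (𝕜 := ℝ) i).contDiff
  refine Submodule.span_induction (p := fun (X : E n → E n) _ => ContDiff ℝ ∞ X ∧ ∃ c : E n → ℝ, ∀ x i j,
      flatDiag n p j * pd j (fun y => X y i) x + flatDiag n p i * pd i (fun y => X y j) x
        = if i = j then 2 * c x * flatDiag n p i else 0) ?_ ?_ ?_ ?_ hX
  -- The equation is linear in X, so the generators suffice. Their conformal factors c are 0 for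
  -- translations and rotations, 1 for the homothety, and −2ηₐxᵃ for the inversions.
  · rintro X (((⟨a, rfl⟩ | ⟨⟨a, b⟩, rfl⟩) | rfl) | ⟨a, rfl⟩)
    · refine ⟨contDiff_const, 0, fun x i j => ?_⟩
      simp [pd_const]
    · refine ⟨((hlow a).smul contDiff_const).sub ((hlow b).smul contDiff_const), 0,
        fun x i j => ?_⟩
      have h : ∀ i : Fin n, (fun y : E n => (lower p y a • EuclideanSpace.single b (1 : ℝ)
          - lower p y b • EuclideanSpace.single a (1 : ℝ)) i)
          = fun y => (flatDiag n p a * if i = b then 1 else 0) * y a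
            - (flatDiag n p b * if i = a then 1 else 0) * y b := by
        intro i; funext y
        simp only [lower, PiLp.sub_apply, PiLp.smul_apply, smul_eq_mul, PiLp.single_apply]
        ring
      have hder : ∀ i j : Fin n, flatDiag n p j *
          pd j (fun y : E n => (lower p y a • EuclideanSpace.single b (1 : ℝ)
          - lower p y b • EuclideanSpace.single a (1 : ℝ)) i) x
          = (if j = a then 1 else 0) * (if i = b then 1 else 0)
            - (if j = b then 1 else 0) * (if i = a then 1 else 0) := by
        intro i j
        rw [h, pd_sub ((hd a x).const_mul _) ((hd b x).const_mul _), pd_const_mul (hd a x),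
          pd_const_mul (hd b x), pd_coord, pd_coord]
        by_cases h1 : j = a <;> by_cases h2 : j = b
        · subst h1; subst h2; ring
        · subst h1
          simp only [h2, if_true, if_false]
          linear_combination (if i = b then (1 : ℝ) else 0) * flatDiag_mul_self p j
        · subst h2
          simp only [h1, if_true, if_false]
          linear_combination -(if i = a then (1 : ℝ) else 0) * flatDiag_mul_self p j
        · simp [h1, h2]
      rw [hder, hder]
      simp only [Pi.zero_apply, mul_zero, zero_mul, ite_self]
      ring
    · refine ⟨contDiff_id, 1, fun x i j => ?_⟩
      rw [pd_coord, pd_coord]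
      by_cases hij : i = j
      · subst hij; simp; ring
      · simp [hij, Ne.symm hij]
    · have hq : ContDiff ℝ ∞ fun x : E n => ∑ j, lower p x j * x j :=
        ContDiff.sum fun j _ => (hlow j).mul (hco j)
      refine ⟨(hq.smul contDiff_const).sub ((contDiff_const.mul (hlow a)).smul contDiff_id),
        fun x => -2 * flatDiag n p a * x a, fun x i j => ?_⟩
      have h : ∀ i : Fin n, (fun y : E n => ((∑ j, lower p y j * y j) •
          EuclideanSpace.single a (1 : ℝ) - (2 * lower p y a) • y) i)
          = fun y => (if i = a then 1 else 0) * (∑ j, flatDiag n p j * (y j * y j))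
            - 2 * flatDiag n p a * (y a * y i) := by
        intro i; funext y
        simp only [lower, PiLp.sub_apply, PiLp.smul_apply, smul_eq_mul, PiLp.single_apply,
          mul_assoc]
        ring
      have hS : DifferentiableAt ℝ (fun y : E n => ∑ j, flatDiag n p j * (y j * y j)) x :=
        DifferentiableAt.fun_sum fun j _ => ((hd j x).fun_mul (hd j x)).const_mul _
      have hder : ∀ i j : Fin n, flatDiag n p j *
          pd j (fun y : E n => ((∑ j, lower p y j * y j) •
          EuclideanSpace.single a (1 : ℝ) - (2 * lower p y a) • y) i) x
          = (if i = a then 2 * x j else 0) - (if j = a then 2 * x i else 0)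
            - (if i = j then 2 * flatDiag n p i * flatDiag n p a * x a else 0) := by
        intro i j
        have hjj := flatDiag_mul_self p j
        rw [h, pd_sub (hS.const_mul _) (((hd a x).fun_mul (hd i x)).const_mul _), pd_const_mul hS,
          pd_const_mul ((hd a x).fun_mul (hd i x)), pd_mul (hd a x) (hd i x),
          pd_sum _ fun j _ => ((hd j x).fun_mul (hd j x)).const_mul _]
        simp only [pd_const_mul ((hd _ x).fun_mul (hd _ x)), pd_mul (hd _ x) (hd _ x), pd_coord]
        have hs : ∑ k, flatDiag n p k * ((if j = k then 1 else 0) * x k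
            + x k * (if j = k then 1 else 0)) = 2 * flatDiag n p j * x j := by
          rw [Finset.sum_eq_single j]
          · simp; ring
          · intro k _ hk; simp [Ne.symm hk]
          · simp
        rw [hs]
        by_cases h1 : j = a
        · subst h1
          by_cases h2 : i = j
          · subst h2
            simp only [if_true]
            ring
          · simp only [h2, Ne.symm h2, if_true, if_false]
            linear_combination (-2 * x i) * hjj
        · by_cases h2 : i = j
          · subst h2
            simp only [h1, if_true, if_false]
            ring
          · by_cases h3 : i = a
            · subst h3
              simp only [h1, h2, if_true, if_false]
              linear_combination (2 * x j) * hjj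
            · simp [h1, h2, h3, Ne.symm h2]
      rw [hder, hder]
      by_cases hij : i = j
      · subst hij
        simp only [if_true]
        ring
      · simp only [hij, Ne.symm hij, if_false]
        ring
  · refine ⟨contDiff_const, 0, fun x i j => ?_⟩
    simp [pd_const]
  · rintro X Y - - ⟨hX, c, hc⟩ ⟨hY, d, hd'⟩
    refine ⟨hX.add hY, c + d, fun x i j => ?_⟩
    have h : ∀ i j : Fin n, pd j (fun y => (X + Y) y i) x
        = pd j (fun y => X y i) x + pd j (fun y => Y y i) x := fun i j =>
      pd_add (hsm hX i x) (hsm hY i x) j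
    rw [h, h]
    have h1 := hc x i j
    have h2 := hd' x i j
    by_cases hij : i = j
    · simp only [hij, if_true, Pi.add_apply] at h1 h2 ⊢
      linear_combination h1 + h2
    · simp only [hij, if_false] at h1 h2 ⊢
      linear_combination h1 + h2
  · rintro r X - ⟨hX, c, hc⟩
    refine ⟨contDiff_const.smul hX, r • c, fun x i j => ?_⟩
    have h : ∀ i j : Fin n, pd j (fun y => (r • X) y i) x = r * pd j (fun y => X y i) x :=
      fun i j => pd_const_mul (hsm hX i x) r j
    rw [h, h]
    have h1 := hc x i j
    by_cases hij : i = j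
    · simp only [hij, if_true, Pi.smul_apply, smul_eq_mul] at h1 ⊢
      linear_combination r * h1
    · simp only [hij, if_false] at h1 ⊢
      linear_combination r * h1

/-- The Lie derivative of the trace symbols `f η` along a conformal vector field. -/
theorem lieSymbol2_diagonal (p : ℕ) (hn : 2 ≤ n) {X : E n → E n} (hX : X ∈ confAlg n p) (w : ℂ)
    {V : Set (E n)} (hV : IsOpen V) {P : E n → Matrix (Fin n) (Fin n) ℂ} {f : E n → ℂ}
    (hf : ContDiff ℝ ∞ f)
    (hP : ∀ x ∈ V, ∀ i j, P x i j = f x * if i = j then (flatDiag n p i : ℂ) else 0)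
    {x : E n} (hx : x ∈ V) (i j : Fin n) :
    lieSymbol2 w X P x i j
      = lieDensity (w - 2 / n) X f x * if i = j then (flatDiag n p i : ℂ) else 0 := by
  have hn0 : (n : ℂ) ≠ 0 := by
    have : n ≠ 0 := by omega
    exact_mod_cast this
  obtain ⟨hXs, c, hc⟩ := conformal_killing p hX
  have hXd : ∀ i, DifferentiableAt ℝ (fun y => X y i) x := fun i =>
    (EuclideanSpace.proj (𝕜 := ℝ) i).differentiableAt.comp x (diff_of_contDiff hXs x)
  have hdiv : divergence X x = n * c x := by
    have : ∀ i, pd i (fun y => X y i) x = c x := by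
      intro i
      have h1 := hc x i i
      simp only [if_true] at h1
      linear_combination (1 / 2 * flatDiag n p i) * h1
        - (pd i (fun y => X y i) x - c x) * flatDiag_mul_self p i
    simp [divergence, this]
  have hPd : ∀ k, pd k (fun y => P y i j) x
      = pd k f x * if i = j then (flatDiag n p i : ℂ) else 0 := by
    intro k
    rw [pd_congr hV (fun y hy => hP y hy i j) hx, pd_mul (diff_of_contDiff hf x)
      (differentiableAt_const _), pd_const]
    ring
  have hs1 : ∑ k, P x k j * ((pd k (fun y => X y i) x : ℝ) : ℂ)
      = f x * (flatDiag n p j * pd j (fun y => X y i) x : ℝ) := by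
    rw [Finset.sum_eq_single j]
    · rw [hP x hx]; simp; ring
    · intro k _ hk; rw [hP x hx]; simp [hk]
    · simp
  have hs2 : ∑ k, P x i k * ((pd k (fun y => X y j) x : ℝ) : ℂ)
      = f x * (flatDiag n p i * pd i (fun y => X y j) x : ℝ) := by
    rw [Finset.sum_eq_single i]
    · rw [hP x hx]; simp; ring
    · intro k _ hk; rw [hP x hx]; simp [Ne.symm hk]
    · simp
  have hk : ((flatDiag n p j * pd j (fun y => X y i) x : ℝ) : ℂ)
      + ((flatDiag n p i * pd i (fun y => X y j) x : ℝ) : ℂ)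
      = 2 * c x * if i = j then (flatDiag n p i : ℂ) else 0 := by
    rw [← Complex.ofReal_add, hc x i j]
    split_ifs <;> simp
  unfold lieSymbol2 lieDensity
  rw [hs1, hs2, hdiv, hP x hx i j]
  simp only [hPd, ← mul_assoc, ← Finset.sum_mul]
  push_cast at hk ⊢
  -- By the Killing equation the two terms moving the indices of f η amount to −2c f η; as div X =
  -- nc, this lowers the density weight by 2/n.
  have e : (w - 2 / (n : ℂ)) * (n * c x) = w * (n * c x) - 2 * c x := by
    field_simp
  linear_combination (-(f x)) * hk - (f x * if i = j then (flatDiag n p i : ℂ) else 0) * e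

end Killing

/-! ### Extension of smooth functions -/

section Extension

variable {n : ℕ}

/-- Multiply by a bump function. The neighbourhood W is fixed before f, so that several functions
can be extended on the same W. -/
theorem exists_contDiff_eq {U : Set (E n)} (hU : IsOpen U) {x₀ : E n} (hx : x₀ ∈ U) :
    ∃ W : Set (E n), IsOpen W ∧ x₀ ∈ W ∧ W ⊆ U ∧ ∀ f : E n → ℂ, ContDiffOn ℝ ∞ f U →
      ∃ f' : E n → ℂ, ContDiff ℝ ∞ f' ∧ ∀ y ∈ W, f' y = f y := by
  obtain ⟨r, hr, hrU⟩ := Metric.nhds_basis_closedBall.mem_iff.1 (hU.mem_nhds hx)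
  let χ : ContDiffBump x₀ := ⟨r / 2, r, half_pos hr, half_lt_self hr⟩
  refine ⟨Metric.ball x₀ (r / 2), Metric.isOpen_ball, Metric.mem_ball_self (half_pos hr),
    fun y hy => hrU (Metric.ball_subset_closedBall
      (Metric.ball_subset_ball (half_lt_self hr).le hy)), fun f hf =>
    ⟨fun y => χ y • f y, ?_, fun y hy => ?_⟩⟩
  · refine contDiff_iff_contDiffAt.2 fun y => ?_
    by_cases hy : y ∈ tsupport χ
    · have hyU : y ∈ U := hrU (by rwa [χ.tsupport_eq] at hy)
      exact χ.contDiff.contDiffAt.smul (hf.contDiffAt (hU.mem_nhds hyU))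
    · have h0 : χ =ᶠ[nhds y] 0 := notMem_tsupport_iff_eventuallyEq.1 hy
      have : (fun y => χ y • f y) =ᶠ[nhds y] fun _ => 0 := by
        filter_upwards [h0] with z hz
        simp [hz]
      exact contDiffAt_const.congr_of_eventuallyEq this
  · change χ y • f y = f y
    rw [χ.one_of_mem_closedBall (Metric.ball_subset_closedBall hy), one_smul]

variable {M : Type*} [TopologicalSpace M] [ChartedSpace (E n) M]

/-- Hausdorffness provides a bump function whose closed support lies in the chart domain, so its
product with f extends by zero to M. Again V does not depend on f. -/
theorem exists_contMDiff_eq [T2Space M] [IsManifold (𝓡 n) ∞ M] (e : Chart n M) {x₀ : E n}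
    (hx : x₀ ∈ e.1.target) :
    ∃ V : Set (E n), IsOpen V ∧ x₀ ∈ V ∧ V ⊆ e.1.target ∧
      ∀ f : E n → ℂ, ContDiffOn ℝ ∞ f e.1.target →
        ∃ u : M → ℂ, ContMDiff (𝓡 n) 𝓘(ℝ, ℂ) ∞ u ∧ ∀ y ∈ V, u (e.1.symm y) = f y := by
  set m := e.1.symm x₀ with hm
  have hms : m ∈ e.1.source := e.1.map_target hx
  obtain ⟨χ, -, hχ⟩ := (SmoothBumpFunction.nhds_basis_tsupport (I := 𝓡 n) m).mem_iff.1
    (e.1.open_source.mem_nhds hms)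
  have h1 : ∀ᶠ y in nhds x₀, χ (e.1.symm y) = 1 :=
    (e.1.symm.continuousAt hx).eventually χ.eventuallyEq_one
  obtain ⟨V, hV, hVo, hxV⟩ := eventually_nhds_iff.1 (h1.and (e.1.open_target.mem_nhds hx))
  refine ⟨V, hVo, hxV, fun y hy => (hV y hy).2, fun f hf =>
    ⟨fun z => χ z • f (e.1 z), ?_, fun y hy => ?_⟩⟩
  · refine contMDiff_of_tsupport fun z hz => ?_
    have hz' : z ∈ e.1.source := hχ (tsupport_smul_subset_left _ _ hz)
    have hfe : ContMDiffAt (𝓡 n) 𝓘(ℝ, ℂ) ∞ (fun z => f (e.1 z)) z := by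
      have h2 : ContMDiffAt 𝓘(ℝ, E n) 𝓘(ℝ, ℂ) ∞ f (e.1 z) :=
        (hf.contDiffAt (e.1.open_target.mem_nhds (e.1.map_source hz'))).contMDiffAt
      exact h2.comp z (contMDiffAt_of_mem_maximalAtlas e.2 hz')
    exact χ.contMDiffAt.smul hfe
  · change χ (e.1.symm y) • f (e.1 (e.1.symm y)) = f y
    rw [(hV y hy).1, e.1.right_inv (hV y hy).2, one_smul]

end Extension

/-! ### Densities and symbols with prescribed local expression -/

section Prescribed

variable {n : ℕ} {M : Type*} [TopologicalSpace M] [ChartedSpace (E n) M]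

theorem contDiffOn_comp_symm {u : M → ℂ} (hu : ContMDiff (𝓡 n) 𝓘(ℝ, ℂ) ∞ u) (e : Chart n M) :
    ContDiffOn ℝ ∞ (fun x => u (e.1.symm x)) e.1.target :=
  contMDiffOn_iff_contDiffOn.1 (hu.comp_contMDiffOn (contMDiffOn_symm_of_mem_maximalAtlas e.2))

theorem symm_transition {e e' : Chart n M} {x : E n} (hx : x ∈ overlap e e') :
    e'.1.symm (transition e e' x) = e.1.symm x :=
  e'.1.left_inv hx.2

/-- The product of a density and a smooth function. -/
def smulDensity {w : ℂ} {u : M → ℂ} (hu : ContMDiff (𝓡 n) 𝓘(ℝ, ℂ) ∞ u) (φ : Density n M w) :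
    Density n M w :=
  ⟨fun e x => u (e.1.symm x) * φ.1 e x, fun e x hx => by
      beta_reduce; rw [φ.2.1 e x hx, mul_zero],
    fun e => (contDiffOn_comp_symm hu e).mul (φ.2.2.1 e), fun e e' x hx => by
      beta_reduce; rw [φ.2.2.2 e e' x hx, symm_transition hx]; ring⟩

/-- The product of a second-order symbol and a smooth function. -/
def smulSymbol2 {w : ℂ} {u : M → ℂ} (hu : ContMDiff (𝓡 n) 𝓘(ℝ, ℂ) ∞ u) (P : Symbol2 n M w) :
    Symbol2 n M w :=
  ⟨fun e x => u (e.1.symm x) • P.1 e x, fun e x hx => by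
      beta_reduce; rw [P.2.1 e x hx, smul_zero],
    fun e i j => (contDiffOn_comp_symm hu e).mul (P.2.2.1 e i j),
    fun e x => by rw [Matrix.transpose_smul, P.2.2.2.1 e x], fun e e' x hx => by
      beta_reduce
      rw [Matrix.mul_smul, Matrix.smul_mul, P.2.2.2.2 e e' x hx, symm_transition hx, smul_comm]⟩

/-- The power `|vol_g|^w` of the metric density. -/
def volDensity [IsManifold (𝓡 n) ∞ M] (g : PseudoRiemannianMetric n M) (w : ℂ) : Density n M w :=
  ⟨fun e => e.1.target.indicator (volPow (g.coeff e) w), fun e x hx => by simp [hx],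
    fun e => ((g.isMetricOn e).smooth_volPow w).congr fun x hx => by simp [hx],
    fun e e' x hx => by
      have hx1 : x ∈ e.1.target := hx.1
      have hx2 : transition e e' x ∈ e'.1.target := e'.1.map_source hx.2
      simp only [hx1, hx2, Set.indicator_of_mem]
      exact (g.isIsometry e e').volPow_eq w hx⟩

/-- The metric supplies the global objects |vol|^w and H, which do not vanish; multiplying them by a
suitable globally defined function prescribes the local expression while respecting the
transformation laws. -/
theorem exists_density_symbol [T2Space M] [IsManifold (𝓡 n) ∞ M]
    (g : PseudoRiemannianMetric n M) (w z : ℂ) (e : Chart n M) {η : Fin n → ℝ} {κ : E n → ℝ}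
    (hc : IsConformalOn (g.coeff e) η κ e.1.target) {x₀ : E n} (hx : x₀ ∈ e.1.target) :
    ∃ V : Set (E n), IsOpen V ∧ x₀ ∈ V ∧ V ⊆ e.1.target ∧
      (∀ f : E n → ℂ, ContDiff ℝ ∞ f → ∃ φ : Density n M w, ∀ y ∈ V, φ.1 e y = f y) ∧
      (∀ f : E n → ℂ, ContDiff ℝ ∞ f → ∃ P : Symbol2 n M z, ∀ y ∈ V, ∀ i j,
        P.1 e y i j = f y * if i = j then (η i : ℂ) else 0) := by
  obtain ⟨V, hVo, hxV, hVe, hext⟩ := exists_contMDiff_eq e hx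
  refine ⟨V, hVo, hxV, hVe, fun f hf => ?_, fun f hf => ?_⟩
  · obtain ⟨u, hu, huf⟩ := hext (fun y => f y * volPow (g.coeff e) (-w) y)
      (hf.contDiffOn.mul ((g.isMetricOn e).smooth_volPow _))
    refine ⟨smulDensity hu (volDensity g w), fun y hy => ?_⟩
    simp only [smulDensity, volDensity, hVe hy, Set.indicator_of_mem, huf y hy]
    linear_combination f y * (g.isMetricOn e).volPow_neg w (hVe hy)
  -- The exponential is the inverse of e^{nzκ/2}e^{−κ}, the factor by which H differs from η in this
  -- chart.
  · obtain ⟨u, hu, huf⟩ := hext (fun y => f y * Complex.exp ((1 - n * z / 2) * (κ y : ℂ)))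
      (hf.contDiffOn.mul (contDiffOn_exp_mul hc.smooth _))
    refine ⟨smulSymbol2 hu (geodesicHamiltonian g z).1, fun y hy i j => ?_⟩
    have hy' := hVe hy
    have h1 : Complex.exp ((1 - n * z / 2) * (κ y : ℂ)) * (Complex.exp (n * z / 2 * (κ y : ℂ))
        * Complex.exp (-(κ y : ℂ))) = 1 := by
      rw [← Complex.exp_add, ← Complex.exp_add]
      convert Complex.exp_zero using 2
      ring
    simp only [smulSymbol2, geodesicHamiltonian, hy', Set.indicator_of_mem, huf y hy,
      Matrix.smul_apply, smul_eq_mul, Matrix.map_apply, hc.inv_eq hy', hc.volPow_eq z hy',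
      Matrix.diagonal_apply]
    split_ifs
    · push_cast
      linear_combination f y * (η i : ℂ) * h1
    · simp

end Prescribed

/-! ### Conformally equivariant quantization of the geodesic Hamiltonian -/

section Quantization

variable {n : ℕ} {M : Type*} [TopologicalSpace M] [ChartedSpace (E n) M]

theorem lieDensity_zero_field (w : ℂ) (f : E n → ℂ) (x : E n) : lieDensity w 0 f x = 0 := by
  simp [lieDensity, divergence, pd_const]

namespace IsConformallyEquivariantQuantization

variable {p : ℕ} {𝒜 : FlatConformalStructure n M p} {lam mu : ℂ}
  {Q : Symbol n M (mu - lam) →ₗ[ℂ] (Density n M lam →ₗ[ℂ] Density n M mu)}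

/-- Equivariant quantization maps are local in the symbol. -/
theorem local_symbol (hQ : IsConformallyEquivariantQuantization 𝒜 lam mu Q) {e : Chart n M}
    (he : e ∈ 𝒜.charts) {V : Set (E n)} (hV : IsOpen V) (hVe : V ⊆ e.1.target)
    (P P' : Symbol n M (mu - lam)) (h2 : ∀ x ∈ V, ∀ i j, P.1.1 e x i j = P'.1.1 e x i j)
    (h1 : ∀ x ∈ V, ∀ i, P.2.1.1 e x i = P'.2.1.1 e x i)
    (h0 : ∀ x ∈ V, P.2.2.1 e x = P'.2.2.1 e x) (φ : Density n M lam) {x : E n} (hx : x ∈ V) :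
    (Q P φ).1 e x = (Q P' φ).1 e x := by
  -- Take X = 0: a symbol vanishing on V is there the Lie derivative of the zero symbol along the
  -- zero field, so its quantization vanishes on V.
  have h := hQ.equivariant e he 0 (Submodule.zero_mem _) V hV hVe 0 (P - P') φ 0
    (fun x hx i j => by
      simp [lieSymbol2, divergence, pd_const, h2 x hx i j])
    (fun x hx i => by simp [lieSymbol1, divergence, pd_const, h1 x hx i])
    (fun x hx => by simp [lieDensity_zero_field, h0 x hx])
    (fun x _ => by rw [lieDensity_zero_field]; rfl) x hx
  rw [lieDensity_zero_field] at h
  simp only [map_sub, map_zero, LinearMap.sub_apply] at h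
  have h' : (Q P φ).1 e x - (Q P' φ).1 e x = 0 - 0 := h
  linear_combination h'

/-- Differential operators are local. -/
theorem local_density (hQ : IsConformallyEquivariantQuantization 𝒜 lam mu Q) {e : Chart n M}
    {V : Set (E n)} (hV : IsOpen V) (hVe : V ⊆ e.1.target) (P : Symbol n M (mu - lam))
    (φ φ' : Density n M lam) (h : ∀ x ∈ V, φ.1 e x = φ'.1 e x) {x : E n} (hx : x ∈ V) :
    (Q P φ).1 e x = (Q P φ').1 e x := by
  obtain ⟨a1, a0, -, -, -, hc⟩ := hQ.symbol_two P e
  rw [hc φ x (hVe hx), hc φ' x (hVe hx), h x hx]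
  simp only [pd_congr hV h hx, pd_congr hV (fun y hy => pd_congr hV h hy _) hx]

/-- The operation `(f, φ) ↦ Q(f η) φ` is a conformal pairing. -/
theorem isConformalPairing (hQ : IsConformallyEquivariantQuantization 𝒜 lam mu Q)
    (hn : 2 ≤ n) {e : Chart n M} (he : e ∈ 𝒜.charts) {V : Set (E n)} (hV : IsOpen V)
    (hVe : V ⊆ e.1.target) {x₀ : E n} (hx : x₀ ∈ V) (D : (E n → ℂ) → Density n M lam)
    (hD : ∀ f, ContDiff ℝ ∞ f → ∀ y ∈ V, (D f).1 e y = f y)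
    (S : (E n → ℂ) → Symbol2 n M (mu - lam))
    (hS : ∀ f, ContDiff ℝ ∞ f → ∀ y ∈ V, ∀ i j,
      (S f).1 e y i j = f y * if i = j then (flatDiag n p i : ℂ) else 0) :
    IsConformalPairing p x₀ (mu - lam - 2 / n) lam mu
      fun f φ => (Q (S f, 0, 0) (D φ)).1 e x₀ := by
  refine ⟨fun φ hφ => ⟨fun f g hf hg => ?_, fun c f hf => ?_⟩, fun f hf => ?_,
    fun X hX hX0 f φ hf hφ hXf hXφ => ?_⟩
  · have h := hQ.local_symbol he hV hVe (S fun x => f x + g x, 0, 0)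
      ((S f, 0, 0) + (S g, 0, 0)) (fun y hy i j => by
        change _ = (S f).1 e y i j + (S g).1 e y i j
        rw [hS _ (hf.add hg) y hy, hS _ hf y hy, hS _ hg y hy]; ring)
      (fun y hy i => by simp) (fun y hy => by simp) (D φ) hx
    change (Q (S fun x => f x + g x, 0, 0) (D φ)).1 e x₀ = _
    rw [h, map_add]
    rfl
  · have h := hQ.local_symbol he hV hVe (S fun x => c * f x, 0, 0)
      (c • (S f, 0, 0)) (fun y hy i j => by
        change _ = c * (S f).1 e y i j
        rw [hS _ (contDiff_const.mul hf) y hy, hS _ hf y hy]; ring)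
      (fun y hy i => by simp) (fun y hy => by simp) (D φ) hx
    change (Q (S fun x => c * f x, 0, 0) (D φ)).1 e x₀ = _
    rw [h, map_smul]
    rfl
  -- The prescribed principal symbol f η gives the second-order part; the lower coefficients are
  -- left unspecified.
  · obtain ⟨a1, a0, -, -, -, hc⟩ := hQ.symbol_two (S f, 0, 0) e
    refine ⟨a1 x₀, a0 x₀, fun φ hφ => ?_⟩
    rw [hc (D φ) x₀ (hVe hx), hD φ hφ x₀ hx]
    congr 1
    congr 1
    · rw [flatLaplace, Finset.mul_sum]
      refine Finset.sum_congr rfl fun i _ => ?_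
      rw [Finset.sum_eq_single i]
      · rw [hS f hf x₀ hx, pd_congr hV (fun y hy => pd_congr hV (hD φ hφ) hy i) hx]
        simp [mul_assoc]
      · intro j _ hj
        rw [hS f hf x₀ hx]; simp [Ne.symm hj]
      · simp
    · exact Finset.sum_congr rfl fun i _ => by rw [pd_congr hV (hD φ hφ) hx]
  · have h := hQ.equivariant e he X hX V hV hVe (S f, 0, 0)
      (S (lieDensity (mu - lam - 2 / n) X f), 0, 0) (D φ) (D (lieDensity lam X φ))
      (fun y hy i j => by
        rw [lieSymbol2_diagonal p hn hX _ hV hf (hS f hf) hy, hS _ hXf y hy])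
      (fun y hy i => by simp [lieSymbol1, pd_const])
      (fun y hy => by
        have : ((0 : Density n M (mu - lam)).1 e) = fun _ => 0 := rfl
        simp [lieDensity, this, pd_const])
      (fun y hy => by
        rw [hD _ hXφ y hy]
        simp only [lieDensity, hD φ hφ y hy, pd_congr hV (hD φ hφ) hy]) x₀ hx
    rw [lieDensity_of_zero x₀ mu hX0] at h
    exact h

end IsConformallyEquivariantQuantization

/-- The conformal factor is given only pointwise; reading it off from a single diagonal entry of g
shows that it, and hence its logarithm κ, is smooth. -/
theorem FlatConformalStructure.Represents.isConformalOn {p : ℕ}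
    {𝒜 : FlatConformalStructure n M p} {g : PseudoRiemannianMetric n M} (h : 𝒜.Represents g)
    (hn : 2 ≤ n) {e : Chart n M} (he : e ∈ 𝒜.charts) :
    ∃ κ : E n → ℝ, IsConformalOn (g.coeff e) (flatDiag n p) κ e.1.target := by
  let i₀ : Fin n := ⟨0, by omega⟩
  have hF : ∀ x ∈ e.1.target, 0 < flatDiag n p i₀ * g.coeff e x i₀ i₀ ∧
      g.coeff e x = (flatDiag n p i₀ * g.coeff e x i₀ i₀) • Matrix.diagonal (flatDiag n p) := by
    intro x hx
    obtain ⟨F, hF, hg⟩ := h e he x hx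
    have h1 : flatDiag n p i₀ * g.coeff e x i₀ i₀ = F := by
      rw [hg, Matrix.smul_apply, Matrix.diagonal_apply_eq, smul_eq_mul]
      linear_combination F * flatDiag_mul_self p i₀
    rw [h1]
    exact ⟨hF, hg⟩
  refine ⟨fun x => Real.log (flatDiag n p i₀ * g.coeff e x i₀ i₀), e.1.open_target,
    flatDiag_mul_self p, ?_, fun x hx => ?_⟩
  · exact (contDiffOn_const.mul (g.smooth e i₀ i₀)).log fun x hx => (hF x hx).1.ne'
  · rw [Real.exp_log (hF x hx).1]
    exact (hF x hx).2

theorem IsConformallyEquivariantQuantization.hamiltonian_adapted [T2Space M]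
    [IsManifold (𝓡 n) ∞ M] {p : ℕ} {𝒜 : FlatConformalStructure n M p} {lam mu : ℂ}
    {Q : Symbol n M (mu - lam) →ₗ[ℂ] (Density n M lam →ₗ[ℂ] Density n M mu)}
    (hQ : IsConformallyEquivariantQuantization 𝒜 lam mu Q) (hn : 2 ≤ n)
    {g : PseudoRiemannianMetric n M} (hg : 𝒜.Represents g) (hres : NonResonant n (mu - lam))
    (φ : Density n M lam) {e : Chart n M} (he : e ∈ 𝒜.charts) {x₀ : E n} (hx : x₀ ∈ e.1.target) :
    (Q (geodesicHamiltonian g (mu - lam)) φ).1 e x₀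
      = laplacePlusCurvature g lam mu (curvatureCoupling n lam mu) φ e x₀ := by
  obtain ⟨κ, hc⟩ := hg.isConformalOn hn he
  obtain ⟨V, hVo, hxV, hVe, hden, hsym⟩ := exists_density_symbol g lam (mu - lam) e hc hx
  -- Assigning 0 to non-smooth functions makes the choice of a density total in f; the same is done
  -- for symbols.
  have hden' : ∀ f : E n → ℂ, ∃ φ : Density n M lam, ContDiff ℝ ∞ f → ∀ y ∈ V, φ.1 e y = f y := by
    intro f
    by_cases hf : ContDiff ℝ ∞ f
    · obtain ⟨φ, h⟩ := hden f hf; exact ⟨φ, fun _ => h⟩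
    · exact ⟨0, fun h => absurd h hf⟩
  have hsym' : ∀ f : E n → ℂ, ∃ P : Symbol2 n M (mu - lam), ContDiff ℝ ∞ f → ∀ y ∈ V, ∀ i j,
      P.1 e y i j = f y * if i = j then (flatDiag n p i : ℂ) else 0 := by
    intro f
    by_cases hf : ContDiff ℝ ∞ f
    · obtain ⟨P, h⟩ := hsym f hf; exact ⟨P, fun _ => h⟩
    · exact ⟨0, fun h => absurd h hf⟩
  choose D hD using hden'
  choose S hS using hsym'
  have hB := hQ.isConformalPairing hn he hVo hVe hxV D hD S hS
  obtain ⟨W, hWo, hxW, hWe, hcut⟩ := exists_contDiff_eq e.1.open_target hx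
  set f : E n → ℂ := fun y => Complex.exp ((n * (mu - lam) / 2 - 1) * (κ y : ℂ)) with hf
  have hfs : ContDiffOn ℝ ∞ f e.1.target := contDiffOn_exp_mul hc.smooth _
  obtain ⟨f', hf's, hff'⟩ := hcut f hfs
  obtain ⟨φ', hφ's, hφφ'⟩ := hcut (φ.1 e) (φ.2.2.1 e)
  have hO : IsOpen (V ∩ W) := hVo.inter hWo
  have hOe : V ∩ W ⊆ e.1.target := fun y hy => hVe hy.1
  have hxO : x₀ ∈ V ∩ W := ⟨hxV, hxW⟩
  -- Near x₀ the Hamiltonian is f η. Locality in the symbol and in the density allows both arguments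
  -- to be replaced by extensions of their local expressions.
  have hQB : (Q (geodesicHamiltonian g (mu - lam)) φ).1 e x₀
      = (Q (S f', 0, 0) (D φ')).1 e x₀ := by
    refine (hQ.local_symbol he hO hOe (geodesicHamiltonian g (mu - lam)) (S f', 0, 0)
      (fun y hy i j => ?_) (fun y hy i => rfl) (fun y hy => rfl) φ hxO).trans ?_
    rotate_left
    · exact hQ.local_density hO hOe _ _ _
        (fun y hy => by rw [hD φ' hφ's y hy.1, hφφ' y hy.2]) hxO
    · have hy' := hOe hy
      rw [hS f' hf's y hy.1, hff' y hy.2]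
      simp only [geodesicHamiltonian, hy', Set.indicator_of_mem, Matrix.smul_apply, smul_eq_mul,
        Matrix.map_apply, hc.inv_eq hy', hc.volPow_eq _ hy', Matrix.diagonal_apply]
      have h1 : f y = Complex.exp (n * (mu - lam) / 2 * (κ y : ℂ)) * Complex.exp (-(κ y : ℂ)) := by
        simp only [hf, ← Complex.exp_add]; ring_nf
      rw [h1]
      split_ifs
      · push_cast; ring
      · simp
  obtain ⟨h1, h2, -⟩ := hres.ne hn
  have hn0 : (n : ℂ) ≠ 0 := by
    have : n ≠ 0 := by omega
    exact_mod_cast this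
  have hn1 : (n : ℂ) - 1 ≠ 0 := by
    rw [sub_ne_zero]; exact_mod_cast (by omega : n ≠ 1)
  -- With ν = δ − 2/n, the denominators nν and n−2−2nν of the classification become nδ−2 and
  -- n+2−2nδ, nonzero by non-resonance.
  have e1 : (n : ℂ) * (mu - lam - 2 / n) = n * (mu - lam) - 2 := by field_simp
  have e2 : (n : ℂ) - 2 - 2 * n * (mu - lam - 2 / n) = n + 2 - 2 * n * (mu - lam) := by
    linear_combination (-2 : ℂ) * e1
  have hmain := hB.eq (by linear_combination -e1) (by rwa [e1]) (by rwa [e2]) hf's hφ's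
  rw [e1, e2] at hmain
  have hfW : ∀ i, ∀ y ∈ W, pd i f' y = pd i f y := fun i y hy => pd_congr hWo hff' hy i
  have hφW : ∀ i, ∀ y ∈ W, pd i φ' y = pd i (φ.1 e) y := fun i y hy => pd_congr hWo hφφ' hy i
  rw [hQB, hmain, laplacePlusCurvature,
    hc.laplace_add_curvatureOp hn1 h1 h2 (φ.2.2.1 e) hx f (fun y _ => rfl)]
  simp only [flatLaplace, flatGrad, hff' x₀ hxW, hφφ' x₀ hxW, hfW _ x₀ hxW, hφW _ x₀ hxW,
    pd_congr hWo (hfW _) hxW, pd_congr hWo (hφW _) hxW]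

/-- H is homogeneous of degree two, so the rescaling multiplies it by (iħ)² = −ħ². Both sides are
μ-densities, so it is enough to compare them in an adapted chart around the point. -/
theorem IsConformallyEquivariantQuantization.hamiltonian [T2Space M]
    [IsManifold (𝓡 n) ∞ M] {p : ℕ} {𝒜 : FlatConformalStructure n M p} {lam mu : ℂ}
    {Q : Symbol n M (mu - lam) →ₗ[ℂ] (Density n M lam →ₗ[ℂ] Density n M mu)}
    (hQ : IsConformallyEquivariantQuantization 𝒜 lam mu Q) (hn : 2 ≤ n)
    {g : PseudoRiemannianMetric n M} (hg : 𝒜.Represents g) (hres : NonResonant n (mu - lam))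
    (hbar : ℝ) (φ : Density n M lam) (e : Chart n M) {x : E n} (hx : x ∈ e.1.target) :
    (Q (symbolScale n M _ hbar (geodesicHamiltonian g (mu - lam))) φ).1 e x
      = -(hbar : ℂ) ^ 2 * laplacePlusCurvature g lam mu (curvatureCoupling n lam mu) φ e x := by
  have hscale : symbolScale n M _ hbar (geodesicHamiltonian g (mu - lam))
      = (-(hbar : ℂ) ^ 2) • geodesicHamiltonian g (mu - lam) := by
    have hI : (Complex.I * hbar) ^ 2 = -(hbar : ℂ) ^ 2 := by
      rw [mul_pow, Complex.I_sq]; ring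
    refine Prod.ext ?_ (Prod.ext ?_ ?_)
    · simp only [symbolScale, Prod.smul_fst, hI]
    · simp [symbolScale, geodesicHamiltonian]
    · simp [symbolScale, geodesicHamiltonian]
  rw [hscale, map_smul]
  change -(hbar : ℂ) ^ 2 * (Q (geodesicHamiltonian g (mu - lam)) φ).1 e x = _
  congr 1
  obtain ⟨e', he', hm⟩ := 𝒜.cover (e.1.symm x)
  have hxo : x ∈ overlap e e' := ⟨hx, hm⟩
  rw [(Q (geodesicHamiltonian g (mu - lam)) φ).2.2.2 e e' x hxo,
    hQ.hamiltonian_adapted hn hg hres φ he' (x₀ := transition e e' x) (e'.1.map_source hm),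
    laplacePlusCurvature_transform g lam mu _ φ e e' hxo]

end Quantization

/-! ### Half-densities. -/

theorem nonResonant_half {n : ℕ} (hn : 2 ≤ n) : NonResonant n ((1 / 2 : ℂ) - 1 / 2) := by
  have hn0 : (n : ℂ) ≠ 0 := by
    have : n ≠ 0 := by omega
    exact_mod_cast this
  have h1 : (n : ℂ) + 1 ≠ 0 := by exact_mod_cast (by omega : n + 1 ≠ 0)
  have h2 : (n : ℂ) + 2 ≠ 0 := by exact_mod_cast (by omega : n + 2 ≠ 0)
  simp only [NonResonant, sub_self, Set.mem_insert_iff, Set.mem_singleton_iff, not_or]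
  exact ⟨(div_ne_zero two_ne_zero hn0).symm,
    (div_ne_zero h2 (mul_ne_zero two_ne_zero hn0)).symm, zero_ne_one,
    (div_ne_zero h1 hn0).symm, (div_ne_zero h2 hn0).symm⟩

theorem curvatureCoupling_half {n : ℕ} (hn : 2 ≤ n) :
    curvatureCoupling n (1 / 2) (1 / 2) = -((n : ℂ) ^ 2 / (4 * (n - 1) * (n + 2))) := by
  have h1 : (n : ℂ) - 1 ≠ 0 := by
    rw [sub_ne_zero]; exact_mod_cast (by omega : n ≠ 1)
  have h2 : (n : ℂ) + 2 ≠ 0 := by exact_mod_cast (by omega : n + 2 ≠ 0)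
  unfold curvatureCoupling
  rw [sub_self, mul_zero, sub_zero]
  field_simp
  norm_num

end ConfQuant

open ConfQuant in
theorem proposition4p3 (n : ℕ) (hn : 2 ≤ n)
    (M : Type*) [TopologicalSpace M] [T2Space M] [ChartedSpace (E n) M] [IsManifold (𝓡 n) ∞ M]
    (g : PseudoRiemannianMetric n M) (hbar : ℝ) :
    (∀ lam mu : ℂ, NonResonant n (mu - lam) →
      (3 ≤ n → ∀ (φ : Density n M lam) (e : Chart n M), ∀ x ∈ e.1.target,
        quantize g lam mu (symbolScale n M _ hbar (geodesicHamiltonian g (mu - lam))) φ e x =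
          -(hbar : ℂ) ^ 2 *
            laplacePlusCurvature g lam mu (curvatureCoupling n lam mu) φ e x) ∧
      (∀ (p : ℕ) (_ : p ≤ n) (𝒜 : FlatConformalStructure n M p), 𝒜.Represents g →
        ∀ Q : Symbol n M (mu - lam) →ₗ[ℂ] (Density n M lam →ₗ[ℂ] Density n M mu),
        IsConformallyEquivariantQuantization 𝒜 lam mu Q →
        ∀ (φ : Density n M lam) (e : Chart n M), ∀ x ∈ e.1.target,
          (Q (symbolScale n M _ hbar (geodesicHamiltonian g (mu - lam))) φ).1 e x =
            -(hbar : ℂ) ^ 2 *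
              laplacePlusCurvature g lam mu (curvatureCoupling n lam mu) φ e x)) ∧
    (NonResonant n ((1 / 2 : ℂ) - 1 / 2) ∧
      curvatureCoupling n (1 / 2) (1 / 2) = -((n : ℂ) ^ 2 / (4 * (n - 1) * (n + 2)))) := by
  refine ⟨fun lam mu hres => ⟨fun h3 φ e x hx => quantize_hamiltonian h3 g hbar hres φ e hx,
    fun p _ 𝒜 hg Q hQ φ e x hx => hQ.hamiltonian hn hg hres hbar φ e hx⟩,
    nonResonant_half hn, curvatureCoupling_half hn⟩
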